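/- Let $N\ge 1$, $s\in(0,1)$, $p\in(1,\infty)$, $\alpha\in(0,s)$ and $\beta=sp-\alpha(p-1)$. Let $\psi:\mathbb R^N\to\mathbb R^N$ be a $C^{1,1}$-diffeomorphism (a bijection such that $\psi,\psi^{-1}$ are $C^1$ with Lipschitz derivatives) with $\psi(x)=x$ for $|x|\ge R$, for some $R>0$. For $\lambda\ge 0$ put $U_\lambda(t)=\big((t+\lambda^{1/\alpha})^+\big)^\alpha$ for $t\in\mathbb R$, and $W_\lambda(x)=U_\lambda(\psi^{-1}(x)\cdot e_N)$ for $x\in\mathbb R^N$. **Notation.** $[t]^{p-1}=|t|^{p-2}t$. For a set $K$, $W^{s,p}(K)$ consists of the $u\in L^p(K)$ with $\iint_{K\times K}\frac{|u(x)-u(y)|^p}{|x-y|^{N+sp}}\,dx\,dy<\infty$, and $W^{s,p}_0(\Omega)=\{\phi\in W^{s,p}(\mathbb R^N):\phi=0\text{ a.e. in }\mathbb R^N\setminus\Omega\}$. For bounded $\Omega$, $\overline W^{s,p}(\Omega)$ consists of the $u\in L^p_{loc}(\mathbb R^N)$ with $\int_{\mathbb R^N}\frac{|u(x)|^{p-1}}{(1+|x|)^{N+sp}}\,dx<\infty$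 that lie in $W^{s,p}(K)$ for some open $K\supset\overline\Omega$. For a bounded open $\Omega$, $(-\Delta)^s_pu\le f$ (resp. $\ge f$) holds *E-weakly in* $\Omega$ if $u\in\overline W^{s,p}(\Omega)$ and, for all $\phi\in W^{s,p}_0(\Omega)$ with $\phi\ge0$, both integrals below converge absolutely and $$\iint_{\mathbb R^{2N}}\frac{[u(x)-u(y)]^{p-1}(\phi(x)-\phi(y))}{|x-y|^{N+sp}}\,dx\,dy\ \le\ (\text{resp. }\ge)\ \int_\Omega f\phi\,dx .$$ For a general open $\Omega$ it holds E-weakly in $\Omega$ if it does so in every bounded open $\Omega'\subset\Omega$. **Theorem.** There exist $\rho^*>0$ and $\lambda^*>0$, depending only on $\psi$ (and $N,s,p,\alpha$), such that for every $\rho\in(0,\rho^*)$ there is a constant $\tilde C>0$, independent of $\lambda$, such that for every $\lambda\in[0,\lambda^*]$ the estimate $$\frac1{\tilde C}\,W_\lambda(x)^{-\beta/\alpha}\ \le\ (-\Delta)^s_pW_\lambda(x)\ \le\ \tilde C\,W_\lambda(x)^{-\beta/\alpha}$$ holds 1. E-weakly in $\psi(\{X\in\mathbb R^N:0<X_N<\rho\})$,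 provided $\lambda>0$ or $\alpha>s-\frac1p$; 2. without that proviso, E-weakly in every bounded open $\Omega'$ with $\overline{\Omega'}\subset\psi(\{X\in\mathbb R^N:0<X_N<\rho\})$. -/

import Mathlib

open MeasureTheory

noncomputable section

namespace FracPLaplace

/-- The Euclidean space `ℝ^N`. -/
abbrev Euc (N : ℕ) : Type := EuclideanSpace ℝ (Fin N)

/-- The odd power `[t]^{p-1} = |t|^{p-2} t`. -/
def oddPow (p t : ℝ) : ℝ := |t| ^ (p - 2) * t

/-- `u` belongs to the fractional Sobolev space `W^{s,p}(K)`: it is in `L^p(K)` and its Gagliardo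
seminorm over `K × K` is finite. -/
def MemWsp {N : ℕ} (s p : ℝ) (K : Set (Euc N)) (u : Euc N → ℝ) : Prop :=
  MemLp u (ENNReal.ofReal p) (volume.restrict K) ∧
  IntegrableOn (fun z : Euc N × Euc N => |u z.1 - u z.2| ^ p / ‖z.1 - z.2‖ ^ ((N : ℝ) + s * p))
    (K ×ˢ K)

/-- `W_0^{s,p}(Ω)`: the functions of `W^{s,p}(ℝ^N)` that vanish almost everywhere outside `Ω`. -/
def MemWspZero {N : ℕ} (s p : ℝ) (Ω : Set (Euc N)) (φ : Euc N → ℝ) : Prop :=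
  MemWsp s p Set.univ φ ∧ ∀ᵐ x : Euc N, x ∉ Ω → φ x = 0

/-- The space `W̄^{s,p}(Ω)` for a bounded set `Ω`: functions in `L^p_loc(ℝ^N)` that are in
`W^{s,p}(K)` for some open neighbourhood `K` of the (compact) closure of `Ω` and whose tail
`∫ |u|^{p-1} / (1+|x|)^{N+sp}` is finite. -/
def MemWspBar {N : ℕ} (s p : ℝ) (Ω : Set (Euc N)) (u : Euc N → ℝ) : Prop :=
  (∀ K : Set (Euc N), IsCompact K → MemLp u (ENNReal.ofReal p) (volume.restrict K)) ∧
  (∃ K : Set (Euc N), IsOpen K ∧ closure Ω ⊆ K ∧ MemWsp s p K u) ∧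
  Integrable (fun x : Euc N => |u x| ^ (p - 1) / (1 + ‖x‖) ^ ((N : ℝ) + s * p))

/-- The integrand of the weak form of `(-Δ)^s_p u` tested with `φ`. -/
def energyIntegrand {N : ℕ} (s p : ℝ) (u φ : Euc N → ℝ) (z : Euc N × Euc N) : ℝ :=
  oddPow p (u z.1 - u z.2) * (φ z.1 - φ z.2) / ‖z.1 - z.2‖ ^ ((N : ℝ) + s * p)

/-- `(-Δ)^s_p u ≤ f` E-weakly in the bounded open set `Ω`. Both sides of the inequality are
required to be honest (absolutely convergent) integrals; for `f ∈ L^{p'}(Ω)` and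
`u ∈ W̄^{s,p}(Ω)` this is automatic. -/
def IsEWeakSubBdd {N : ℕ} (s p : ℝ) (Ω : Set (Euc N)) (u f : Euc N → ℝ) : Prop :=
  MemWspBar s p Ω u ∧
  ∀ φ : Euc N → ℝ, MemWspZero s p Ω φ → (∀ᵐ x : Euc N, 0 ≤ φ x) →
    Integrable (energyIntegrand s p u φ) ∧ IntegrableOn (fun x => f x * φ x) Ω ∧
    ∫ z, energyIntegrand s p u φ z ≤ ∫ x in Ω, f x * φ x

/-- `(-Δ)^s_p u ≥ f` E-weakly in the bounded open set `Ω`. -/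
def IsEWeakSuperBdd {N : ℕ} (s p : ℝ) (Ω : Set (Euc N)) (u f : Euc N → ℝ) : Prop :=
  MemWspBar s p Ω u ∧
  ∀ φ : Euc N → ℝ, MemWspZero s p Ω φ → (∀ᵐ x : Euc N, 0 ≤ φ x) →
    Integrable (energyIntegrand s p u φ) ∧ IntegrableOn (fun x => f x * φ x) Ω ∧
    ∫ x in Ω, f x * φ x ≤ ∫ z, energyIntegrand s p u φ z

/-- `(-Δ)^s_p u ≤ f` E-weakly in an arbitrary open set `Ω`, i.e. in every bounded open subset
(for bounded `Ω` this is the same as `IsEWeakSubBdd`). -/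
def IsEWeakSub {N : ℕ} (s p : ℝ) (Ω : Set (Euc N)) (u f : Euc N → ℝ) : Prop :=
  ∀ Ω' : Set (Euc N), IsOpen Ω' → Bornology.IsBounded Ω' → Ω' ⊆ Ω → IsEWeakSubBdd s p Ω' u f

/-- `(-Δ)^s_p u ≥ f` E-weakly in an arbitrary open set `Ω`, i.e. in every bounded open subset. -/
def IsEWeakSuper {N : ℕ} (s p : ℝ) (Ω : Set (Euc N)) (u f : Euc N → ℝ) : Prop :=
  ∀ Ω' : Set (Euc N), IsOpen Ω' → Bornology.IsBounded Ω' → Ω' ⊆ Ω → IsEWeakSuperBdd s p Ω' u f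

/-- A `C^{1,1}`-diffeomorphism of `ℝ^N`: a bijection of class `C^1` with inverse of class `C^1`,
both with Lipschitz derivative. -/
structure IsC11Diffeo {N : ℕ} (ψ : Euc N ≃ Euc N) : Prop where
  contDiff : ContDiff ℝ 1 ψ
  contDiff_symm : ContDiff ℝ 1 ψ.symm
  lipschitz_fderiv : ∃ K, LipschitzWith K (fderiv ℝ ψ)
  lipschitz_fderiv_symm : ∃ K, LipschitzWith K (fderiv ℝ ψ.symm)

/-- The one-dimensional barrier `U_λ(t) = ((t + λ^{1/α})^+)^α`. -/
def barrierU (α lam t : ℝ) : ℝ := (max (t + lam ^ (1 / α)) 0) ^ α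

/-- The last coordinate `X_N = X · e_N` on `ℝ^N`, `N ≥ 1`. -/
def lastCoord {N : ℕ} (hN : 1 ≤ N) (X : Euc N) : ℝ := X ⟨N - 1, by omega⟩

/-- The transported barrier `W_λ(x) = U_λ(ψ⁻¹(x) · e_N)`. -/
def barrierW {N : ℕ} (hN : 1 ≤ N) (α lam : ℝ) (ψ : Euc N ≃ Euc N) (x : Euc N) : ℝ :=
  barrierU α lam (lastCoord hN (ψ.symm x))

/-- The exponent `β = sp - α(p-1)`. -/
def betaExp (s p α : ℝ) : ℝ := s * p - α * (p - 1)

/-- The image `ψ({X : 0 < X_N < ρ})` of the strip. -/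
def imageStrip {N : ℕ} (hN : 1 ≤ N) (ψ : Euc N ≃ Euc N) (ρ : ℝ) : Set (Euc N) :=
  ψ '' {X | 0 < lastCoord hN X ∧ lastCoord hN X < ρ}

end FracPLaplace

end

noncomputable section

namespace FracPLaplace

/-! Write `L` for the shifted level `ψ⁻¹(x)·e_N + λ^{1/α}`, so that `W_λ = (L^+)^α`.

Dimension one. By dilation, the operator applied to `t_+^α` at `L > 0` is a constant times `L^{-β}`;
the point is that the constant is positive. The integral is truncated multiplicatively: only values
`v ≤ rL` or `v ≥ L/r` are kept. For `L = 1`, the half-line `v ≤ 0` contributes `1/(sp)` and the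
inversion `v ↦ 1/v` folds `[1/r, ∞)` onto `(0, r]`, so the constant is `1/(sp) + ∫₀^r
foldedDensity`. At `α = s` the density has an explicit antiderivative and the total over `(0, 1]` is
zero (`integral_critical_density`), which is the harmonicity of `t_+^s`. For `α < s` the density is
strictly larger at every point, so the constant is bounded below by a positive number, uniformly in
`r` (`exists_bounds_integral_foldedDensity`, `exists_bounds_integral_farSet`).

Dimension `N`. After pulling back by `ψ` and freezing the derivative at one point, the kernel is
homogeneous, and integrating it over hyperplanes `h_N = t` leaves a multiple of `|t|^{-(1+sp)}`,
with factor between two positive bounds (`exists_lintegral_lastCoord_bounds`). The `C^{1,1}`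
regularity gives the freezing error an extra factor `min 1 |h|` (`exists_kernel_sub_le`). Its
contribution therefore converges absolutely without truncation and is `o(L^{-β})` as `L → 0`
(`exists_lintegral_posPow_sub_pow_min_le`). Hence there are two-sided bounds uniform in `r` as soon
as `L < l` (`exists_bounds_truncated`); this `l` determines `ρ*` and `λ*`.

Weak form. The retained set of pairs is symmetric and the kernel antisymmetric, so the truncated
weak form equals `2 ∫ φ · (truncated operator)`. Dominated convergence as `r → 1` then gives the
estimate (`exists_weak_bounds`). Integrability comes from Young's and Hardy's inequalities together
with integrability of `L^{(α-s)p}` near the closure of the domain. Only this last condition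
distinguishes the two cases: it holds up to the boundary if `λ > 0` or `α > s - 1/p`, and always
away from it. -/

/-! ### Integrating homogeneous kernels over hyperplanes -/

lemma exists_lastCoord_splitting {N : ℕ} (hN : 1 ≤ N) :
    ∃ T : (ℝ × (Fin (N - 1) → ℝ)) →ₗ[ℝ] Euc N, MeasurePreserving T volume volume ∧
      (∀ z, lastCoord hN (T z) = z.1) ∧ ∀ z, ‖z‖ ≤ ‖T z‖ := by
  obtain ⟨n, rfl⟩ : ∃ n, N = n + 1 := ⟨N - 1, by omega⟩
  have hlast : ∀ h : n + 1 - 1 < n + 1, (⟨n + 1 - 1, h⟩ : Fin (n + 1)) = Fin.last n :=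
    fun h => rfl
  have hco : ∀ (x : Euc (n + 1)) i, |x i| ≤ ‖x‖ := fun x i => by
    simpa using PiLp.norm_apply_le x i
  let T : (ℝ × (Fin n → ℝ)) →ₗ[ℝ] Euc (n + 1) :=
    { toFun := fun z => WithLp.toLp 2 ((Fin.last n).insertNth z.1 z.2 : Fin (n + 1) → ℝ)
      map_add' := fun z w => by
        ext i
        refine Fin.lastCases ?_ (fun j => ?_) i <;> simp
      map_smul' := fun c z => by
        ext i
        refine Fin.lastCases ?_ (fun j => ?_) i <;> simp }
  have hT0 : ∀ z, T z (Fin.last n) = z.1 := fun z => by simp [T]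
  have hTj : ∀ z j, T z (Fin.castSucc j) = z.2 j := fun z j => by simp [T]
  refine ⟨T, ?_, fun z => ?_, fun z => ?_⟩
  · have h1 := (volume_preserving_piFinSuccAbove (fun _ : Fin (n + 1) => ℝ) (Fin.last n)).symm
    have h2 := PiLp.volume_preserving_toLp (Fin (n + 1))
    exact h2.comp h1
  · exact hT0 z
  · rw [Prod.norm_def, max_le_iff]
    constructor
    · rw [← hT0 z]; exact hco _ _
    · rw [pi_norm_le_iff_of_nonneg (norm_nonneg _)]
      intro j
      rw [← hTj z j]; exact hco _ _

/-- Scaling of a Lebesgue integral over a finite-dimensional coordinate space. -/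
lemma lintegral_pi_eq_mul_comp_smul {n : ℕ} (g : (Fin n → ℝ) → ENNReal) (hg : Measurable g) {c : ℝ}
    (hc : c ≠ 0) : ∫⁻ k, g k = ENNReal.ofReal (|c| ^ n) * ∫⁻ k, g (c • k) := by
  have h := Measure.map_addHaar_smul (volume : Measure (Fin n → ℝ)) hc
  have h2 : ∫⁻ k, g (c • k) = ENNReal.ofReal |(c ^ n)⁻¹| * ∫⁻ k, g k := by
    rw [← lintegral_map hg (measurable_const_smul c), h, lintegral_smul_measure]
    simp
  have hpos : 0 < |c| ^ n := by positivity
  rw [h2, ← mul_assoc, ← ENNReal.ofReal_mul hpos.le, abs_inv, abs_pow, mul_inv_cancel₀ hpos.ne']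
  simp

lemma measurable_lastCoord {N : ℕ} (hN : 1 ≤ N) : Measurable (lastCoord hN) := by
  unfold lastCoord; fun_prop

/-- On the hyperplane at height `t` the substitution `k ↦ t k` has Jacobian `|t|^{N-1}`, and
homogeneity of the norm extracts `|t|^{-r}`. What remains is the integral over the hyperplane at
height `1`, which is `κ`; it is finite exactly because `r > N - 1`. -/
theorem exists_lintegral_lastCoord {N : ℕ} (hN : 1 ≤ N) {r m : ℝ} (hr : (N : ℝ) - 1 < r)
    (hm : 0 < m) (A : Euc N →L[ℝ] Euc N) (hA : ∀ h, m * ‖h‖ ≤ ‖A h‖) :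
    ∃ κ : ℝ, 0 < κ ∧ ∀ f : ℝ → ENNReal, Measurable f →
      ∫⁻ h, f (lastCoord hN h) * ENNReal.ofReal (‖A h‖ ^ (-r)) =
        ENNReal.ofReal κ * ∫⁻ t, f t * ENNReal.ofReal (|t| ^ (-(r - (N - 1)))) := by
  obtain ⟨T, hT, hT1, hTn⟩ := exists_lastCoord_splitting hN
  have hr0 : 0 < r := lt_of_le_of_lt (by simpa using hN) hr
  set I : ENNReal := ∫⁻ k : Fin (N - 1) → ℝ, ENNReal.ofReal (‖A (T (1, k))‖ ^ (-r)) with hI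
  have hTc : Continuous T := T.continuous_of_finiteDimensional
  have hTl : ∀ k : Fin (N - 1) → ℝ, 1 ≤ ‖T (1, k)‖ ∧ ‖k‖ ≤ ‖T (1, k)‖ := fun k => by
    have := hTn (1, k)
    rw [Prod.norm_def, max_le_iff] at this
    simpa using this
  -- `‖T (1, k)‖` dominates both `1` and `‖k‖`, hence their average.
  have hlow : ∀ k : Fin (N - 1) → ℝ, m / 2 * (1 + ‖k‖) ≤ ‖A (T (1, k))‖ := fun k => by
    have h1 := hA (T (1, k))
    obtain ⟨h2, h3⟩ := hTl k
    nlinarith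
  have hmeas : Measurable fun k : Fin (N - 1) → ℝ => ENNReal.ofReal (‖A (T (1, k))‖ ^ (-r)) := by
    have : Continuous fun k : Fin (N - 1) → ℝ => A (T (1, k)) := by fun_prop
    exact ((this.norm.measurable).pow_const _).ennreal_ofReal
  have hIfin : I ≠ ⊤ := by
    have hint : Integrable (fun k : Fin (N - 1) → ℝ => (m / 2) ^ (-r) * (1 + ‖k‖) ^ (-r)) := by
      refine (integrable_one_add_norm ?_).const_mul _
      rw [Module.finrank_fin_fun, Nat.cast_sub hN]; simpa using hr
    refine ne_top_of_le_ne_top hint.lintegral_lt_top.ne (lintegral_mono fun k => ?_)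
    refine ENNReal.ofReal_le_ofReal ?_
    rw [← Real.mul_rpow (by positivity) (by positivity)]
    exact Real.rpow_le_rpow_of_nonpos (by positivity) (hlow k) (by linarith)
  have hIpos : I ≠ 0 := by
    rw [hI, Ne, lintegral_eq_zero_iff hmeas]
    intro h0
    have : ∀ᵐ k : Fin (N - 1) → ℝ, False := by
      filter_upwards [h0] with k hk
      have h1 : 0 < ‖A (T (1, k))‖ := lt_of_lt_of_le (by positivity) (hlow k)
      have h2 : 0 < ‖A (T (1, k))‖ ^ (-r) := Real.rpow_pos_of_pos h1 _
      simp at hk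
      linarith
    have h1 : (volume : Measure (Fin (N - 1) → ℝ)) = 0 := by simpa using this
    exact isOpen_univ.measure_ne_zero volume Set.univ_nonempty (by rw [h1]; simp)
  refine ⟨I.toReal, ENNReal.toReal_pos hIpos hIfin, fun f hf => ?_⟩
  rw [ENNReal.ofReal_toReal hIfin]
  have hmA : Measurable fun h : Euc N => ENNReal.ofReal (‖A h‖ ^ (-r)) :=
    ((A.continuous.norm.measurable).pow_const _).ennreal_ofReal
  have hm1 : Measurable fun h : Euc N =>
      f (lastCoord hN h) * ENNReal.ofReal (‖A h‖ ^ (-r)) :=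
    (hf.comp (measurable_lastCoord hN)).mul hmA
  rw [← hT.lintegral_comp hm1, Measure.volume_eq_prod, lintegral_prod _ (by
    exact (hm1.comp hTc.measurable).aemeasurable), mul_comm, ← lintegral_mul_const]
  swap
  · exact hf.mul (by fun_prop)
  refine lintegral_congr_ae ?_
  have hne : ∀ᵐ t : ℝ, t ≠ 0 := by simp [ae_iff]
  filter_upwards [hne] with t ht
  simp only [hT1]
  have hmt : Measurable fun k : Fin (N - 1) → ℝ => ENNReal.ofReal (‖A (T (t, k))‖ ^ (-r)) := by
    have : Continuous fun k : Fin (N - 1) → ℝ => T (t, k) := by fun_prop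
    exact hmA.comp this.measurable
  rw [lintegral_const_mul _ hmt, mul_assoc]
  congr 1
  rw [lintegral_pi_eq_mul_comp_smul _ hmt ht]
  have hs : ∀ k : Fin (N - 1) → ℝ, ENNReal.ofReal (‖A (T (t, t • k))‖ ^ (-r)) =
      ENNReal.ofReal (|t| ^ (-r)) * ENNReal.ofReal (‖A (T (1, k))‖ ^ (-r)) := fun k => by
    have : ((t, t • k) : ℝ × (Fin (N - 1) → ℝ)) = t • (1, k) := by simp
    rw [this, map_smul, map_smul, norm_smul, Real.norm_eq_abs,
      Real.mul_rpow (abs_nonneg _) (norm_nonneg _), ENNReal.ofReal_mul (by positivity)]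
  simp only [hs]
  rw [lintegral_const_mul _ hmeas, ← mul_assoc, ← ENNReal.ofReal_mul (by positivity)]
  congr 2
  have ht' : 0 < |t| := abs_pos.mpr ht
  rw [← Real.rpow_natCast, ← Real.rpow_add ht', Nat.cast_sub hN]
  congr 1
  push_cast
  ring

/-- A uniform version of `exists_lintegral_lastCoord` over linear maps with the same bounds. -/
theorem exists_lintegral_lastCoord_bounds {N : ℕ} (hN : 1 ≤ N) {r m M : ℝ}
    (hr : (N : ℝ) - 1 < r) (hm : 0 < m) (hM : 0 < M) :
    ∃ κ₀ κ₁ : ℝ, 0 < κ₀ ∧ 0 < κ₁ ∧ ∀ A : Euc N →L[ℝ] Euc N,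
      (∀ h, m * ‖h‖ ≤ ‖A h‖) → (∀ h, ‖A h‖ ≤ M * ‖h‖) →
      ∃ κ : ℝ, κ₀ ≤ κ ∧ κ ≤ κ₁ ∧ ∀ f : ℝ → ENNReal, Measurable f →
        ∫⁻ h, f (lastCoord hN h) * ENNReal.ofReal (‖A h‖ ^ (-r)) =
          ENNReal.ofReal κ * ∫⁻ t, f t * ENNReal.ofReal (|t| ^ (-(r - (N - 1)))) := by
  have hr0 : 0 < r := lt_of_le_of_lt (by simpa using hN) hr
  obtain ⟨k, hk, hkf⟩ := exists_lintegral_lastCoord hN hr one_pos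
    (ContinuousLinearMap.id ℝ (Euc N)) (by simp)
  refine ⟨M ^ (-r) * k, m ^ (-r) * k, by positivity, by positivity, fun A hA1 hA2 => ?_⟩
  obtain ⟨κ, hκ, hκf⟩ := exists_lintegral_lastCoord hN hr hm A hA1
  -- The factor `κ` is known only through the integral identity, so it is compared with the factor
  -- of the identity map by testing both on the indicator of `[1, 2]`, for which the weighted
  -- integral is finite and nonzero.
  set f : ℝ → ENNReal := (Set.Icc 1 2).indicator 1 with hf
  have hfm : Measurable f := measurable_one.indicator measurableSet_Icc
  set c : ENNReal := ∫⁻ t, f t * ENNReal.ofReal (|t| ^ (-(r - (N - 1)))) with hc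
  have hceq : c = ∫⁻ t in Set.Icc (1 : ℝ) 2, ENNReal.ofReal (|t| ^ (-(r - (N - 1)))) := by
    rw [hc, ← lintegral_indicator measurableSet_Icc]
    refine lintegral_congr fun t => ?_
    by_cases ht : t ∈ Set.Icc (1 : ℝ) 2 <;> simp [hf, ht]
  have hθ : 0 < r - ((N : ℝ) - 1) := by linarith
  have hctop : c ≠ ⊤ := by
    rw [hceq]
    refine ne_top_of_le_ne_top (b := ∫⁻ t in Set.Icc (1 : ℝ) 2, 1) (by simp) ?_
    refine setLIntegral_mono measurable_const fun t ht => ?_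
    rw [ENNReal.ofReal_le_one]
    refine Real.rpow_le_one_of_one_le_of_nonpos ?_ (by linarith)
    rw [abs_of_nonneg (by linarith [ht.1])]; exact ht.1
  have hc0 : c ≠ 0 := by
    rw [hceq]
    have : ∫⁻ t in Set.Icc (1 : ℝ) 2, ENNReal.ofReal (2 ^ (-(r - ((N : ℝ) - 1)))) ≤
        ∫⁻ t in Set.Icc (1 : ℝ) 2, ENNReal.ofReal (|t| ^ (-(r - (N - 1)))) := by
      refine setLIntegral_mono (by fun_prop) fun t ht => ENNReal.ofReal_le_ofReal ?_
      have h1 : |t| = t := abs_of_nonneg (by linarith [ht.1])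
      rw [h1]
      exact Real.rpow_le_rpow_of_nonpos (by linarith [ht.1]) ht.2 (by linarith)
    have hp : 0 < ∫⁻ t in Set.Icc (1 : ℝ) 2, ENNReal.ofReal (2 ^ (-(r - ((N : ℝ) - 1)))) := by
      norm_num
      positivity
    exact (hp.trans_le this).ne'
  have key : ∀ a b : ℝ, 0 ≤ a → 0 ≤ b → ENNReal.ofReal a * c ≤ ENNReal.ofReal b * c → a ≤ b := by
    intro a b ha hb hab
    have := (ENNReal.mul_le_mul_iff_left hc0 hctop).1 hab
    exact (ENNReal.ofReal_le_ofReal_iff hb).1 this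
  have hmI : Measurable fun h : Euc N => f (lastCoord hN h) *
      ENNReal.ofReal (‖(ContinuousLinearMap.id ℝ (Euc N)) h‖ ^ (-r)) :=
    (hfm.comp (measurable_lastCoord hN)).mul (by fun_prop)
  have hfne : ∀ h : Euc N, f (lastCoord hN h) ≠ 0 → 0 < ‖h‖ := by
    intro h hh
    rw [norm_pos_iff]
    rintro rfl
    simp [hf, lastCoord] at hh
  refine ⟨κ, ?_, ?_, hκf⟩
  · refine key _ _ (by positivity) hκ.le ?_
    rw [← hκf f hfm, ENNReal.ofReal_mul (by positivity), mul_assoc, ← hkf f hfm,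
      ← lintegral_const_mul _ hmI]
    refine lintegral_mono fun h => ?_
    rw [mul_left_comm, ← ENNReal.ofReal_mul (by positivity)]
    rcases eq_or_ne (f (lastCoord hN h)) 0 with h0 | h0
    · simp [h0]
    have hpos := hfne h h0
    gcongr
    rw [← Real.mul_rpow hM.le (norm_nonneg _)]
    exact Real.rpow_le_rpow_of_nonpos (lt_of_lt_of_le (by positivity) (hA1 h)) (hA2 h)
      (by linarith)
  · refine key _ _ hκ.le (by positivity) ?_
    rw [← hκf f hfm, ENNReal.ofReal_mul (by positivity), mul_assoc, ← hkf f hfm,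
      ← lintegral_const_mul _ hmI]
    refine lintegral_mono fun h => ?_
    rw [mul_left_comm (ENNReal.ofReal _), ← ENNReal.ofReal_mul (by positivity)]
    rcases eq_or_ne (f (lastCoord hN h)) 0 with h0 | h0
    · simp [h0]
    have hpos := hfne h h0
    gcongr
    rw [← Real.mul_rpow hm.le (norm_nonneg _)]
    exact Real.rpow_le_rpow_of_nonpos (by simpa using mul_pos hm hpos) (hA1 h)
      (by linarith)

/-- The Bochner form of a weighted integral formula stated for nonnegative functions. -/
lemma integral_lastCoord_of_lintegral {N : ℕ} (hN : 1 ≤ N) {r θ κ : ℝ} (hκ : 0 ≤ κ)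
    (A : Euc N →L[ℝ] Euc N)
    (h : ∀ f : ℝ → ENNReal, Measurable f →
        ∫⁻ h, f (lastCoord hN h) * ENNReal.ofReal (‖A h‖ ^ (-r)) =
          ENNReal.ofReal κ * ∫⁻ t, f t * ENNReal.ofReal (|t| ^ (-θ)))
    (F : ℝ → ℝ) (hF : Measurable F) :
    ∫ h, F (lastCoord hN h) * ‖A h‖ ^ (-r) = κ * ∫ t, F t * |t| ^ (-θ) := by
  have hmA : Measurable fun h : Euc N => ENNReal.ofReal (‖A h‖ ^ (-r)) :=
    ((A.continuous.norm.measurable).pow_const _).ennreal_ofReal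
  have hmt : Measurable fun t : ℝ => ENNReal.ofReal (|t| ^ (-θ)) := by fun_prop
  -- The identity for nonnegative functions is an equality of measures, so the signed version needs
  -- no integrability hypothesis.
  have hmap : Measure.map (lastCoord hN)
      (volume.withDensity fun h : Euc N => ENNReal.ofReal (‖A h‖ ^ (-r))) =
      ENNReal.ofReal κ • volume.withDensity fun t : ℝ => ENNReal.ofReal (|t| ^ (-θ)) := by
    refine Measure.ext fun S hS => ?_
    have h1 := h (S.indicator 1) (measurable_one.indicator hS)
    rw [Measure.map_apply (measurable_lastCoord hN) hS,
      withDensity_apply _ (measurable_lastCoord hN hS), Measure.smul_apply,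
      withDensity_apply _ hS, ← lintegral_indicator (measurable_lastCoord hN hS),
      ← lintegral_indicator hS, smul_eq_mul]
    refine Eq.trans (lintegral_congr fun x => ?_) (h1.trans (congrArg _ (lintegral_congr fun t => ?_)))
    · by_cases hx : lastCoord hN x ∈ S <;> simp [hx]
    · by_cases hx : t ∈ S <;> simp [hx]
  have e1 : ∫ h, F (lastCoord hN h) * ‖A h‖ ^ (-r) = ∫ t, F t ∂(Measure.map (lastCoord hN)
      (volume.withDensity fun h : Euc N => ENNReal.ofReal (‖A h‖ ^ (-r)))) := by
    rw [integral_map (measurable_lastCoord hN).aemeasurable hF.aestronglyMeasurable,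
      integral_withDensity_eq_integral_toReal_smul hmA (by simp)]
    refine integral_congr_ae (.of_forall fun x => ?_)
    simp only [smul_eq_mul]
    rw [ENNReal.toReal_ofReal (by positivity), mul_comm]
  rw [e1, hmap, integral_smul_measure, integral_withDensity_eq_integral_toReal_smul hmt (by simp),
    ENNReal.toReal_ofReal hκ, smul_eq_mul]
  congr 1
  refine integral_congr_ae (.of_forall fun x => ?_)
  simp only [smul_eq_mul]
  rw [ENNReal.toReal_ofReal (by positivity), mul_comm]

/-! ### The one-dimensional profile and its scaling -/

/-- The power `(v^+)^α`. -/
def posPow (α v : ℝ) : ℝ := (max v 0) ^ α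

lemma posPow_nonneg (α v : ℝ) : 0 ≤ posPow α v := by unfold posPow; positivity

lemma posPow_of_pos {α v : ℝ} (hv : 0 < v) : posPow α v = v ^ α := by
  rw [posPow, max_eq_left hv.le]

lemma posPow_of_nonpos {α v : ℝ} (hα : 0 < α) (hv : v ≤ 0) : posPow α v = 0 := by
  rw [posPow, max_eq_right hv, Real.zero_rpow hα.ne']

lemma continuous_posPow {α : ℝ} (hα : 0 < α) : Continuous (posPow α) := by
  unfold posPow
  exact (continuous_id.max continuous_const).rpow_const fun _ => Or.inr hα.le

lemma abs_oddPow {p : ℝ} (hp : 1 < p) (t : ℝ) : |oddPow p t| = |t| ^ (p - 1) := by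
  rcases eq_or_ne t 0 with rfl | ht
  · simp [oddPow, Real.zero_rpow (by linarith : p - 1 ≠ 0)]
  have : 0 < |t| := abs_pos.2 ht
  rw [oddPow, abs_mul, abs_of_nonneg (by positivity : 0 ≤ |t| ^ (p - 2))]
  nth_rw 2 [← Real.rpow_one |t|]
  rw [← Real.rpow_add this]; ring_nf

lemma oddPow_of_nonneg {p t : ℝ} (hp : 1 < p) (ht : 0 ≤ t) : oddPow p t = t ^ (p - 1) := by
  rw [← abs_of_nonneg ht, ← abs_oddPow hp t, abs_of_nonneg ht]
  exact (abs_of_nonneg (by unfold oddPow; positivity)).symm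

lemma oddPow_neg (p t : ℝ) : oddPow p (-t) = -oddPow p t := by
  simp [oddPow]

lemma measurable_oddPow (p : ℝ) : Measurable (oddPow p) := by
  unfold oddPow; fun_prop

lemma oddPow_mul {p c t : ℝ} (hp : 1 < p) (hc : 0 < c) :
    oddPow p (c * t) = c ^ (p - 1) * oddPow p t := by
  rcases le_total 0 t with ht | ht
  · rw [oddPow_of_nonneg hp ht, oddPow_of_nonneg hp (by positivity), Real.mul_rpow hc.le ht]
  · have h : 0 ≤ -t := by linarith
    rw [← neg_neg t, mul_neg, oddPow_neg, oddPow_neg, oddPow_of_nonneg hp h,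
      oddPow_of_nonneg hp (by positivity), Real.mul_rpow hc.le h]
    ring

/-- The linear bound serves near the origin, the bound of order `α` at infinity; every integrability
statement about the profile combines the two. -/
lemma abs_one_sub_posPow_le {α : ℝ} (hα : 0 < α) (hα1 : α ≤ 1) (x : ℝ) :
    |1 - posPow α (1 + x)| ≤ |x| ∧ |1 - posPow α (1 + x)| ≤ |x| ^ α := by
  rcases le_or_gt (1 + x) 0 with h | h
  · rw [posPow_of_nonpos hα h]
    have h1 : 1 ≤ |x| := by rw [abs_of_neg (by linarith)]; linarith
    simpa using ⟨h1, Real.one_le_rpow h1 hα.le⟩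
  rw [posPow_of_pos h]
  rcases le_total 0 x with hx | hx
  · have h1 : 1 ≤ (1 + x) ^ α := Real.one_le_rpow (by linarith) hα.le
    have h2 : (1 + x) ^ α ≤ 1 + x := by
      simpa using Real.rpow_le_rpow_of_exponent_le (by linarith : 1 ≤ 1 + x) hα1
    have h3 : (1 + x) ^ α ≤ 1 ^ α + x ^ α :=
      Real.rpow_add_le_add_rpow zero_le_one hx hα.le hα1
    rw [abs_sub_comm, abs_of_nonneg (by linarith : 0 ≤ (1 + x) ^ α - 1), abs_of_nonneg hx]
    rw [Real.one_rpow] at h3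
    constructor <;> linarith
  · have h1 : (1 + x) ^ α ≤ 1 := Real.rpow_le_one h.le (by linarith) hα.le
    have h2 : 1 + x ≤ (1 + x) ^ α := by
      simpa using Real.rpow_le_rpow_of_exponent_ge h (by linarith : 1 + x ≤ 1) hα1
    have h3 : |x| ≤ |x| ^ α := by
      have hx1 : |x| ≤ 1 := by rw [abs_of_nonpos hx]; linarith
      rcases eq_or_lt_of_le (abs_nonneg x) with h0 | h0
      · rw [← h0, Real.zero_rpow hα.ne']
      simpa using Real.rpow_le_rpow_of_exponent_ge h0 hx1 hα1
    rw [abs_of_nonneg (by linarith : 0 ≤ 1 - (1 + x) ^ α)]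
    have h4 : 1 - (1 + x) ^ α ≤ |x| := by rw [abs_of_nonpos hx]; linarith
    exact ⟨h4, h4.trans h3⟩

lemma posPow_sub_posPow_scale {α L x : ℝ} (hL : 0 < L) :
    posPow α L - posPow α (L + L * x) = L ^ α * (1 - posPow α (1 + x)) := by
  have : max (L + L * x) 0 = L * max (1 + x) 0 := by
    rw [mul_max_of_nonneg _ _ hL.le]; ring_nf
  rw [posPow_of_pos hL]
  unfold posPow
  rw [this, Real.mul_rpow hL.le (by positivity)]
  ring

lemma lintegral_eq_mul_comp_mul (g : ℝ → ENNReal) (hg : Measurable g) {c : ℝ} (hc : 0 < c) :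
    ∫⁻ t, g t = ENNReal.ofReal c * ∫⁻ x, g (c * x) := by
  have h2 : ∫⁻ x, g (c * x) = ENNReal.ofReal |c⁻¹| * ∫⁻ x, g x := by
    rw [← lintegral_map hg (measurable_const_mul c), Real.map_volume_mul_left hc.ne',
      lintegral_smul_measure]
    simp
  rw [h2, ← mul_assoc, ← ENNReal.ofReal_mul hc.le, abs_of_pos (by positivity),
    mul_inv_cancel₀ hc.ne']
  simp

/-- Substitution `t = L x`. The weight `w` is free so that the same computation covers no cutoff,
the factor `min 1 |t|` and the indicator of `farSet r L`. -/
lemma lintegral_posPow_scale {α a σ L : ℝ} (hα : 0 < α) (hL : 0 < L) (w : ℝ → ℝ)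
    (hw : Measurable w) :
    ∫⁻ t, ENNReal.ofReal (|posPow α L - posPow α (L + t)| ^ a * |t| ^ (-(1 + σ)) * w t) =
      ENNReal.ofReal (L ^ (α * a - σ)) * ∫⁻ x,
        ENNReal.ofReal (|1 - posPow α (1 + x)| ^ a * |x| ^ (-(1 + σ)) * w (L * x)) := by
  have hpm : Measurable (posPow α) := (continuous_posPow hα).measurable
  rw [lintegral_eq_mul_comp_mul _ (by fun_prop) hL,
    ← lintegral_const_mul' _ _ ENNReal.ofReal_ne_top,
    ← lintegral_const_mul' _ _ ENNReal.ofReal_ne_top]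
  refine lintegral_congr fun x => ?_
  rw [← ENNReal.ofReal_mul hL.le, ← ENNReal.ofReal_mul (by positivity),
    posPow_sub_posPow_scale hL, abs_mul, abs_mul, abs_of_pos hL,
    abs_of_pos (by positivity : 0 < L ^ α), Real.mul_rpow (by positivity) (abs_nonneg _),
    Real.mul_rpow hL.le (abs_nonneg _), ← Real.rpow_mul hL.le]
  have : L ^ (α * a - σ) = L * L ^ (α * a) * L ^ (-(1 + σ)) := by
    nth_rw 2 [← Real.rpow_one L]
    rw [← Real.rpow_add hL, ← Real.rpow_add hL]; ring_nf
  rw [this]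
  ring_nf

lemma integrable_of_abs_le_rpow {g : ℝ → ℝ} (hg : Measurable g) {C e₁ e₂ : ℝ} (h₁ : -1 < e₁)
    (h₂ : e₂ < -1) (hg₁ : ∀ x, 0 < |x| → |x| ≤ 1 → |g x| ≤ C * |x| ^ e₁)
    (hg₂ : ∀ x, 1 < |x| → |g x| ≤ C * |x| ^ e₂) : Integrable g := by
  set h : ℝ → ℝ := fun x => if x ≤ 1 then C * x ^ e₁ else C * x ^ e₂ with hh
  have hi : IntegrableOn h (Set.Ioi 0) := by
    rw [← Set.Ioc_union_Ioi_eq_Ioi (zero_le_one' ℝ)]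
    refine IntegrableOn.union ?_ ?_
    · have := ((intervalIntegral.intervalIntegrable_rpow' (a := 0) (b := 1) h₁).1).const_mul C
      refine IntegrableOn.congr_fun this (fun x hx => ?_) measurableSet_Ioc
      simp [hh, hx.2]
    · refine IntegrableOn.congr_fun ((integrableOn_Ioi_rpow_of_lt h₂ one_pos).const_mul C)
        (fun x hx => ?_) measurableSet_Ioi
      simp [hh, not_le.2 (Set.mem_Ioi.1 hx)]
  have hi2 : Integrable fun x => h |x| := by
    rw [← integrableOn_univ, ← Set.Iic_union_Ioi (a := (0 : ℝ))]
    refine IntegrableOn.union ?_ (hi.congr_fun (fun x hx => ?_) measurableSet_Ioi)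
    · rw [integrableOn_Iic_iff_integrableOn_Iio]
      have := (Measure.measurePreserving_neg (volume : Measure ℝ)).integrableOn_comp_preimage
        (Homeomorph.neg ℝ).measurableEmbedding (f := h) (s := Set.Ioi 0)
      have h3 := this.2 hi
      simp only [Set.neg_preimage, Set.neg_Ioi, neg_zero] at h3
      refine h3.congr_fun (fun x hx => ?_) measurableSet_Iio
      simp only [Function.comp, abs_of_neg (Set.mem_Iio.1 hx)]
    · simp only [abs_of_pos (Set.mem_Ioi.1 hx)]
  refine hi2.mono' hg.aestronglyMeasurable ?_
  have hne : ∀ᵐ t : ℝ, t ≠ 0 := by simp [ae_iff]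
  filter_upwards [hne] with x hx
  rw [Real.norm_eq_abs]
  simp only [hh]
  split_ifs with h1
  · exact hg₁ x (abs_pos.2 hx) h1
  · exact hg₂ x (not_le.1 h1)

/-- The set of increments `t` for which `L + t` and `L` are not within a ratio `r`. -/
def farSet (r L : ℝ) : Set ℝ := {t | L + t ≤ r * L ∨ L ≤ r * (L + t)}

lemma measurableSet_farSet (r L : ℝ) : MeasurableSet (farSet r L) := by
  exact (measurableSet_le (f := fun t => L + t) (g := fun _ => r * L) (by fun_prop)
    (by fun_prop)).union (measurableSet_le (f := fun _ => L) (g := fun t => r * (L + t))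
    (by fun_prop) (by fun_prop))

lemma mul_mem_farSet {r L x : ℝ} (hL : 0 < L) : L * x ∈ farSet r L ↔ x ∈ farSet r 1 := by
  simp only [farSet, Set.mem_ofPred_eq]
  constructor <;> rintro (h | h)
  · left; nlinarith
  · right; nlinarith
  · left; nlinarith
  · right; nlinarith

lemma one_sub_le_abs_of_mem_farSet {r x : ℝ} (hr0 : 0 < r) (hr1 : r < 1) (h : x ∈ farSet r 1) :
    1 - r ≤ |x| := by
  rcases h with h | h
  · have := neg_le_abs x; linarith
  · have h1 := le_abs_self x
    rcases le_or_gt 0 x with hx | hx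
    · nlinarith
    · rw [abs_of_neg hx]
      nlinarith

/-! ### Size estimates for the one-dimensional integrals -/

section profile

variable {s p α : ℝ}

/-- At `L = 1` the integrand is of order at most `p - 1 - sp > -1` at the origin and at most `αp - 1
- sp < -1` at infinity; scaling gives the power of `L`. -/
lemma exists_lintegral_posPow_sub_pow_le (hs0 : 0 < s) (hs1 : s < 1) (hp : 1 < p) (hα0 : 0 < α)
    (hαs : α < s) : ∃ C : ℝ, 0 < C ∧ ∀ L : ℝ, 0 < L →
      ∫⁻ t, ENNReal.ofReal (|posPow α L - posPow α (L + t)| ^ p * |t| ^ (-(1 + s * p))) ≤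
        ENNReal.ofReal (C * L ^ ((α - s) * p)) := by
  have hpm : Measurable (posPow α) := (continuous_posPow hα0).measurable
  set g : ℝ → ℝ := fun x => |1 - posPow α (1 + x)| ^ p * |x| ^ (-(1 + s * p)) with hg
  have hg0 : ∀ x, 0 ≤ g x := fun x => by simp only [hg]; positivity
  have hgi : Integrable g := by
    refine integrable_of_abs_le_rpow (C := 1) (e₁ := p - (1 + s * p))
      (e₂ := α * p - (1 + s * p)) (by fun_prop) (by nlinarith) (by nlinarith) ?_ ?_
    · intro x hx hx1
      rw [abs_of_nonneg (hg0 x), one_mul, sub_eq_add_neg, Real.rpow_add hx]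
      exact mul_le_mul_of_nonneg_right (Real.rpow_le_rpow (abs_nonneg _)
        (abs_one_sub_posPow_le hα0 (by linarith) x).1 (by linarith)) (by positivity)
    · intro x hx
      have hx0 : 0 < |x| := by linarith
      rw [abs_of_nonneg (hg0 x), one_mul, sub_eq_add_neg, Real.rpow_add hx0,
        Real.rpow_mul hx0.le]
      exact mul_le_mul_of_nonneg_right (Real.rpow_le_rpow (abs_nonneg _)
        (abs_one_sub_posPow_le hα0 (by linarith) x).2 (by linarith)) (by positivity)
  -- The summand `1` only makes the constant strictly positive without further work.
  refine ⟨(∫ x, g x) + 1, by have := integral_nonneg (μ := volume) (f := g) hg0; positivity, fun L hL => ?_⟩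
  have h1 := lintegral_posPow_scale (a := p) (σ := s * p) hα0 hL (fun _ => 1) measurable_const
  simp only [mul_one] at h1
  rw [h1, ← ofReal_integral_eq_lintegral_ofReal hgi (.of_forall hg0),
    ← ENNReal.ofReal_mul (by positivity)]
  refine ENNReal.ofReal_le_ofReal ?_
  rw [mul_comm, show α * p - s * p = (α - s) * p by ring]
  gcongr
  linarith

/-- The extra factor raises the order at the origin to `p - 1 - sp > -1`; without it the integral
may diverge and the operator has to be understood by truncation. At infinity the order is `-1 - β`.
-/
lemma integrable_profile_trunc (hs0 : 0 < s) (hs1 : s < 1) (hp : 1 < p) (hα0 : 0 < α)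
    (hαs : α < s) :
    Integrable fun x => |1 - posPow α (1 + x)| ^ (p - 1) * |x| ^ (-(1 + s * p)) * min 1 |x| := by
  have hpm : Measurable (posPow α) := (continuous_posPow hα0).measurable
  refine integrable_of_abs_le_rpow (C := 1) (e₁ := (p - 1) + (-(1 + s * p)) + 1)
      (e₂ := α * (p - 1) + (-(1 + s * p))) (by fun_prop) (by nlinarith) (by nlinarith) ?_ ?_
  · intro x hx hx1
    rw [abs_of_nonneg (by positivity), one_mul, Real.rpow_add hx, Real.rpow_add hx, Real.rpow_one,
      min_eq_right hx1]
    exact mul_le_mul_of_nonneg_right (mul_le_mul_of_nonneg_right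
      (Real.rpow_le_rpow (abs_nonneg _) (abs_one_sub_posPow_le hα0 (by linarith) x).1
        (by linarith)) (by positivity)) (abs_nonneg _)
  · intro x hx
    have hx0 : 0 < |x| := by linarith
    rw [abs_of_nonneg (by positivity), one_mul, Real.rpow_add hx0,
      Real.rpow_mul hx0.le, min_eq_left hx.le, mul_one]
    exact mul_le_mul_of_nonneg_right (Real.rpow_le_rpow (abs_nonneg _)
      (abs_one_sub_posPow_le hα0 (by linarith) x).2 (by linarith)) (by positivity)

/-- This makes the freezing error negligible. After `t = L x` the cutoff becomes `min 1 |L x|`,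
which tends to `0` pointwise and is dominated by `min 1 |x|` for `L < 1`, so the integral is
`o(L^{-β})`. -/
lemma exists_lintegral_posPow_sub_pow_min_le (hs0 : 0 < s) (hs1 : s < 1) (hp : 1 < p)
    (hα0 : 0 < α) (hαs : α < s) {η : ℝ} (hη : 0 < η) : ∃ l : ℝ, 0 < l ∧ ∀ L : ℝ, 0 < L → L < l →
      ∫⁻ t, ENNReal.ofReal
        (|posPow α L - posPow α (L + t)| ^ (p - 1) * |t| ^ (-(1 + s * p)) * min 1 |t|) ≤
        ENNReal.ofReal (η * L ^ (-betaExp s p α)) := by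
  have hpm : Measurable (posPow α) := (continuous_posPow hα0).measurable
  set g : ℝ → ℝ → ℝ := fun L x =>
    |1 - posPow α (1 + x)| ^ (p - 1) * |x| ^ (-(1 + s * p)) * min 1 |L * x| with hg
  have hgi := integrable_profile_trunc hs0 hs1 hp hα0 hαs
  have hlim : Filter.Tendsto (fun L => ∫ x, g L x) (nhdsWithin 0 (Set.Ioi 0)) (nhds 0) := by
    have h0 : ∫ _ : ℝ, (0 : ℝ) = 0 := by simp
    rw [show nhds (0 : ℝ) = nhds (∫ _ : ℝ, (0 : ℝ)) by rw [h0]]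
    refine tendsto_integral_filter_of_dominated_convergence _ ?_ ?_ hgi ?_
    · refine .of_forall fun L => Measurable.aestronglyMeasurable ?_
      simp only [hg]; fun_prop
    · filter_upwards [Ioo_mem_nhdsGT (zero_lt_one' ℝ)] with L hL
      refine .of_forall fun x => ?_
      simp only [hg]
      rw [Real.norm_eq_abs, abs_of_nonneg (by positivity)]
      refine mul_le_mul_of_nonneg_left (min_le_min_left _ ?_) (by positivity)
      rw [abs_mul, abs_of_pos hL.1]
      exact mul_le_of_le_one_left (abs_nonneg _) hL.2.le
    · refine .of_forall fun x => ?_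
      have hc : Continuous fun L => g L x := by simp only [hg]; fun_prop
      have := (hc.tendsto 0).mono_left (nhdsWithin_le_nhds (s := Set.Ioi 0))
      simpa [hg] using this
  have hev := (hlim.eventually (gt_mem_nhds hη))
  obtain ⟨l, hl, hl2⟩ := (mem_nhdsGT_iff_exists_Ioo_subset).1 (Filter.inter_mem hev (Ioo_mem_nhdsGT (zero_lt_one' ℝ)))
  refine ⟨l, hl, fun L hL hLl => ?_⟩
  obtain ⟨h1, h2⟩ := hl2 ⟨hL, hLl⟩
  have hgL : Integrable (g L) := by
    refine hgi.mono' (Measurable.aestronglyMeasurable (by simp only [hg]; fun_prop))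
      (.of_forall fun x => ?_)
    simp only [hg]
    rw [Real.norm_eq_abs, abs_of_nonneg (by positivity)]
    refine mul_le_mul_of_nonneg_left (min_le_min_left _ ?_) (by positivity)
    rw [abs_mul, abs_of_pos hL]
    exact mul_le_of_le_one_left (abs_nonneg _) h2.2.le
  rw [lintegral_posPow_scale (a := p - 1) (σ := s * p) hα0 hL (fun t => min 1 |t|) (by fun_prop),
    ← ofReal_integral_eq_lintegral_ofReal hgL (.of_forall fun x => by simp only [hg]; positivity),
    ← ENNReal.ofReal_mul (by positivity)]
  refine ENNReal.ofReal_le_ofReal ?_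
  rw [mul_comm, show α * (p - 1) - s * p = -betaExp s p α by unfold betaExp; ring]
  gcongr
  exact le_of_lt h1

/-- The far set stays at distance at least `1 - r` from the origin, so there the factor `min 1 |x|`
costs only a constant. -/
lemma integrableOn_profile_farSet (hs0 : 0 < s) (hs1 : s < 1) (hp : 1 < p)
    (hα0 : 0 < α) (hαs : α < s) {r : ℝ} (hr0 : 0 < r) (hr1 : r < 1) :
    IntegrableOn (fun x => |1 - posPow α (1 + x)| ^ (p - 1) * |x| ^ (-(1 + s * p)))
      (farSet r 1) := by
  have hpm : Measurable (posPow α) := (continuous_posPow hα0).measurable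
  have hgi := (integrable_profile_trunc hs0 hs1 hp hα0 hαs).const_mul (1 / min 1 (1 - r))
  have hd : 0 < min 1 (1 - r) := lt_min one_pos (by linarith)
  refine Integrable.mono' hgi.integrableOn (Measurable.aestronglyMeasurable (by fun_prop)) ?_
  filter_upwards [ae_restrict_mem (measurableSet_farSet r 1)] with x hx
  have h1 : min 1 (1 - r) ≤ min 1 |x| := min_le_min_left _ (one_sub_le_abs_of_mem_farSet hr0 hr1 hx)
  rw [Real.norm_eq_abs, abs_of_nonneg (by positivity), one_div, inv_mul_eq_div, le_div_iff₀ hd]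
  gcongr

lemma exists_lintegral_farSet_le (hs0 : 0 < s) (hs1 : s < 1) (hp : 1 < p)
    (hα0 : 0 < α) (hαs : α < s) {r : ℝ} (hr0 : 0 < r) (hr1 : r < 1) : ∃ C : ℝ, 0 < C ∧ ∀ L : ℝ, 0 < L →
      ∫⁻ t in farSet r L, ENNReal.ofReal
        (|posPow α L - posPow α (L + t)| ^ (p - 1) * |t| ^ (-(1 + s * p))) ≤
        ENNReal.ofReal (C * L ^ (-betaExp s p α)) := by
  have hgi := integrableOn_profile_farSet hs0 hs1 hp hα0 hαs hr0 hr1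
  set c := ∫ x in farSet r 1, |1 - posPow α (1 + x)| ^ (p - 1) * |x| ^ (-(1 + s * p)) with hc
  have hc0 : 0 ≤ c := integral_nonneg fun x => by positivity
  refine ⟨c + 1, by positivity, fun L hL => ?_⟩
  have e : ∀ (R : ℝ) (g : ℝ → ℝ), ∫⁻ t in farSet r R, ENNReal.ofReal (g t) =
      ∫⁻ t, ENNReal.ofReal (g t * (farSet r R).indicator 1 t) := fun R g => by
    rw [← lintegral_indicator (measurableSet_farSet r R)]
    refine lintegral_congr fun t => ?_
    by_cases ht : t ∈ farSet r R <;> simp [ht]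
  have h1 := lintegral_posPow_scale (a := p - 1) (σ := s * p) hα0 hL ((farSet r L).indicator 1)
    (measurable_one.indicator (measurableSet_farSet r L))
  have hind : ∀ x, (farSet r L).indicator (1 : ℝ → ℝ) (L * x) = (farSet r 1).indicator 1 x := by
    intro x
    by_cases hx : x ∈ farSet r 1
    · rw [Set.indicator_of_mem hx, Set.indicator_of_mem ((mul_mem_farSet hL).2 hx)]; rfl
    · rw [Set.indicator_of_notMem hx, Set.indicator_of_notMem (mt (mul_mem_farSet hL).1 hx)]
  simp only [hind] at h1
  rw [e, h1, ← e, ← ofReal_integral_eq_lintegral_ofReal hgi (.of_forall fun x => by positivity),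
    ← ENNReal.ofReal_mul (by positivity), ← hc]
  refine ENNReal.ofReal_le_ofReal ?_
  rw [mul_comm, show α * (p - 1) - s * p = -betaExp s p α by unfold betaExp; ring]
  gcongr
  linarith

end profile

/-! ### Positivity of the one-dimensional constant -/

section profile

variable {s p α : ℝ}

/-- The density obtained by folding the exterior of the unit interval onto it by inversion. -/
def foldedDensity (s p α u : ℝ) : ℝ :=
  (1 - u ^ α) ^ (p - 1) * (1 - u) ^ (-(1 + s * p)) * (1 - u ^ (betaExp s p α - 1))

lemma one_sub_rpow_mem {a u : ℝ} (ha0 : 0 < a) (ha1 : a ≤ 1) (hu0 : 0 < u) (hu1 : u < 1) :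
    0 < 1 - u ^ a ∧ 1 - u ^ a ≤ 1 - u := by
  have h1 : u ^ a < 1 := Real.rpow_lt_one hu0.le hu1 ha0
  have h2 : u ≤ u ^ a := by
    simpa using Real.rpow_le_rpow_of_exponent_ge hu0 hu1.le ha1
  constructor <;> linarith

/-- At `α = s` one has `β = s`, and this density is minus the folded one. The value `1/(sp)` thus
says that the one-dimensional constant vanishes at `α = s`. -/
lemma integral_critical_density (hs0 : 0 < s) (hs1 : s < 1) (hp : 1 < p) :
    IntegrableOn (fun u : ℝ => (1 - u ^ s) ^ (p - 1) * (1 - u) ^ (-(1 + s * p)) * (u ^ (s - 1) - 1))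
      (Set.Ioc 0 1) ∧
    ∫ u in Set.Ioc (0 : ℝ) 1,
      (1 - u ^ s) ^ (p - 1) * (1 - u) ^ (-(1 + s * p)) * (u ^ (s - 1) - 1) = 1 / (s * p) := by
  have hsp : 0 < s * p := by nlinarith
  -- An explicit antiderivative: it equals `-1/(sp)` at `0` and tends to `0` at `1`, because `1 -
  -- u^s ≤ 1 - u` bounds it by `(1 - u)^{p - sp}/(sp)` in absolute value.
  set g : ℝ → ℝ := fun u => -((1 - u ^ s) ^ p * (1 - u) ^ (-(s * p)) / (s * p)) with hg
  have hcont : ContinuousOn g (Set.Icc 0 1) := by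
    intro u hu
    rcases eq_or_lt_of_le hu.2 with rfl | hu1
    · have hg1 : g 1 = 0 := by simp [hg, Real.zero_rpow (by linarith : p ≠ 0)]
      unfold ContinuousWithinAt
      rw [hg1]
      have hlim : Filter.Tendsto (fun u : ℝ => -((1 - u) ^ (p - s * p) / (s * p)))
          (nhdsWithin 1 (Set.Icc 0 1)) (nhds 0) := by
        have hc : ContinuousAt (fun u : ℝ => -((1 - u) ^ (p - s * p) / (s * p))) 1 := by
          have : ContinuousAt (fun u : ℝ => (1 - u) ^ (p - s * p)) 1 :=
            (continuousAt_const.sub continuousAt_id).rpow_const (Or.inr (by nlinarith))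
          exact (this.div_const _).neg
        have h0 := hc.tendsto
        simp only [sub_self] at h0
        rw [Real.zero_rpow (by nlinarith : p - s * p ≠ 0)] at h0
        simp only [zero_div, neg_zero] at h0
        exact h0.mono_left nhdsWithin_le_nhds
      refine tendsto_of_tendsto_of_tendsto_of_le_of_le' hlim tendsto_const_nhds ?_ ?_
      · filter_upwards [self_mem_nhdsWithin, mem_nhdsWithin_of_mem_nhds (lt_mem_nhds one_pos)]
          with u hu hu0
        simp only [hg]
        rcases eq_or_lt_of_le hu.2 with rfl | hu1
        · simp [Real.zero_rpow (by linarith : p ≠ 0), Real.zero_rpow (by nlinarith : p - s * p ≠ 0)]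
        obtain ⟨h1, h2⟩ := one_sub_rpow_mem hs0 hs1.le hu0 hu1
        have h3 : 0 < 1 - u := by linarith
        rw [sub_eq_add_neg p, Real.rpow_add h3]
        gcongr
      · filter_upwards [self_mem_nhdsWithin] with u hu
        simp only [hg]
        have h1 : 0 ≤ 1 - u ^ s := by
          have := Real.rpow_le_one hu.1 hu.2 hs0.le
          linarith
        have h2 : 0 ≤ 1 - u := by linarith [hu.2]
        have : 0 ≤ (1 - u ^ s) ^ p * (1 - u) ^ (-(s * p)) / (s * p) := by positivity
        linarith
    · refine ContinuousAt.continuousWithinAt ?_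
      have h1 : ContinuousAt (fun u : ℝ => (1 - u ^ s) ^ p) u :=
        (continuousAt_const.sub (continuousAt_id.rpow_const (Or.inr hs0.le))).rpow_const
          (Or.inr (by linarith))
      have h2 : ContinuousAt (fun u : ℝ => (1 - u) ^ (-(s * p))) u :=
        (continuousAt_const.sub continuousAt_id).rpow_const (Or.inl (by simp; linarith))
      exact ((h1.mul h2).div_const _).neg
  have hderiv : ∀ u ∈ Set.Ioo (0 : ℝ) 1, HasDerivAt g
      ((1 - u ^ s) ^ (p - 1) * (1 - u) ^ (-(1 + s * p)) * (u ^ (s - 1) - 1)) u := by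
    intro u hu
    obtain ⟨h1, h2⟩ := one_sub_rpow_mem hs0 hs1.le hu.1 hu.2
    have h3 : 0 < 1 - u := by linarith
    have d1 : HasDerivAt (fun u : ℝ => 1 - u ^ s) (-(s * u ^ (s - 1))) u := by
      simpa using (Real.hasDerivAt_rpow_const (p := s) (Or.inl hu.1.ne')).const_sub 1
    have d2 := d1.rpow_const (p := p) (Or.inl h1.ne')
    have d3 : HasDerivAt (fun u : ℝ => 1 - u) (-1) u := by
      simpa using (hasDerivAt_id u).const_sub 1
    have d4 := d3.rpow_const (p := -(s * p)) (Or.inl h3.ne')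
    have d5 := ((d2.mul d4).div_const (s * p)).neg
    refine d5.congr_deriv ?_
    have e1 : (1 - u ^ s) ^ p = (1 - u ^ s) ^ (p - 1) * (1 - u ^ s) := by
      rw [← Real.rpow_add_one h1.ne']; ring_nf
    have e2 : (1 - u) ^ (-(s * p)) = (1 - u) ^ (-(1 + s * p)) * (1 - u) := by
      rw [← Real.rpow_add_one h3.ne']; ring_nf
    have e3 : u ^ s = u ^ (s - 1) * u := by
      rw [← Real.rpow_add_one hu.1.ne']; ring_nf
    have e4 : -(s * p) - 1 = -(1 + s * p) := by ring
    rw [e1, e2, e4]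
    nth_rw 3 [e3]
    have : p ≠ 0 := by linarith
    field_simp
    ring
  have hnn : ∀ u ∈ Set.Ioo (0 : ℝ) 1,
      0 ≤ (1 - u ^ s) ^ (p - 1) * (1 - u) ^ (-(1 + s * p)) * (u ^ (s - 1) - 1) := by
    intro u hu
    obtain ⟨h1, h2⟩ := one_sub_rpow_mem hs0 hs1.le hu.1 hu.2
    have h3 : 0 < 1 - u := by linarith
    have h4 : 1 ≤ u ^ (s - 1) :=
      Real.one_le_rpow_of_pos_of_le_one_of_nonpos hu.1 hu.2.le (by linarith)
    have h5 : 0 ≤ u ^ (s - 1) - 1 := by linarith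
    positivity
  -- The derivative of a continuous function is integrable once it is nonnegative, so no separate
  -- analysis of the endpoint singularities is needed.
  have hint := intervalIntegral.integrableOn_deriv_of_nonneg hcont hderiv hnn
  refine ⟨hint, ?_⟩
  have := intervalIntegral.integral_eq_sub_of_hasDerivAt_of_le zero_le_one hcont hderiv
    ((intervalIntegrable_iff_integrableOn_Ioc_of_le zero_le_one).2 hint)
  rw [intervalIntegral.integral_of_le zero_le_one] at this
  rw [this]
  simp [hg, Real.zero_rpow (by linarith : p ≠ 0), Real.zero_rpow hs0.ne']

lemma measurable_foldedDensity : Measurable (foldedDensity s p α) := by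
  unfold foldedDensity; fun_prop

lemma lt_betaExp (hp : 1 < p) (hαs : α < s) : s < betaExp s p α := by
  unfold betaExp; nlinarith

/-- Comparison with the critical density `Ds`. Passing from `s` down to `α` decreases `(1 -
u^α)^{p-1}` strictly, and `β > s` gives `u^{β-1} ≤ u^{s-1}`; hence `-D < Ds` on `(0, 1)`. The
negative part of `D` therefore has integral strictly below `1/(sp)`, and bounding `∫₀^r D` from
below by minus that integral makes the constant independent of `r`. -/
lemma exists_bounds_integral_foldedDensity (hs0 : 0 < s) (hs1 : s < 1) (hp : 1 < p)
    (hα0 : 0 < α) (hαs : α < s) :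
    IntegrableOn (foldedDensity s p α) (Set.Ioc 0 1) ∧
    ∃ c C : ℝ, 0 < c ∧ ∀ r : ℝ, 0 < r → r < 1 →
      c ≤ 1 / (s * p) + ∫ u in Set.Ioc 0 r, foldedDensity s p α u ∧
      1 / (s * p) + ∫ u in Set.Ioc 0 r, foldedDensity s p α u ≤ C := by
  obtain ⟨hci, hcv⟩ := integral_critical_density hs0 hs1 hp
  have hsp : 0 < s * p := by nlinarith
  set D := foldedDensity s p α with hD
  set Ds : ℝ → ℝ := fun u =>
    (1 - u ^ s) ^ (p - 1) * (1 - u) ^ (-(1 + s * p)) * (u ^ (s - 1) - 1) with hDs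
  have hβ := lt_betaExp hp hαs
  have hDs_pos : ∀ u ∈ Set.Ioo (0 : ℝ) 1, 0 < Ds u := by
    intro u hu
    obtain ⟨h1, h2⟩ := one_sub_rpow_mem hs0 hs1.le hu.1 hu.2
    have h3 : 0 < 1 - u := by linarith [hu.2]
    have h4 : 1 < u ^ (s - 1) :=
      Real.one_lt_rpow_of_pos_of_lt_one_of_neg hu.1 hu.2 (by linarith)
    have h5 : 0 < u ^ (s - 1) - 1 := by linarith
    simp only [hDs]; positivity
  have hneg : ∀ u ∈ Set.Ioo (0 : ℝ) 1, -Ds u < D u := by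
    intro u hu
    obtain ⟨h1, h2⟩ := one_sub_rpow_mem hs0 hs1.le hu.1 hu.2
    obtain ⟨h1', h2'⟩ := one_sub_rpow_mem hα0 (by linarith) hu.1 hu.2
    have h3 : 0 < 1 - u := by linarith [hu.2]
    have h4 : 1 < u ^ (s - 1) :=
      Real.one_lt_rpow_of_pos_of_lt_one_of_neg hu.1 hu.2 (by linarith)
    have h6 : u ^ (betaExp s p α - 1) ≤ u ^ (s - 1) :=
      Real.rpow_le_rpow_of_exponent_ge hu.1 hu.2.le (by linarith)
    have h7 : u ^ s < u ^ α := Real.rpow_lt_rpow_of_exponent_gt hu.1 hu.2 hαs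
    have h8 : (1 - u ^ α) ^ (p - 1) < (1 - u ^ s) ^ (p - 1) :=
      Real.rpow_lt_rpow h1'.le (by linarith) (by linarith)
    have hk : 0 < (1 - u) ^ (-(1 + s * p)) := by positivity
    have hA : 0 < (1 - u ^ α) ^ (p - 1) := by positivity
    have h9 : (1 - u ^ α) ^ (p - 1) * (u ^ (betaExp s p α - 1) - 1) <
        (1 - u ^ s) ^ (p - 1) * (u ^ (s - 1) - 1) := by
      calc _ ≤ (1 - u ^ α) ^ (p - 1) * (u ^ (s - 1) - 1) := by gcongr
        _ < _ := by
          apply mul_lt_mul_of_pos_right h8; linarith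
    simp only [hD, hDs, foldedDensity]
    nlinarith
  have hone : ∀ᵐ u : ℝ, u ≠ 1 := by simp [ae_iff]
  have hIoo : ∀ᵐ u ∂(volume.restrict (Set.Ioc (0 : ℝ) 1)), u ∈ Set.Ioo (0 : ℝ) 1 := by
    filter_upwards [ae_restrict_mem measurableSet_Ioc, ae_restrict_of_ae hone] with u hu h1
    exact ⟨hu.1, lt_of_le_of_ne hu.2 h1⟩
  have hDi : IntegrableOn D (Set.Ioc 0 1) := by
    -- `B` makes `1 - u^{β-1} ≤ B (1 - u)` true: by monotonicity in the exponent if `β ≤ 2`, by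
    -- Bernoulli's inequality otherwise.
    set B := max 1 (betaExp s p α - 1) with hB
    have hpow : IntegrableOn (fun u : ℝ => (1 - u) ^ (p - 1 - s * p)) (Set.Ioc 0 1) := by
      have h1 : IntervalIntegrable (fun x : ℝ => x ^ (p - 1 - s * p)) volume 0 1 :=
        intervalIntegral.intervalIntegrable_rpow' (by nlinarith)
      have h2 := (h1.comp_sub_left 1).symm
      rw [sub_zero, sub_self] at h2
      exact h2.1
    refine Integrable.mono' (hci.add (hpow.const_mul B))
      measurable_foldedDensity.aestronglyMeasurable ?_
    filter_upwards [hIoo] with u hu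
    rw [Real.norm_eq_abs, abs_le]
    obtain ⟨h1', h2'⟩ := one_sub_rpow_mem hα0 (by linarith) hu.1 hu.2
    have h3 : 0 < 1 - u := by linarith [hu.2]
    have hB0 : 0 ≤ B := le_trans zero_le_one (le_max_left _ _)
    have h4 : 0 ≤ B * (1 - u) ^ (p - 1 - s * p) := by positivity
    have h5 := hneg u hu
    have h6 := hDs_pos u hu
    simp only [Pi.add_apply]
    refine ⟨by linarith, ?_⟩
    suffices h : D u ≤ B * (1 - u) ^ (p - 1 - s * p) by linarith
    have hpw : 1 - u ^ (betaExp s p α - 1) ≤ B * (1 - u) := by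
      rcases le_total (betaExp s p α - 1) 1 with hb | hb
      · have : u ≤ u ^ (betaExp s p α - 1) := by
          simpa using Real.rpow_le_rpow_of_exponent_ge hu.1 hu.2.le hb
        have hB1 : 1 ≤ B := le_max_left _ _
        nlinarith
      · have := one_add_mul_self_le_rpow_one_add (s := u - 1) (by linarith [hu.1]) hb
        have hB1 : betaExp s p α - 1 ≤ B := le_max_right _ _
        rw [show 1 + (u - 1) = u by ring] at this
        nlinarith
    calc D u ≤ (1 - u) ^ (p - 1) * (1 - u) ^ (-(1 + s * p)) * (B * (1 - u)) := by
          simp only [hD, foldedDensity]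
          have hA : (1 - u ^ α) ^ (p - 1) ≤ (1 - u) ^ (p - 1) :=
            Real.rpow_le_rpow h1'.le h2' (by linarith)
          have hA0 : 0 < (1 - u ^ α) ^ (p - 1) := by positivity
          have hk : 0 < (1 - u) ^ (-(1 + s * p)) := by positivity
          have hBu : 0 ≤ B * (1 - u) := by positivity
          calc _ ≤ (1 - u ^ α) ^ (p - 1) * (1 - u) ^ (-(1 + s * p)) * (B * (1 - u)) := by gcongr
            _ ≤ _ := by gcongr
      _ = B * (1 - u) ^ (p - 1 - s * p) := by
          rw [show p - 1 - s * p = (p - 1) + (-(1 + s * p)) + 1 by ring, Real.rpow_add h3,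
            Real.rpow_add h3, Real.rpow_one]
          ring
  refine ⟨hDi, 1 / (s * p) - ∫ u in Set.Ioc (0 : ℝ) 1, max (-D u) 0,
    1 / (s * p) + ∫ u in Set.Ioc (0 : ℝ) 1, |D u|, ?_, ?_⟩
  · have hi2 : IntegrableOn (fun u => max (-D u) 0) (Set.Ioc 0 1) := hDi.neg.pos_part
    have hi3 : IntegrableOn (fun u => Ds u - max (-D u) 0) (Set.Ioc 0 1) := hci.sub hi2
    -- Writing `1/(sp)` as `∫ Ds` turns positivity of `c` into positivity of the integral of `Ds -
    -- D⁻`, which is positive throughout `(0, 1)`.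
    rw [← hcv, ← integral_sub hci hi2, setIntegral_pos_iff_support_of_nonneg_ae _ hi3]
    · refine lt_of_lt_of_le (by simp) (measure_mono (μ := volume) (s := Set.Ioo (0 : ℝ) 1) ?_)
      intro u hu
      refine ⟨?_, hu.1, hu.2.le⟩
      have h1 := hneg u hu
      have h2 := hDs_pos u hu
      have : max (-D u) 0 < Ds u := max_lt (by linarith) h2
      simp only [Function.mem_support, ne_eq]
      exact (sub_pos.2 this).ne'
    · filter_upwards [hIoo] with u hu
      have h1 := hneg u hu
      have h2 := hDs_pos u hu
      have : max (-D u) 0 < Ds u := max_lt (by linarith) h2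
      exact (sub_pos.2 this).le
  · intro r hr0 hr1
    have hsub : Set.Ioc 0 r ⊆ Set.Ioc (0 : ℝ) 1 := Set.Ioc_subset_Ioc_right hr1.le
    have hi2 : IntegrableOn (fun u => max (-D u) 0) (Set.Ioc 0 1) := hDi.neg.pos_part
    constructor
    · have h1 : ∫ u in Set.Ioc 0 r, max (-D u) 0 ≤ ∫ u in Set.Ioc (0 : ℝ) 1, max (-D u) 0 :=
        setIntegral_mono_set hi2 (.of_forall fun u => le_max_right _ _) (.of_forall hsub)
      have h2 : -∫ u in Set.Ioc 0 r, D u ≤ ∫ u in Set.Ioc 0 r, max (-D u) 0 := by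
        rw [← integral_neg]
        exact integral_mono (hDi.mono_set hsub).neg (hi2.mono_set hsub) fun u => le_max_left _ _
      linarith
    · have h1 : ∫ u in Set.Ioc 0 r, |D u| ≤ ∫ u in Set.Ioc (0 : ℝ) 1, |D u| :=
        setIntegral_mono_set hDi.abs (.of_forall fun u => abs_nonneg _) (.of_forall hsub)
      have h2 : ∫ u in Set.Ioc 0 r, D u ≤ ∫ u in Set.Ioc 0 r, |D u| :=
        integral_mono (hDi.mono_set hsub) (IntegrableOn.mono_set hDi.abs hsub) fun u => le_abs_self _
      linarith

/-- The one-dimensional truncated integral, folded onto the unit interval. -/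
lemma integral_farSet_profile (hs0 : 0 < s) (hs1 : s < 1) (hp : 1 < p) (hα0 : 0 < α) (hαs : α < s)
    {r : ℝ} (hr0 : 0 < r) (hr1 : r < 1) :
    ∫ x in farSet r 1, oddPow p (1 - posPow α (1 + x)) * |x| ^ (-(1 + s * p)) =
      1 / (s * p) + ∫ u in Set.Ioc 0 r, foldedDensity s p α u := by
  have hsp : 0 < s * p := by nlinarith
  have hpm : Measurable (posPow α) := (continuous_posPow hα0).measurable
  have hom := measurable_oddPow p
  set H : ℝ → ℝ := fun v => oddPow p (1 - posPow α v) * |v - 1| ^ (-(1 + s * p)) with hH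
  have hHm : Measurable H := by simp only [hH]; fun_prop
  have hset : farSet r 1 = (fun x => 1 + x) ⁻¹' (Set.Iic r ∪ Set.Ici r⁻¹) := by
    ext x
    simp only [farSet, Set.mem_ofPred_eq, Set.mem_preimage, Set.mem_union, Set.mem_Iic,
      Set.mem_Ici, mul_one]
    rw [inv_le_iff_one_le_mul₀' hr0]
  have hmp := measurePreserving_add_left (volume : Measure ℝ) 1
  have hemb : MeasurableEmbedding fun x : ℝ => 1 + x := measurableEmbedding_addLeft 1
  have hI0 : IntegrableOn H (Set.Iic r ∪ Set.Ici r⁻¹) := by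
    rw [← hmp.integrableOn_comp_preimage hemb, ← hset]
    refine (integrableOn_profile_farSet hs0 hs1 hp hα0 hαs hr0 hr1).mono'
      (hHm.comp (measurable_const_add 1)).aestronglyMeasurable (.of_forall fun x => ?_)
    simp only [hH, Function.comp, Real.norm_eq_abs, abs_mul, abs_oddPow hp, add_sub_cancel_left]
    rw [abs_of_nonneg (by positivity : 0 ≤ |x| ^ (-(1 + s * p)))]
  have e0 : ∫ x in farSet r 1, oddPow p (1 - posPow α (1 + x)) * |x| ^ (-(1 + s * p)) =
      ∫ v in Set.Iic r ∪ Set.Ici r⁻¹, H v := by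
    rw [hset, ← hmp.setIntegral_preimage_emb hemb H]
    simp [hH]
  have hr1' : 1 < r⁻¹ := (one_lt_inv₀ hr0).2 hr1
  have hdisj : Disjoint (Set.Iic r) (Set.Ici r⁻¹) := by
    rw [Set.disjoint_left]
    intro x hx hx'
    simp only [Set.mem_Iic, Set.mem_Ici] at hx hx'
    linarith
  have hIr : IntegrableOn H (Set.Iic r) := hI0.mono_set Set.subset_union_left
  have hIi : IntegrableOn H (Set.Ici r⁻¹) := hI0.mono_set Set.subset_union_right
  rw [e0, setIntegral_union hdisj measurableSet_Ici hIr hIi,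
    ← Set.Iic_union_Ioc_eq_Iic hr0.le, setIntegral_union (Set.Iic_disjoint_Ioc le_rfl)
    measurableSet_Ioc (hIr.mono_set (Set.Iic_subset_Iic.2 hr0.le))
    (hIr.mono_set Set.Ioc_subset_Iic_self)]
  have e1 : ∫ v in Set.Iic 0, H v = 1 / (s * p) := by
    have h1 : ∫ v in Set.Iic 0, H v = ∫ v in Set.Iic 0, (1 - v) ^ (-(1 + s * p)) := by
      refine setIntegral_congr_fun measurableSet_Iic fun v hv => ?_
      simp only [hH]
      rw [posPow_of_nonpos hα0 hv, sub_zero, oddPow_of_nonneg hp zero_le_one, Real.one_rpow,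
        one_mul, abs_sub_comm, abs_of_nonneg]
      have := Set.mem_Iic.1 hv
      linarith
    have h2 := integral_comp_neg_Iic (c := 0) (f := fun x : ℝ => (1 + x) ^ (-(1 + s * p)))
    simp only [neg_zero, ← sub_eq_add_neg] at h2
    have h3 : ∫ x in Set.Ioi (0 : ℝ), (1 + x) ^ (-(1 + s * p)) =
        ∫ x in Set.Ioi (1 : ℝ), x ^ (-(1 + s * p)) := by
      rw [← hmp.setIntegral_preimage_emb hemb fun x => x ^ (-(1 + s * p))]
      simp
    rw [h1, h2, h3, integral_Ioi_rpow_of_lt (by linarith) one_pos, Real.one_rpow]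
    rw [show -(1 + s * p) + 1 = -(s * p) by ring, neg_div_neg_eq]
  set G : ℝ → ℝ := fun u => (1 - u ^ α) ^ (p - 1) * (1 - u) ^ (-(1 + s * p)) with hG
  have e2 : ∫ v in Set.Ioc 0 r, H v = ∫ u in Set.Ioc 0 r, G u := by
    refine setIntegral_congr_fun measurableSet_Ioc fun u hu => ?_
    have hu1 : u < 1 := lt_of_le_of_lt hu.2 hr1
    obtain ⟨h1, h2⟩ := one_sub_rpow_mem hα0 (by linarith) hu.1 hu1
    simp only [hH, hG]
    rw [posPow_of_pos hu.1, oddPow_of_nonneg hp h1.le, abs_sub_comm, abs_of_nonneg (by linarith)]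
  have hGi : IntegrableOn G (Set.Ioc 0 r) := by
    refine (hIr.mono_set Set.Ioc_subset_Iic_self).congr_fun (fun u hu => ?_) measurableSet_Ioc
    have hu1 : u < 1 := lt_of_le_of_lt hu.2 hr1
    obtain ⟨h1, h2⟩ := one_sub_rpow_mem hα0 (by linarith) hu.1 hu1
    simp only [hH, hG]
    rw [posPow_of_pos hu.1, oddPow_of_nonneg hp h1.le, abs_sub_comm, abs_of_nonneg (by linarith)]
  -- The folding `v = u⁻¹`; the sign changes because the profile exceeds `1` on this side.
  have e3 : ∫ v in Set.Ici r⁻¹, H v =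
      ∫ u in Set.Ioc 0 r, -(G u * u ^ (betaExp s p α - 1)) := by
    have hsub : Set.Ici r⁻¹ ⊆ Set.Ioi 0 := fun x hx =>
      lt_of_lt_of_le (by positivity) (Set.mem_Ici.1 hx)
    have h1 := integral_comp_rpow_Ioi ((Set.Ici r⁻¹).indicator H) (p := -1) (by norm_num)
    rw [setIntegral_indicator measurableSet_Ici, Set.inter_eq_right.2 hsub] at h1
    rw [← h1, ← integral_indicator measurableSet_Ioc, ← integral_indicator measurableSet_Ioi]
    congr 1
    ext u
    by_cases hu : 0 < u
    swap
    · rw [Set.indicator_of_notMem (by simpa using hu), Set.indicator_of_notMem]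
      exact fun h => hu h.1
    rw [Set.indicator_of_mem (Set.mem_Ioi.2 hu), Real.rpow_neg_one]
    by_cases hur : u ≤ r
    swap
    · rw [Set.indicator_of_notMem, Set.indicator_of_notMem, smul_zero]
      · exact fun h => hur h.2
      · simp only [Set.mem_Ici]
        rw [inv_le_inv₀ hr0 hu]; exact hur
    have hu1 : u < 1 := lt_of_le_of_lt hur hr1
    obtain ⟨h2, h3⟩ := one_sub_rpow_mem hα0 (by linarith) hu hu1
    have hu2 : 0 < 1 - u := by linarith
    rw [Set.indicator_of_mem, Set.indicator_of_mem (show u ∈ Set.Ioc 0 r from ⟨hu, hur⟩)]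
    swap
    · simp only [Set.mem_Ici]
      rw [inv_le_inv₀ hr0 hu]; exact hur
    simp only [hH, hG, smul_eq_mul, abs_neg, abs_one, one_mul]
    rw [posPow_of_pos (inv_pos.2 hu), ← neg_sub _ (1 : ℝ), oddPow_neg,
      show u⁻¹ ^ α - 1 = u ^ (-α) * (1 - u ^ α) by
        rw [mul_sub, ← Real.rpow_add hu, neg_add_cancel, Real.rpow_zero, mul_one,
          Real.rpow_neg hu.le, Real.inv_rpow hu.le],
      oddPow_mul hp (by positivity), oddPow_of_nonneg hp h2.le,
      show u⁻¹ - 1 = u⁻¹ * (1 - u) by field_simp,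
      abs_of_pos (by positivity), Real.mul_rpow (by positivity) hu2.le, Real.inv_rpow hu.le,
      ← Real.rpow_neg hu.le, ← Real.rpow_mul hu.le]
    -- The three factors come from the Jacobian of the inversion, the increment of the profile and
    -- the kernel.
    have : u ^ (betaExp s p α - 1) = u ^ (-1 - 1 : ℝ) * u ^ (-α * (p - 1)) *
        u ^ (- -(1 + s * p)) := by
      rw [← Real.rpow_add hu, ← Real.rpow_add hu]
      congr 1
      unfold betaExp; ring
    rw [this]
    ring
  have hDi : IntegrableOn (foldedDensity s p α) (Set.Ioc 0 r) :=
    (exists_bounds_integral_foldedDensity hs0 hs1 hp hα0 hαs).1.mono_set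
      (Set.Ioc_subset_Ioc_right hr1.le)
  have hGβ : IntegrableOn (fun u => -(G u * u ^ (betaExp s p α - 1))) (Set.Ioc 0 r) := by
    refine (hDi.sub hGi).congr (.of_forall fun u => ?_)
    simp only [foldedDensity, hG, Pi.sub_apply]; ring
  rw [e1, e2, e3, add_assoc, ← integral_add hGi hGβ]
  congr 1
  refine integral_congr_ae (.of_forall fun u => ?_)
  simp only [foldedDensity, hG]; ring

/-- The constants precede the quantifier over `r`: this uniformity is what survives the limit `r →
1` in the weak form. -/
theorem exists_bounds_integral_farSet (hs0 : 0 < s) (hs1 : s < 1) (hp : 1 < p) (hα0 : 0 < α)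
    (hαs : α < s) : ∃ c C : ℝ, 0 < c ∧ 0 < C ∧ ∀ r : ℝ, 0 < r → r < 1 → ∀ L : ℝ, 0 < L →
      c * L ^ (-betaExp s p α) ≤
        ∫ t in farSet r L, oddPow p (posPow α L - posPow α (L + t)) * |t| ^ (-(1 + s * p)) ∧
      ∫ t in farSet r L, oddPow p (posPow α L - posPow α (L + t)) * |t| ^ (-(1 + s * p)) ≤
        C * L ^ (-betaExp s p α) := by
  obtain ⟨-, c, C, hc, hcC⟩ := exists_bounds_integral_foldedDensity hs0 hs1 hp hα0 hαs
  have hC : 0 < C := by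
    have := hcC (1 / 2) (by norm_num) (by norm_num)
    linarith
  refine ⟨c, C, hc, hC, fun r hr0 hr1 L hL => ?_⟩
  have hscale :
      ∫ t in farSet r L, oddPow p (posPow α L - posPow α (L + t)) * |t| ^ (-(1 + s * p)) =
      (1 / (s * p) + ∫ u in Set.Ioc 0 r, foldedDensity s p α u) * L ^ (-betaExp s p α) := by
    rw [← integral_farSet_profile hs0 hs1 hp hα0 hαs hr0 hr1,
      ← integral_indicator (measurableSet_farSet r L),
      ← integral_indicator (measurableSet_farSet r 1), ← integral_mul_const]
    set F := (farSet r L).indicator fun t =>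
      oddPow p (posPow α L - posPow α (L + t)) * |t| ^ (-(1 + s * p))
    have h1 := Measure.integral_comp_mul_left F L
    rw [abs_of_pos (inv_pos.2 hL), smul_eq_mul, eq_inv_mul_iff_mul_eq₀ hL.ne',
      ← integral_const_mul] at h1
    rw [← h1]
    refine integral_congr_ae (.of_forall fun x => ?_)
    simp only [F]
    by_cases hx : x ∈ farSet r 1
    · rw [Set.indicator_of_mem hx, Set.indicator_of_mem ((mul_mem_farSet hL).2 hx),
        posPow_sub_posPow_scale hL, oddPow_mul hp (by positivity), abs_mul, abs_of_pos hL,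
        Real.mul_rpow hL.le (abs_nonneg _), ← Real.rpow_mul hL.le]
      have : L ^ (-betaExp s p α) = L * L ^ (α * (p - 1)) * L ^ (-(1 + s * p)) := by
        nth_rw 2 [← Real.rpow_one L]
        rw [← Real.rpow_add hL, ← Real.rpow_add hL]
        congr 1
        unfold betaExp; ring
      rw [this]; ring
    · rw [Set.indicator_of_notMem hx, Set.indicator_of_notMem (mt (mul_mem_farSet hL).1 hx)]
      simp
  obtain ⟨h1, h2⟩ := hcC r hr0 hr1
  rw [hscale]
  constructor <;> gcongr

end profile

/-! ### Bounds for the diffeomorphism and freezing of the kernel -/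

/-- Quantitative consequences of being a `C^{1,1}`-diffeomorphism equal to the identity outside
a ball. -/
structure DiffeoBounds {N : ℕ} (ψ : Euc N ≃ Euc N) (m M K R : ℝ) : Prop where
  m_pos : 0 < m
  M_pos : 0 < M
  K_pos : 0 < K
  continuous : Continuous ψ
  continuous_symm : Continuous ψ.symm
  hasFDerivAt : ∀ X, HasFDerivAt ψ (fderiv ℝ ψ X) X
  lower : ∀ X Y, m * ‖Y - X‖ ≤ ‖ψ Y - ψ X‖
  upper : ∀ X Y, ‖ψ Y - ψ X‖ ≤ M * ‖Y - X‖
  fderiv_lower : ∀ X h, m * ‖h‖ ≤ ‖fderiv ℝ ψ X h‖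
  fderiv_upper : ∀ X h, ‖fderiv ℝ ψ X h‖ ≤ M * ‖h‖
  taylor : ∀ X Y, ‖ψ Y - ψ X - fderiv ℝ ψ X (Y - X)‖ ≤ K * ‖Y - X‖ ^ 2
  det_lower : ∀ X, m ≤ |(fderiv ℝ ψ X).det|
  det_upper : ∀ X, |(fderiv ℝ ψ X).det| ≤ M
  det_lip : ∀ X Y, |(|(fderiv ℝ ψ Y).det| - |(fderiv ℝ ψ X).det|)| ≤ K * ‖Y - X‖
  symm_norm_le : ∀ x, ‖ψ.symm x‖ ≤ ‖x‖ + R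

lemma contDiff_det {N : ℕ} : ContDiff ℝ 1 fun A : Euc N →L[ℝ] Euc N => A.det := by
  have h : (fun A : Euc N →L[ℝ] Euc N => A.det) = fun A => ∑ σ : Equiv.Perm (Fin N),
      (Equiv.Perm.sign σ : ℝ) * ∏ i, (A (EuclideanSpace.single i 1)) (σ i) := by
    ext A
    rw [ContinuousLinearMap.det,
      ← LinearMap.det_toMatrix (EuclideanSpace.basisFun (Fin N) ℝ).toBasis, Matrix.det_apply']
    refine Finset.sum_congr rfl fun σ _ => ?_
    congr 1
  rw [h]
  refine ContDiff.sum fun σ _ => contDiff_const.mul (contDiff_prod fun i _ => ?_)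
  have h2 : ContDiff ℝ 1 fun A : Euc N →L[ℝ] Euc N => A (EuclideanSpace.single i 1) := by
    fun_prop
  exact (contDiff_euclidean.1 h2) (σ i)

/-- The determinant is `C^1`, hence bounded and Lipschitz on the compact convex ball of radius `M`.
Lipschitz control of `Dψ` thereby passes to the Jacobian. -/
lemma exists_det_bounds {N : ℕ} (M : ℝ) : ∃ B : ℝ, 0 < B ∧
    (∀ A : Euc N →L[ℝ] Euc N, ‖A‖ ≤ M → |A.det| ≤ B) ∧
    ∀ A A' : Euc N →L[ℝ] Euc N, ‖A‖ ≤ M → ‖A'‖ ≤ M → |A'.det - A.det| ≤ B * ‖A' - A‖ := by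
  have hc := contDiff_det (N := N)
  have hK : IsCompact (Metric.closedBall (0 : Euc N →L[ℝ] Euc N) M) :=
    isCompact_closedBall _ _
  obtain ⟨B₁, hB₁⟩ := hK.exists_bound_of_continuousOn hc.continuous.continuousOn
  obtain ⟨B₂, hB₂⟩ := hK.exists_bound_of_continuousOn (hc.continuous_fderiv one_ne_zero).continuousOn
  refine ⟨max 1 (max B₁ B₂), by positivity, fun A hA => ?_, fun A A' hA hA' => ?_⟩
  · exact (hB₁ A (by simpa using hA)).trans ((le_max_left _ _).trans (le_max_right _ _))
  · have := (convex_closedBall (0 : Euc N →L[ℝ] Euc N) M).norm_image_sub_le_of_norm_fderiv_le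
      (fun x _ => (hc.differentiable one_ne_zero) x) hB₂ (x := A) (y := A')
      (by simpa using hA) (by simpa using hA')
    refine this.trans ?_
    gcongr
    exact (le_max_right _ _).trans (le_max_right _ _)

lemma exists_bound_fderiv {N : ℕ} {f : Euc N → Euc N} (hf : ContDiff ℝ 1 f) {R : ℝ}
    (hR : ∀ x, R ≤ ‖x‖ → f x = x) : ∃ M : ℝ, 0 < M ∧ ∀ x, ‖fderiv ℝ f x‖ ≤ M := by
  obtain ⟨B, hB⟩ := (isCompact_closedBall (0 : Euc N) R).exists_bound_of_continuousOn
    (hf.continuous_fderiv one_ne_zero).continuousOn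
  refine ⟨max 1 B, by positivity, fun x => ?_⟩
  rcases le_or_gt ‖x‖ R with hx | hx
  · exact (hB x (by simpa using hx)).trans (le_max_right _ _)
  · have : f =ᶠ[nhds x] id := by
      filter_upwards [(isOpen_lt continuous_const continuous_norm).mem_nhds hx] with y hy
      exact hR y (le_of_lt hy)
    rw [this.fderiv_eq, fderiv_id]
    exact ContinuousLinearMap.norm_id_le.trans (le_max_left _ _)

/-- Both `ψ` and its inverse have bounded derivatives, being the identity outside a ball. Upper
bounds for the inverse become lower bounds for `ψ` through the chain rule `Dψ⁻¹ ∘ Dψ = id` and its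
determinant. -/
theorem IsC11Diffeo.exists_bounds {N : ℕ} {ψ : Euc N ≃ Euc N} (hψ : IsC11Diffeo ψ) {R : ℝ}
    (hR0 : 0 < R) (hR : ∀ x, R ≤ ‖x‖ → ψ x = x) : ∃ m M K : ℝ, DiffeoBounds ψ m M K R := by
  have hRs : ∀ x, R ≤ ‖x‖ → ψ.symm x = x := fun x hx => by
    rw [Equiv.symm_apply_eq, hR x hx]
  obtain ⟨M₁, hM₁, hM₁b⟩ := exists_bound_fderiv hψ.contDiff hR
  obtain ⟨M₂, hM₂, hM₂b⟩ := exists_bound_fderiv hψ.contDiff_symm hRs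
  obtain ⟨K₀, hK₀⟩ := hψ.lipschitz_fderiv
  obtain ⟨B₁, hB₁, hB₁b, hB₁l⟩ := exists_det_bounds (N := N) M₁
  obtain ⟨B₂, hB₂, hB₂b, -⟩ := exists_det_bounds (N := N) M₂
  have hd : Differentiable ℝ ψ := hψ.contDiff.differentiable one_ne_zero
  have hds : Differentiable ℝ ψ.symm := hψ.contDiff_symm.differentiable one_ne_zero
  have hup : ∀ X Y, ‖ψ Y - ψ X‖ ≤ M₁ * ‖Y - X‖ := fun X Y =>
    convex_univ.norm_image_sub_le_of_norm_fderiv_le (fun x _ => hd x) (fun x _ => hM₁b x)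
      (Set.mem_univ _) (Set.mem_univ _)
  have hups : ∀ X Y, ‖ψ.symm Y - ψ.symm X‖ ≤ M₂ * ‖Y - X‖ := fun X Y =>
    convex_univ.norm_image_sub_le_of_norm_fderiv_le (fun x _ => hds x) (fun x _ => hM₂b x)
      (Set.mem_univ _) (Set.mem_univ _)
  have hcomp : ∀ X, (fderiv ℝ ψ.symm (ψ X)).comp (fderiv ℝ ψ X) = ContinuousLinearMap.id ℝ _ := by
    intro X
    have h1 := ((hds (ψ X)).hasFDerivAt).comp X (hd X).hasFDerivAt
    have h2 : (ψ.symm ∘ ψ : Euc N → Euc N) = id := by ext1 x; simp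
    rw [h2] at h1
    exact h1.unique (hasFDerivAt_id X)
  have hdet : ∀ X, |(fderiv ℝ ψ.symm (ψ X)).det| * |(fderiv ℝ ψ X).det| = 1 := by
    intro X
    have h1 := congrArg (fun A : Euc N →L[ℝ] Euc N => LinearMap.det (A : Euc N →ₗ[ℝ] Euc N)) (hcomp X)
    have h2 : LinearMap.det ((fderiv ℝ ψ.symm (ψ X) : Euc N →ₗ[ℝ] Euc N) ∘ₗ
        (fderiv ℝ ψ X : Euc N →ₗ[ℝ] Euc N)) = 1 := h1.trans (by simp)
    rw [LinearMap.det_comp] at h2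
    rw [← abs_mul]
    exact (congrArg abs h2).trans abs_one
  have hK : ∀ X Y, ‖fderiv ℝ ψ Y - fderiv ℝ ψ X‖ ≤ K₀ * ‖Y - X‖ := fun X Y => by
    simpa [dist_eq_norm] using hK₀.dist_le_mul Y X
  refine ⟨min M₂⁻¹ B₂⁻¹, max M₁ B₁, max 1 (max K₀ (B₁ * K₀)), by positivity, by positivity,
    by positivity, hψ.contDiff.continuous, hψ.contDiff_symm.continuous,
    fun X => (hd X).hasFDerivAt, fun X Y => ?_, fun X Y => ?_, fun X h => ?_, fun X h => ?_,
    fun X Y => ?_, fun X => ?_, fun X => ?_, fun X Y => ?_, fun x => ?_⟩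
  · have h1 := hups (ψ X) (ψ Y)
    simp only [Equiv.symm_apply_apply] at h1
    calc _ ≤ M₂⁻¹ * ‖Y - X‖ := by gcongr; exact min_le_left _ _
      _ ≤ _ := by rw [inv_mul_le_iff₀ hM₂]; exact h1
  · exact (hup X Y).trans (by gcongr; exact le_max_left _ _)
  · have h1 := congrArg (fun A => A h) (hcomp X)
    simp only [ContinuousLinearMap.comp_apply, ContinuousLinearMap.id_apply] at h1
    have h2 : ‖h‖ ≤ M₂ * ‖fderiv ℝ ψ X h‖ := by
      nth_rw 1 [← h1]
      exact ContinuousLinearMap.le_of_opNorm_le _ (hM₂b _) _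
    calc _ ≤ M₂⁻¹ * ‖h‖ := by gcongr; exact min_le_left _ _
      _ ≤ _ := by rw [inv_mul_le_iff₀ hM₂]; exact h2
  · exact (ContinuousLinearMap.le_of_opNorm_le _ (hM₁b X) h).trans
      (by gcongr; exact le_max_left _ _)
  · have h1 := (convex_segment X Y).norm_image_sub_le_of_norm_fderiv_le' (f := ψ)
      (φ := fderiv ℝ ψ X) (C := K₀ * ‖Y - X‖) (𝕜 := ℝ) (fun x _ => hd x) (fun z hz => ?_)
      (left_mem_segment ℝ X Y) (right_mem_segment ℝ X Y)
    · refine h1.trans ?_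
      rw [mul_assoc, ← pow_two]
      gcongr
      exact (le_max_left _ _).trans (le_max_right _ _)
    · refine (hK X z).trans ?_
      gcongr
      have := norm_sub_le_of_mem_segment hz
      exact this
  · have h1 := hdet X
    have h2 := hB₂b _ (hM₂b (ψ X))
    refine (min_le_right _ _).trans ?_
    rw [inv_le_iff_one_le_mul₀ hB₂, ← h1, mul_comm]
    gcongr
  · exact (hB₁b _ (hM₁b X)).trans (le_max_right _ _)
  · calc _ ≤ |(fderiv ℝ ψ Y).det - (fderiv ℝ ψ X).det| := abs_abs_sub_abs_le _ _
      _ ≤ B₁ * ‖fderiv ℝ ψ Y - fderiv ℝ ψ X‖ := hB₁l _ _ (hM₁b X) (hM₁b Y)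
      _ ≤ B₁ * (K₀ * ‖Y - X‖) := by gcongr; exact hK X Y
      _ ≤ _ := by
        rw [← mul_assoc]
        gcongr
        exact (le_max_right _ _).trans (le_max_right _ _)
  -- `ψ⁻¹` maps the open ball of radius `R` into the closed one: a preimage outside would be a fixed
  -- point of `ψ`, hence equal to `x`.
  · rcases le_or_gt R ‖x‖ with hx | hx
    · rw [hRs x hx]; linarith
    · have : ‖ψ.symm x‖ ≤ R := by
        by_contra! hcon
        have h1 := hR _ hcon.le
        rw [Equiv.apply_symm_apply] at h1
        rw [← h1] at hcon
        linarith
      linarith [norm_nonneg x]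

/-- The kernel of the transported operator. -/
def pullKernel {N : ℕ} (ψ : Euc N ≃ Euc N) (q : ℝ) (X Y : Euc N) : ℝ :=
  ‖ψ X - ψ Y‖ ^ (-q) * |(fderiv ℝ ψ Y).det|

/-- The frozen kernel. -/
def frozenKernel {N : ℕ} (ψ : Euc N ≃ Euc N) (q : ℝ) (X h : Euc N) : ℝ :=
  ‖fderiv ℝ ψ X h‖ ^ (-q) * |(fderiv ℝ ψ X).det|

namespace DiffeoBounds

variable {N : ℕ} {ψ : Euc N ≃ Euc N} {m M K R : ℝ}

lemma measurable_det (hb : DiffeoBounds ψ m M K R) :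
    Measurable fun Y => |(fderiv ℝ ψ Y).det| := by
  have h : LipschitzWith K.toNNReal fun Y => |(fderiv ℝ ψ Y).det| := by
    refine LipschitzWith.of_dist_le_mul fun x y => ?_
    rw [Real.dist_eq, dist_eq_norm, Real.coe_toNNReal _ hb.K_pos.le]
    exact hb.det_lip y x
  exact h.continuous.measurable

lemma measurable_pullKernel (hb : DiffeoBounds ψ m M K R) (q : ℝ) (X : Euc N) :
    Measurable (pullKernel ψ q X) := by
  have := hb.measurable_det
  have h2 := hb.continuous.measurable
  unfold pullKernel
  fun_prop

lemma lintegral_comp (hb : DiffeoBounds ψ m M K R) (F : Euc N → ENNReal) :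
    ∫⁻ y, F y = ∫⁻ Y, ENNReal.ofReal |(fderiv ℝ ψ Y).det| * F (ψ Y) := by
  have := lintegral_image_eq_lintegral_abs_det_fderiv_mul volume MeasurableSet.univ
    (fun x _ => (hb.hasFDerivAt x).hasFDerivWithinAt) ψ.injective.injOn F
  simpa [Set.image_univ, ψ.surjective.range_eq] using this

lemma integral_comp (hb : DiffeoBounds ψ m M K R) (F : Euc N → ℝ) :
    ∫ y, F y = ∫ Y, |(fderiv ℝ ψ Y).det| * F (ψ Y) := by
  have := integral_image_eq_integral_abs_det_fderiv_smul volume MeasurableSet.univ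
    (fun x _ => (hb.hasFDerivAt x).hasFDerivWithinAt) ψ.injective.injOn F
  simpa [Set.image_univ, ψ.surjective.range_eq] using this

lemma pullKernel_le (hb : DiffeoBounds ψ m M K R) {q : ℝ} (hq : 0 < q) (X Y : Euc N) :
    pullKernel ψ q X Y ≤ m ^ (-q) * M * ‖Y - X‖ ^ (-q) := by
  have hm := hb.m_pos
  have hM := hb.M_pos
  -- On the diagonal both sides vanish, by the convention `0 ^ (-q) = 0` for `q ≠ 0`.
  rcases eq_or_ne X Y with rfl | hXY
  · simp [pullKernel, Real.zero_rpow (by linarith : -q ≠ 0)]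
  have h1 : 0 < ‖Y - X‖ := norm_pos_iff.2 (sub_ne_zero.2 hXY.symm)
  have h2 : ‖ψ X - ψ Y‖ ^ (-q) ≤ m ^ (-q) * ‖Y - X‖ ^ (-q) := by
    rw [← Real.mul_rpow hm.le h1.le, norm_sub_rev (ψ X)]
    exact Real.rpow_le_rpow_of_nonpos (by positivity) (hb.lower X Y) (by linarith)
  calc _ ≤ m ^ (-q) * ‖Y - X‖ ^ (-q) * M := by
        unfold pullKernel
        gcongr
        exact hb.det_upper Y
    _ = _ := by ring

lemma le_pullKernel (hb : DiffeoBounds ψ m M K R) {q : ℝ} (hq : 0 < q) (X Y : Euc N) :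
    M ^ (-q) * m * ‖Y - X‖ ^ (-q) ≤ pullKernel ψ q X Y := by
  have hm := hb.m_pos
  have hM := hb.M_pos
  rcases eq_or_ne X Y with rfl | hXY
  · simp [pullKernel, Real.zero_rpow (by linarith : -q ≠ 0)]
  have h1 : 0 < ‖Y - X‖ := norm_pos_iff.2 (sub_ne_zero.2 hXY.symm)
  have h2 : M ^ (-q) * ‖Y - X‖ ^ (-q) ≤ ‖ψ X - ψ Y‖ ^ (-q) := by
    rw [← Real.mul_rpow hM.le h1.le, norm_sub_rev (ψ X)]
    exact Real.rpow_le_rpow_of_nonpos (lt_of_lt_of_le (by positivity) (hb.lower X Y))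
      (hb.upper X Y) (by linarith)
  calc _ = M ^ (-q) * ‖Y - X‖ ^ (-q) * m := by ring
    _ ≤ _ := by
        unfold pullKernel
        gcongr
        exact hb.det_lower Y

end DiffeoBounds

lemma abs_rpow_neg_sub_le {q a b d : ℝ} (hq : 0 < q) (hd : 0 < d) (ha : d ≤ a) (hb : d ≤ b) :
    |a ^ (-q) - b ^ (-q)| ≤ q * d ^ (-q - 1) * |a - b| := by
  have h := (convex_Ici d).norm_image_sub_le_of_norm_hasDerivWithin_le
    (f := fun x : ℝ => x ^ (-q)) (f' := fun x => -q * x ^ (-q - 1)) (C := q * d ^ (-q - 1))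
    (x := b) (y := a) (fun x hx => ?_) (fun x hx => ?_) hb ha
  · simpa using h
  · exact (Real.hasDerivAt_rpow_const
      (Or.inl (lt_of_lt_of_le hd hx).ne')).hasDerivWithinAt
  · have hx0 : 0 < x := lt_of_lt_of_le hd hx
    rw [Real.norm_eq_abs, abs_mul, abs_neg, abs_of_pos hq, abs_of_pos (by positivity)]
    exact mul_le_mul_of_nonneg_left (Real.rpow_le_rpow_of_nonpos hd hx (by linarith)) hq.le

/-- This is where the Lipschitz derivative pays. For `|h| ≤ 1` the Taylor error `|h|²` changes a
norm comparable to `|h|`, so its power `-q` changes by at most a multiple of `|h|^{-q-1} |h|²`; the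
Jacobian factor contributes `|h|^{-q} |h|`. For `|h| ≥ 1` the two kernels are bounded separately. -/
theorem DiffeoBounds.exists_kernel_sub_le {N : ℕ} {ψ : Euc N ≃ Euc N} {m M K R : ℝ}
    (hb : DiffeoBounds ψ m M K R) {q : ℝ} (hq : 0 < q) : ∃ C : ℝ, 0 < C ∧ ∀ X h : Euc N,
      |pullKernel ψ q X (X + h) - frozenKernel ψ q X h| ≤ C * (min 1 ‖h‖ * ‖h‖ ^ (-q)) := by
  have hm := hb.m_pos
  have hM := hb.M_pos
  have hK := hb.K_pos
  refine ⟨max (m ^ (-q) * M) (q * m ^ (-q - 1) * K * M + m ^ (-q) * K), by positivity,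
    fun X h => ?_⟩
  rcases eq_or_ne h 0 with rfl | hh
  · simp [pullKernel, frozenKernel, Real.zero_rpow (by linarith : -q ≠ 0)]
  have hn : 0 < ‖h‖ := norm_pos_iff.2 hh
  have hmh : m ^ (-q) * ‖h‖ ^ (-q) = (m * ‖h‖) ^ (-q) := (Real.mul_rpow hm.le hn.le).symm
  have hl1 : m * ‖h‖ ≤ ‖ψ X - ψ (X + h)‖ := by
    have := hb.lower X (X + h)
    rwa [add_sub_cancel_left, norm_sub_rev] at this
  have hl2 := hb.fderiv_lower X h
  have hfz : ‖fderiv ℝ ψ X h‖ ^ (-q) ≤ m ^ (-q) * ‖h‖ ^ (-q) := by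
    rw [hmh]
    exact Real.rpow_le_rpow_of_nonpos (by positivity) hl2 (by linarith)
  rcases le_total 1 ‖h‖ with h1 | h1
  · rw [min_eq_left h1, one_mul]
    have hA : pullKernel ψ q X (X + h) ≤ m ^ (-q) * M * ‖h‖ ^ (-q) := by
      simpa using hb.pullKernel_le hq X (X + h)
    have hB : frozenKernel ψ q X h ≤ m ^ (-q) * M * ‖h‖ ^ (-q) := by
      calc _ ≤ m ^ (-q) * ‖h‖ ^ (-q) * M := by
            unfold frozenKernel
            gcongr
            exact hb.det_upper X
        _ = _ := by ring
    have hA0 : 0 ≤ pullKernel ψ q X (X + h) := by unfold pullKernel; positivity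
    have hB0 : 0 ≤ frozenKernel ψ q X h := by unfold frozenKernel; positivity
    refine le_trans (b := m ^ (-q) * M * ‖h‖ ^ (-q)) ?_ (by gcongr; exact le_max_left _ _)
    rw [abs_le]; constructor <;> linarith
  · rw [min_eq_right h1]
    refine le_trans (b := (q * m ^ (-q - 1) * K * M + m ^ (-q) * K) * (‖h‖ * ‖h‖ ^ (-q))) ?_
      (by gcongr; exact le_max_right _ _)
    set a := ‖ψ X - ψ (X + h)‖ with ha
    set b := ‖fderiv ℝ ψ X h‖ with hbd
    set J := |(fderiv ℝ ψ X).det| with hJ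
    set J' := |(fderiv ℝ ψ (X + h)).det| with hJ'
    have hab : |a - b| ≤ K * ‖h‖ ^ 2 := by
      have h2 := hb.taylor X (X + h)
      rw [add_sub_cancel_left] at h2
      rw [ha, norm_sub_rev]
      exact (abs_norm_sub_norm_le _ _).trans h2
    have hd := abs_rpow_neg_sub_le hq (by positivity) hl1 hl2
    have hJJ : |J' - J| ≤ K * ‖h‖ := by simpa using hb.det_lip X (X + h)
    have hJ'M : J' ≤ M := hb.det_upper _
    have hJ'0 : 0 ≤ J' := abs_nonneg _
    have e : pullKernel ψ q X (X + h) - frozenKernel ψ q X h =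
        (a ^ (-q) - b ^ (-q)) * J' + b ^ (-q) * (J' - J) := by
      unfold pullKernel frozenKernel; ring
    rw [e]
    calc _ ≤ |a ^ (-q) - b ^ (-q)| * J' + b ^ (-q) * |J' - J| := by
          refine (abs_add_le _ _).trans ?_
          rw [abs_mul, abs_mul, abs_of_nonneg hJ'0,
            abs_of_nonneg (by positivity : 0 ≤ b ^ (-q))]
      _ ≤ (q * (m * ‖h‖) ^ (-q - 1) * (K * ‖h‖ ^ 2)) * M +
          m ^ (-q) * ‖h‖ ^ (-q) * (K * ‖h‖) := by
          gcongr
          exact hd.trans (by gcongr)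
      _ = _ := by
          rw [Real.mul_rpow hm.le hn.le, Real.rpow_sub_one hn.ne']
          field_simp

/-! ### The truncated operator at the transported barrier -/

/-- The shifted level function `ψ⁻¹(x) · e_N + μ`. -/
def levelFun {N : ℕ} (hN : 1 ≤ N) (ψ : Euc N ≃ Euc N) (μ : ℝ) (x : Euc N) : ℝ :=
  lastCoord hN (ψ.symm x) + μ

lemma lastCoord_add {N : ℕ} (hN : 1 ≤ N) (X Y : Euc N) :
    lastCoord hN (X + Y) = lastCoord hN X + lastCoord hN Y := rfl

lemma abs_lastCoord_le {N : ℕ} (hN : 1 ≤ N) (X : Euc N) : |lastCoord hN X| ≤ ‖X‖ := by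
  exact PiLp.norm_apply_le X (⟨N - 1, by omega⟩ : Fin N)

lemma levelFun_comp_add {N : ℕ} (hN : 1 ≤ N) (ψ : Euc N ≃ Euc N) (μ : ℝ) (x h : Euc N) :
    levelFun hN ψ μ (ψ (ψ.symm x + h)) = levelFun hN ψ μ x + lastCoord hN h := by
  simp only [levelFun, Equiv.symm_apply_apply, lastCoord_add]; ring

section

variable {N : ℕ} {hN : 1 ≤ N} {s p α : ℝ} {ψ : Euc N ≃ Euc N} {m M K R : ℝ}

lemma DiffeoBounds.measurable_levelFun (hb : DiffeoBounds ψ m M K R) (μ : ℝ) :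
    Measurable (levelFun hN ψ μ) := by
  have h1 := measurable_lastCoord hN
  have h2 := hb.continuous_symm.measurable
  unfold levelFun
  exact (h1.comp h2).add_const μ

/-- The factor `min 1 ‖h‖` is not homogeneous, so the hyperplane formula is applied twice: where
`|h_N| ≤ 1` with `min 1 ‖h‖ ≤ ‖h‖`, which lowers the exponent by one, and elsewhere with `min 1 ‖h‖
≤ 1`. Both exponents exceed `N - 1` because `σ > 0`. -/
lemma exists_lintegral_lastCoord_min_le (hN : 1 ≤ N) {σ : ℝ} (hσ : 0 < σ) :
    ∃ κ : ℝ, 0 < κ ∧ ∀ f : ℝ → ENNReal, Measurable f →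
      ∫⁻ h, f (lastCoord hN h) * ENNReal.ofReal (min 1 ‖h‖ * ‖h‖ ^ (-((N : ℝ) + σ))) ≤
        ENNReal.ofReal κ * ∫⁻ t, f t * ENNReal.ofReal (min 1 |t| * |t| ^ (-(1 + σ))) := by
  obtain ⟨κ₁, hκ₁, h₁⟩ := exists_lintegral_lastCoord hN (r := (N : ℝ) + σ - 1) (by linarith)
    one_pos (ContinuousLinearMap.id ℝ (Euc N)) (by simp)
  obtain ⟨κ₂, hκ₂, h₂⟩ := exists_lintegral_lastCoord hN (r := (N : ℝ) + σ) (by linarith)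
    one_pos (ContinuousLinearMap.id ℝ (Euc N)) (by simp)
  refine ⟨κ₁ + κ₂, by positivity, fun f hf => ?_⟩
  have hS : MeasurableSet {t : ℝ | |t| ≤ 1} := measurableSet_le (by fun_prop) (by fun_prop)
  set f₁ := {t : ℝ | |t| ≤ 1}.indicator f with hf₁
  set f₂ := {t : ℝ | |t| ≤ 1}ᶜ.indicator f with hf₂
  have hf₁m : Measurable f₁ := hf.indicator hS
  have hf₂m : Measurable f₂ := hf.indicator hS.compl
  have hmI : Measurable fun h : Euc N => f₁ (lastCoord hN h) *
      ENNReal.ofReal (‖h‖ ^ (-((N : ℝ) + σ - 1))) :=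
    (hf₁m.comp (measurable_lastCoord hN)).mul (by fun_prop)
  calc _ ≤ ∫⁻ h, (f₁ (lastCoord hN h) * ENNReal.ofReal (‖h‖ ^ (-((N : ℝ) + σ - 1))) +
        f₂ (lastCoord hN h) * ENNReal.ofReal (‖h‖ ^ (-((N : ℝ) + σ)))) := by
        refine lintegral_mono fun h => ?_
        simp only [hf₁, hf₂]
        by_cases ht : |lastCoord hN h| ≤ 1
        · rw [Set.indicator_of_mem (by exact ht), Set.indicator_of_notMem (by simpa using ht),
            zero_mul, add_zero]
          gcongr
          rcases eq_or_ne h 0 with rfl | hh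
          · simp; positivity
          have hn : 0 < ‖h‖ := norm_pos_iff.2 hh
          rw [show -((N : ℝ) + σ - 1) = 1 + -((N : ℝ) + σ) by ring, Real.rpow_add hn, Real.rpow_one]
          gcongr
          exact min_le_right _ _
        · rw [Set.indicator_of_notMem (by exact ht), Set.indicator_of_mem (by exact ht),
            zero_mul, zero_add]
          gcongr
          exact mul_le_of_le_one_left (by positivity) (min_le_left _ _)
    _ = ENNReal.ofReal κ₁ * (∫⁻ t, f₁ t * ENNReal.ofReal (|t| ^ (-σ))) +
        ENNReal.ofReal κ₂ * ∫⁻ t, f₂ t * ENNReal.ofReal (|t| ^ (-(1 + σ))) := by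
        rw [lintegral_add_left hmI]
        have e₁ := h₁ f₁ hf₁m
        have e₂ := h₂ f₂ hf₂m
        rw [show (N : ℝ) + σ - 1 - (N - 1) = σ by ring] at e₁
        rw [show (N : ℝ) + σ - (N - 1) = 1 + σ by ring] at e₂
        simp only [ContinuousLinearMap.id_apply] at e₁ e₂
        rw [e₁, e₂]
    _ ≤ ENNReal.ofReal κ₁ * (∫⁻ t, f t * ENNReal.ofReal (min 1 |t| * |t| ^ (-(1 + σ)))) +
        ENNReal.ofReal κ₂ * ∫⁻ t, f t * ENNReal.ofReal (min 1 |t| * |t| ^ (-(1 + σ))) := by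
        gcongr 1
        · refine mul_le_mul_right (lintegral_mono fun t => ?_) _
          simp only [hf₁]
          by_cases ht : |t| ≤ 1
          · rw [Set.indicator_of_mem (by exact ht), min_eq_right ht]
            rcases eq_or_ne t 0 with rfl | h0
            · simp [Real.zero_rpow (neg_ne_zero.2 hσ.ne')]
            have hn : 0 < |t| := abs_pos.2 h0
            rw [show -σ = 1 + -(1 + σ) by ring, Real.rpow_add hn, Real.rpow_one]
          · rw [Set.indicator_of_notMem (by exact ht), zero_mul]; exact zero_le
        · refine mul_le_mul_right (lintegral_mono fun t => ?_) _
          simp only [hf₂]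
          by_cases ht : |t| ≤ 1
          · rw [Set.indicator_of_notMem (by simpa using ht), zero_mul]; exact zero_le
          · rw [Set.indicator_of_mem (by exact ht), min_eq_left (not_le.1 ht).le, one_mul]
    _ = _ := by rw [← add_mul, ENNReal.ofReal_add hκ₁.le hκ₂.le]

/-- Integrals of functions of the level difference against the nonlocal kernel reduce to dimension
one, up to constants. -/
lemma DiffeoBounds.exists_lintegral_levelFun_bounds (hb : DiffeoBounds ψ m M K R) (hN : 1 ≤ N)
    {σ : ℝ} (hσ : 0 < σ) : ∃ c C : ℝ, 0 < c ∧ 0 < C ∧ ∀ (μ : ℝ) (x : Euc N) (f : ℝ → ENNReal),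
      Measurable f →
      ENNReal.ofReal c * ∫⁻ t, f t * ENNReal.ofReal (|t| ^ (-(1 + σ))) ≤
        ∫⁻ y, f (levelFun hN ψ μ y - levelFun hN ψ μ x) *
          ENNReal.ofReal (‖x - y‖ ^ (-((N : ℝ) + σ))) ∧
      ∫⁻ y, f (levelFun hN ψ μ y - levelFun hN ψ μ x) *
          ENNReal.ofReal (‖x - y‖ ^ (-((N : ℝ) + σ))) ≤
        ENNReal.ofReal C * ∫⁻ t, f t * ENNReal.ofReal (|t| ^ (-(1 + σ))) := by
  have hm := hb.m_pos
  have hM := hb.M_pos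
  obtain ⟨κ, hκ, h⟩ := exists_lintegral_lastCoord hN (r := (N : ℝ) + σ) (by linarith)
    one_pos (ContinuousLinearMap.id ℝ (Euc N)) (by simp)
  have hq : 0 < (N : ℝ) + σ := by positivity
  set q := (N : ℝ) + σ with hqd
  refine ⟨M ^ (-q) * m * κ, m ^ (-q) * M * κ, by positivity, by positivity, fun μ x f hf => ?_⟩
  have e₁ := h f hf
  rw [show q - (N - 1) = 1 + σ by rw [hqd]; ring] at e₁
  simp only [ContinuousLinearMap.id_apply] at e₁
  have hmI : Measurable fun h : Euc N => f (lastCoord hN h) * ENNReal.ofReal (‖h‖ ^ (-q)) :=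
    (hf.comp (measurable_lastCoord hN)).mul (by fun_prop)
  -- The substitution `y = ψ (ψ⁻¹ x + h)` makes the level difference exactly `h_N`.
  have key : ∫⁻ y, f (levelFun hN ψ μ y - levelFun hN ψ μ x) * ENNReal.ofReal (‖x - y‖ ^ (-q)) =
      ∫⁻ h, f (lastCoord hN h) * ENNReal.ofReal (pullKernel ψ q (ψ.symm x) (ψ.symm x + h)) := by
    rw [hb.lintegral_comp, ← lintegral_add_left_eq_self _ (ψ.symm x)]
    refine lintegral_congr fun h => ?_
    rw [levelFun_comp_add, add_sub_cancel_left, mul_left_comm, ← ENNReal.ofReal_mul (abs_nonneg _)]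
    simp [pullKernel, mul_comm]
  rw [key]
  constructor
  · rw [ENNReal.ofReal_mul (by positivity), mul_assoc, ← e₁, ← lintegral_const_mul _ hmI]
    refine lintegral_mono fun h => ?_
    rw [mul_left_comm, ← ENNReal.ofReal_mul (by positivity)]
    gcongr
    simpa using hb.le_pullKernel hq (ψ.symm x) (ψ.symm x + h)
  · rw [ENNReal.ofReal_mul (by positivity), mul_assoc, ← e₁, ← lintegral_const_mul _ hmI]
    refine lintegral_mono fun h => ?_
    rw [mul_left_comm (ENNReal.ofReal _), ← ENNReal.ofReal_mul (by positivity)]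
    gcongr
    simpa using hb.pullKernel_le hq (ψ.symm x) (ψ.symm x + h)

lemma DiffeoBounds.exists_lintegral_pow_le (hb : DiffeoBounds ψ m M K R) (hN : 1 ≤ N)
    (hs0 : 0 < s) (hs1 : s < 1) (hp : 1 < p) (hα0 : 0 < α) (hαs : α < s) :
    ∃ C : ℝ, 0 < C ∧ ∀ (μ : ℝ) (x : Euc N), 0 < levelFun hN ψ μ x →
      ∫⁻ y, ENNReal.ofReal (|posPow α (levelFun hN ψ μ x) - posPow α (levelFun hN ψ μ y)| ^ p *
        ‖x - y‖ ^ (-((N : ℝ) + s * p))) ≤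
        ENNReal.ofReal (C * levelFun hN ψ μ x ^ ((α - s) * p)) := by
  have hpm : Measurable (posPow α) := (continuous_posPow hα0).measurable
  obtain ⟨_, C₁, _, hC₁, h₁⟩ := hb.exists_lintegral_levelFun_bounds hN (σ := s * p) (by nlinarith)
  obtain ⟨C₂, hC₂, h₂⟩ := exists_lintegral_posPow_sub_pow_le hs0 hs1 hp hα0 hαs
  refine ⟨C₁ * C₂, by positivity, fun μ x hx => ?_⟩
  set L := levelFun hN ψ μ x with hL
  have h := (h₁ μ x (fun t => ENNReal.ofReal (|posPow α L - posPow α (L + t)| ^ p))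
    (by fun_prop)).2
  simp only [← hL, add_sub_cancel] at h
  simp only [← ENNReal.ofReal_mul (Real.rpow_nonneg (abs_nonneg _) p)] at h
  refine h.trans ?_
  rw [mul_assoc, ENNReal.ofReal_mul hC₁.le]
  gcongr
  exact h₂ L hx

/-- The constant depends on `r`. It only justifies Fubini at fixed `r` and never enters the final
estimate. -/
lemma DiffeoBounds.exists_lintegral_far_le (hb : DiffeoBounds ψ m M K R) (hN : 1 ≤ N)
    (hs0 : 0 < s) (hs1 : s < 1) (hp : 1 < p) (hα0 : 0 < α) (hαs : α < s) {r : ℝ} (hr0 : 0 < r)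
    (hr1 : r < 1) :
    ∃ C : ℝ, 0 < C ∧ ∀ (μ : ℝ) (x : Euc N), 0 < levelFun hN ψ μ x →
      ∫⁻ y in {y | levelFun hN ψ μ y - levelFun hN ψ μ x ∈ farSet r (levelFun hN ψ μ x)},
        ENNReal.ofReal (|posPow α (levelFun hN ψ μ x) - posPow α (levelFun hN ψ μ y)| ^ (p - 1) *
        ‖x - y‖ ^ (-((N : ℝ) + s * p))) ≤
        ENNReal.ofReal (C * levelFun hN ψ μ x ^ (-betaExp s p α)) := by
  have hpm : Measurable (posPow α) := (continuous_posPow hα0).measurable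
  obtain ⟨_, C₁, _, hC₁, h₁⟩ := hb.exists_lintegral_levelFun_bounds hN (σ := s * p) (by nlinarith)
  obtain ⟨C₂, hC₂, h₂⟩ := exists_lintegral_farSet_le hs0 hs1 hp hα0 hαs hr0 hr1
  refine ⟨C₁ * C₂, by positivity, fun μ x hx => ?_⟩
  set L := levelFun hN ψ μ x with hL
  have hfar := measurableSet_farSet r L
  have h := (h₁ μ x ((farSet r L).indicator fun t =>
    ENNReal.ofReal (|posPow α L - posPow α (L + t)| ^ (p - 1)))
    (Measurable.indicator (by fun_prop) hfar)).2
  have hlm := hb.measurable_levelFun (hN := hN) μ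
  have hset : MeasurableSet {y | levelFun hN ψ μ y - L ∈ farSet r L} :=
    (hlm.sub_const L) hfar
  rw [← lintegral_indicator hset]
  refine le_trans (le_of_eq (lintegral_congr fun y => ?_)) (h.trans ?_)
  · rw [← hL]
    by_cases hy : levelFun hN ψ μ y - L ∈ farSet r L
    · rw [Set.indicator_of_mem (by exact hy), Set.indicator_of_mem hy, ← ENNReal.ofReal_mul
        (by positivity), add_sub_cancel]
    · rw [Set.indicator_of_notMem (by exact hy), Set.indicator_of_notMem hy, zero_mul]
  · rw [mul_assoc, ENNReal.ofReal_mul hC₁.le]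
    gcongr
    refine le_trans (le_of_eq ?_) (h₂ L hx)
    rw [← lintegral_indicator hfar]
    refine lintegral_congr fun t => ?_
    by_cases hy : t ∈ farSet r L
    · rw [Set.indicator_of_mem hy, Set.indicator_of_mem hy, ← ENNReal.ofReal_mul (by positivity)]
    · rw [Set.indicator_of_notMem hy, Set.indicator_of_notMem hy, zero_mul]

/-- The exterior of the transported half-space carries a Hardy weight. -/
lemma DiffeoBounds.exists_le_lintegral_exterior (hb : DiffeoBounds ψ m M K R) (hN : 1 ≤ N)
    {σ : ℝ} (hσ : 0 < σ) : ∃ c : ℝ, 0 < c ∧ ∀ x : Euc N, 0 < levelFun hN ψ 0 x →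
      ENNReal.ofReal (c * levelFun hN ψ 0 x ^ (-σ)) ≤
        ∫⁻ y in {y | levelFun hN ψ 0 y ≤ 0}, ENNReal.ofReal (‖x - y‖ ^ (-((N : ℝ) + σ))) := by
  obtain ⟨c, _, hc, _, h₁⟩ := hb.exists_lintegral_levelFun_bounds hN hσ
  refine ⟨c / σ, by positivity, fun x hx => ?_⟩
  set L := levelFun hN ψ 0 x with hL
  have h := (h₁ 0 x ((Set.Iic (-L)).indicator 1) (measurable_one.indicator measurableSet_Iic)).1
  have hlm := hb.measurable_levelFun (hN := hN) 0
  rw [← lintegral_indicator (measurableSet_le hlm measurable_const)]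
  refine le_trans (le_trans (le_of_eq ?_) h) (le_of_eq (lintegral_congr fun y => ?_))
  · have e1 : ∫⁻ t, (Set.Iic (-L)).indicator 1 t * ENNReal.ofReal (|t| ^ (-(1 + σ))) =
        ∫⁻ t in Set.Iic (-L), ENNReal.ofReal (|t| ^ (-(1 + σ))) := by
      rw [← lintegral_indicator measurableSet_Iic]
      refine lintegral_congr fun t => ?_
      by_cases ht : t ∈ Set.Iic (-L)
      · rw [Set.indicator_of_mem ht, Set.indicator_of_mem ht]; simp
      · rw [Set.indicator_of_notMem ht, Set.indicator_of_notMem ht, zero_mul]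
    have hval : ∫ t in Set.Iic (-L), |t| ^ (-(1 + σ)) = L ^ (-σ) / σ := by
      have h2 := integral_comp_neg_Iic (c := -L) (f := fun t : ℝ => |t| ^ (-(1 + σ)))
      simp only [abs_neg, neg_neg] at h2
      have h3 : ∫ t in Set.Ioi L, |t| ^ (-(1 + σ)) = ∫ t in Set.Ioi L, t ^ (-(1 + σ)) :=
        setIntegral_congr_fun measurableSet_Ioi fun t ht => by
          simp only [abs_of_pos (hx.trans (Set.mem_Ioi.1 ht))]
      rw [h2, h3, integral_Ioi_rpow_of_lt (by linarith) hx,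
        show -(1 + σ) + 1 = -σ by ring, neg_div_neg_eq]
    -- A nonintegrable function would have integral `0` by convention, contradicting `hval`.
    have hint : IntegrableOn (fun t : ℝ => |t| ^ (-(1 + σ))) (Set.Iic (-L)) := by
      by_contra hcon
      rw [integral_undef hcon] at hval
      have : 0 < L ^ (-σ) / σ := by positivity
      linarith
    rw [e1, ← ofReal_integral_eq_lintegral_ofReal hint (.of_forall fun t => by positivity), hval,
      ← ENNReal.ofReal_mul hc.le]
    congr 1
    ring
  · rw [← hL]
    by_cases hy : levelFun hN ψ 0 y ≤ 0
    · rw [Set.indicator_of_mem (by simpa using hy), Set.indicator_of_mem (by exact hy)]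
      simp
    · rw [Set.indicator_of_notMem (by simpa using hy), Set.indicator_of_notMem (by exact hy),
        zero_mul]

/-- Two-sided bounds for the truncated operator applied to the transported barrier. -/
theorem DiffeoBounds.exists_bounds_truncated (hb : DiffeoBounds ψ m M K R) (hN : 1 ≤ N)
    (hs0 : 0 < s) (hs1 : s < 1) (hp : 1 < p) (hα0 : 0 < α) (hαs : α < s) :
    ∃ l c C : ℝ, 0 < l ∧ 0 < c ∧ 0 < C ∧ ∀ (μ : ℝ) (x : Euc N) (r : ℝ), 0 < r → r < 1 →
      0 < levelFun hN ψ μ x → levelFun hN ψ μ x < l →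
      c * levelFun hN ψ μ x ^ (-betaExp s p α) ≤
        ∫ y in {y | levelFun hN ψ μ y - levelFun hN ψ μ x ∈ farSet r (levelFun hN ψ μ x)},
          oddPow p (posPow α (levelFun hN ψ μ x) - posPow α (levelFun hN ψ μ y)) *
            ‖x - y‖ ^ (-((N : ℝ) + s * p)) ∧
      ∫ y in {y | levelFun hN ψ μ y - levelFun hN ψ μ x ∈ farSet r (levelFun hN ψ μ x)},
          oddPow p (posPow α (levelFun hN ψ μ x) - posPow α (levelFun hN ψ μ y)) *
            ‖x - y‖ ^ (-((N : ℝ) + s * p)) ≤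
        C * levelFun hN ψ μ x ^ (-betaExp s p α) := by
  have hpm : Measurable (posPow α) := (continuous_posPow hα0).measurable
  have hom := measurable_oddPow p
  have hm := hb.m_pos
  have hM := hb.M_pos
  have hσ : 0 < s * p := by nlinarith
  have hq : 0 < (N : ℝ) + s * p := by positivity
  obtain ⟨κ₀, κ₁, hκ₀, hκ₁, hκ⟩ := exists_lintegral_lastCoord_bounds hN
    (r := (N : ℝ) + s * p) (by linarith) hm hM
  obtain ⟨c₁, C₁, hc₁, hC₁, h₁⟩ := exists_bounds_integral_farSet hs0 hs1 hp hα0 hαs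
  obtain ⟨B, hB, hBk⟩ := hb.exists_kernel_sub_le hq
  obtain ⟨κ₂, hκ₂, h₂⟩ := exists_lintegral_lastCoord_min_le hN hσ
  -- Chosen so that `B κ₂ η` is half of `m κ₀ c₁`, the lower constant of the frozen operator; the
  -- error then uses up at most half of the main term.
  set η := m * κ₀ * c₁ / 2 / (B * κ₂) with hη
  have hη0 : 0 < η := by positivity
  obtain ⟨l, hl, h₃⟩ := exists_lintegral_posPow_sub_pow_min_le hs0 hs1 hp hα0 hαs hη0
  refine ⟨l, m * κ₀ * c₁ / 2, M * κ₁ * C₁ + m * κ₀ * c₁ / 2, hl, by positivity, by positivity,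
    fun μ x r hr0 hr1 hx hxl => ?_⟩
  set L := levelFun hN ψ μ x with hL
  set X := ψ.symm x with hX
  set q := (N : ℝ) + s * p with hqd
  have hfar := measurableSet_farSet r L
  set F : ℝ → ℝ := (farSet r L).indicator fun t => oddPow p (posPow α L - posPow α (L + t)) with hF
  have hFm : Measurable F := Measurable.indicator (by fun_prop) hfar
  have hFl : Measurable fun h => F (lastCoord hN h) := hFm.comp (measurable_lastCoord hN)
  have hFle : ∀ t, |F t| ≤ |posPow α L - posPow α (L + t)| ^ (p - 1) := fun t => by
    simp only [hF]
    by_cases ht : t ∈ farSet r L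
    · rw [Set.indicator_of_mem ht, abs_oddPow hp]
    · rw [Set.indicator_of_notMem ht, abs_zero]; positivity
  have hlm := hb.measurable_levelFun (hN := hN) μ
  have hset : MeasurableSet {y | levelFun hN ψ μ y - L ∈ farSet r L} :=
    (hlm.sub_const L) hfar
  have key : ∫ y in {y | levelFun hN ψ μ y - L ∈ farSet r L},
      oddPow p (posPow α L - posPow α (levelFun hN ψ μ y)) * ‖x - y‖ ^ (-q) =
      ∫ h, F (lastCoord hN h) * pullKernel ψ q X (X + h) := by
    rw [← integral_indicator hset, hb.integral_comp, ← integral_add_left_eq_self _ X]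
    refine integral_congr_ae (.of_forall fun h => ?_)
    simp only [hF]
    have hlv : levelFun hN ψ μ (ψ (X + h)) = L + lastCoord hN h := levelFun_comp_add hN ψ μ x h
    by_cases ht : lastCoord hN h ∈ farSet r L
    · rw [Set.indicator_of_mem (by simpa [hlv] using ht), Set.indicator_of_mem ht, hlv]
      simp only [pullKernel, hX, Equiv.apply_symm_apply]
      ring
    · rw [Set.indicator_of_notMem (by simpa [hlv] using ht), Set.indicator_of_notMem ht]
      simp
  rw [key]
  obtain ⟨κ, hκl, hκu, hκf⟩ := hκ (fderiv ℝ ψ X) (hb.fderiv_lower X) (hb.fderiv_upper X)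
  rw [show q - (N - 1) = 1 + s * p by rw [hqd]; ring] at hκf
  have hκ0 : 0 < κ := lt_of_lt_of_le hκ₀ hκl
  have hfin : ∫⁻ t, ENNReal.ofReal (|F t|) * ENNReal.ofReal (|t| ^ (-(1 + s * p))) < ⊤ := by
    obtain ⟨C₄, -, h₄⟩ := exists_lintegral_farSet_le hs0 hs1 hp hα0 hαs hr0 hr1
    refine lt_of_le_of_lt ?_ (lt_of_le_of_lt (h₄ L hx) ENNReal.ofReal_lt_top)
    rw [← lintegral_indicator hfar]
    refine lintegral_mono fun t => ?_
    by_cases ht : t ∈ farSet r L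
    · rw [Set.indicator_of_mem ht, ← ENNReal.ofReal_mul (abs_nonneg _)]
      gcongr
      exact hFle t
    · simp only [hF]
      rw [Set.indicator_of_notMem ht, Set.indicator_of_notMem ht]
      simp
  have hfz : Measurable (frozenKernel ψ q X) := by unfold frozenKernel; fun_prop
  have hpk : Measurable fun h => pullKernel ψ q X (X + h) :=
    (hb.measurable_pullKernel q X).comp (measurable_const_add X)
  have hint₀ : Integrable fun h => F (lastCoord hN h) * frozenKernel ψ q X h := by
    refine ⟨(hFl.mul hfz).aestronglyMeasurable, ?_⟩
    rw [hasFiniteIntegral_iff_norm]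
    have e : ∀ h, ENNReal.ofReal ‖F (lastCoord hN h) * frozenKernel ψ q X h‖ =
        ENNReal.ofReal |(fderiv ℝ ψ X).det| * (ENNReal.ofReal |F (lastCoord hN h)| *
          ENNReal.ofReal (‖fderiv ℝ ψ X h‖ ^ (-q))) := fun h => by
      rw [← ENNReal.ofReal_mul (abs_nonneg _), ← ENNReal.ofReal_mul (abs_nonneg _),
        Real.norm_eq_abs, abs_mul, frozenKernel, abs_mul, abs_abs,
        abs_of_nonneg (by positivity : 0 ≤ ‖fderiv ℝ ψ X h‖ ^ (-q))]
      ring_nf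
    simp only [e]
    rw [lintegral_const_mul' _ _ ENNReal.ofReal_ne_top,
      hκf (fun t => ENNReal.ofReal |F t|) (by fun_prop)]
    exact ENNReal.mul_lt_top ENNReal.ofReal_lt_top (ENNReal.mul_lt_top ENNReal.ofReal_lt_top hfin)
  -- `F` is bounded by the untruncated profile, so this bound, unlike `hfin`, does not depend on
  -- `r`.
  have hdiff : ∫⁻ h, ENNReal.ofReal ‖F (lastCoord hN h) *
      (pullKernel ψ q X (X + h) - frozenKernel ψ q X h)‖ ≤
      ENNReal.ofReal (m * κ₀ * c₁ / 2 * L ^ (-betaExp s p α)) := by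
    have e : ∀ h, ENNReal.ofReal ‖F (lastCoord hN h) *
        (pullKernel ψ q X (X + h) - frozenKernel ψ q X h)‖ ≤ ENNReal.ofReal B *
        (ENNReal.ofReal (|posPow α L - posPow α (L + lastCoord hN h)| ^ (p - 1)) *
          ENNReal.ofReal (min 1 ‖h‖ * ‖h‖ ^ (-q))) := fun h => by
      rw [← ENNReal.ofReal_mul (by positivity), ← ENNReal.ofReal_mul hB.le, Real.norm_eq_abs,
        abs_mul, mul_left_comm]
      gcongr
      · exact hFle _
      · exact hBk X h
    refine (lintegral_mono e).trans ?_
    rw [lintegral_const_mul' _ _ ENNReal.ofReal_ne_top]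
    refine (mul_le_mul_right (h₂ (fun t =>
      ENNReal.ofReal (|posPow α L - posPow α (L + t)| ^ (p - 1))) (by fun_prop)) _).trans ?_
    have e2 : ∀ t, ENNReal.ofReal (|posPow α L - posPow α (L + t)| ^ (p - 1)) *
        ENNReal.ofReal (min 1 |t| * |t| ^ (-(1 + s * p))) = ENNReal.ofReal
        (|posPow α L - posPow α (L + t)| ^ (p - 1) * |t| ^ (-(1 + s * p)) * min 1 |t|) := fun t => by
      rw [← ENNReal.ofReal_mul (by positivity)]
      ring_nf
    simp only [e2]
    refine (mul_le_mul_right (mul_le_mul_right (h₃ L hx hxl) _) _).trans ?_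
    rw [← ENNReal.ofReal_mul hκ₂.le, ← ENNReal.ofReal_mul hB.le]
    refine ENNReal.ofReal_le_ofReal (le_of_eq ?_)
    rw [hη]
    field_simp
  have hint₁ : Integrable fun h => F (lastCoord hN h) *
      (pullKernel ψ q X (X + h) - frozenKernel ψ q X h) := by
    refine ⟨(hFl.mul (hpk.sub hfz)).aestronglyMeasurable, ?_⟩
    rw [hasFiniteIntegral_iff_norm]
    exact lt_of_le_of_lt hdiff ENNReal.ofReal_lt_top
  have hsplit : ∫ h, F (lastCoord hN h) * pullKernel ψ q X (X + h) =
      (∫ h, F (lastCoord hN h) * frozenKernel ψ q X h) +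
      ∫ h, F (lastCoord hN h) * (pullKernel ψ q X (X + h) - frozenKernel ψ q X h) := by
    rw [← integral_add hint₀ hint₁]
    refine integral_congr_ae (.of_forall fun h => ?_)
    simp only
    ring
  have herr : |∫ h, F (lastCoord hN h) * (pullKernel ψ q X (X + h) - frozenKernel ψ q X h)| ≤
      m * κ₀ * c₁ / 2 * L ^ (-betaExp s p α) := by
    rw [← Real.norm_eq_abs]
    refine (norm_integral_le_lintegral_norm _).trans ?_
    exact ENNReal.toReal_le_of_le_ofReal (by positivity) hdiff
  have hmain : ∫ h, F (lastCoord hN h) * frozenKernel ψ q X h =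
      |(fderiv ℝ ψ X).det| * (κ * ∫ t in farSet r L,
        oddPow p (posPow α L - posPow α (L + t)) * |t| ^ (-(1 + s * p))) := by
    rw [← integral_indicator hfar]
    have e := integral_lastCoord_of_lintegral hN hκ0.le _ hκf F hFm
    have e3 : ∀ t, F t * |t| ^ (-(1 + s * p)) = (farSet r L).indicator (fun t =>
        oddPow p (posPow α L - posPow α (L + t)) * |t| ^ (-(1 + s * p))) t := fun t => by
      simp only [hF]
      by_cases ht : t ∈ farSet r L
      · rw [Set.indicator_of_mem ht, Set.indicator_of_mem ht]
      · rw [Set.indicator_of_notMem ht, Set.indicator_of_notMem ht, zero_mul]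
    simp only [e3] at e
    rw [← e, ← integral_const_mul]
    refine integral_congr_ae (.of_forall fun h => ?_)
    simp only [frozenKernel]
    ring
  obtain ⟨hl₁, hu₁⟩ := h₁ r hr0 hr1 L hx
  rw [hsplit, hmain]
  set I := ∫ t in farSet r L, oddPow p (posPow α L - posPow α (L + t)) * |t| ^ (-(1 + s * p))
  have hP : 0 < L ^ (-betaExp s p α) := by positivity
  have hdl := hb.det_lower X
  have hdu := hb.det_upper X
  have hI0 : 0 ≤ I := le_trans (by positivity) hl₁
  have hlow : m * (κ₀ * (c₁ * L ^ (-betaExp s p α))) ≤ |(fderiv ℝ ψ X).det| * (κ * I) := by gcongr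
  have hupp : |(fderiv ℝ ψ X).det| * (κ * I) ≤ M * (κ₁ * (C₁ * L ^ (-betaExp s p α))) := by gcongr
  rw [abs_le] at herr
  constructor
  · nlinarith [herr.1]
  · nlinarith [herr.2]

end

/-! ### Local integrability of level powers and membership of the barrier -/

/-- The power `e` of the positive part of the level function is integrable near the closure
of `Ω`. -/
def LevelAdmissible {N : ℕ} (hN : 1 ≤ N) (ψ : Euc N ≃ Euc N) (μ e : ℝ) (Ω : Set (Euc N)) : Prop :=
  ∃ K : Set (Euc N), IsOpen K ∧ Bornology.IsBounded K ∧ closure Ω ⊆ K ∧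
    ∫⁻ y in K ∩ {y | 0 < levelFun hN ψ μ y}, ENNReal.ofReal (levelFun hN ψ μ y ^ e) < ⊤

section

variable {N : ℕ} {hN : 1 ≤ N} {s p α μ : ℝ} {ψ : Euc N ≃ Euc N} {m M K R : ℝ}

lemma continuous_lastCoord (hN : 1 ≤ N) : Continuous (lastCoord hN) := by
  unfold lastCoord; fun_prop

lemma DiffeoBounds.continuous_levelFun (hb : DiffeoBounds ψ m M K R) (μ : ℝ) :
    Continuous (levelFun hN ψ μ) := by
  unfold levelFun
  exact ((continuous_lastCoord hN).comp hb.continuous_symm).add continuous_const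

lemma levelAdmissible_of_le (hb : DiffeoBounds ψ m M K R) {Ω : Set (Euc N)}
    (hΩ : Bornology.IsBounded Ω) {δ e : ℝ} (hδ : 0 < δ) (he : e ≤ 0)
    (h : ∀ x ∈ closure Ω, δ ≤ levelFun hN ψ μ x) : LevelAdmissible hN ψ μ e Ω := by
  obtain ⟨B, hB⟩ := hΩ.closure.subset_ball 0
  have hc := hb.continuous_levelFun (hN := hN) μ
  refine ⟨Metric.ball 0 B ∩ {x | δ / 2 < levelFun hN ψ μ x},
    Metric.isOpen_ball.inter (isOpen_lt continuous_const hc),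
    Metric.isBounded_ball.subset Set.inter_subset_left, fun x hx => ⟨hB hx, ?_⟩, ?_⟩
  · have := h x hx
    simp only [Set.mem_ofPred_eq]
    linarith
  · set S := Metric.ball 0 B ∩ {x | δ / 2 < levelFun hN ψ μ x} ∩ {y | 0 < levelFun hN ψ μ y}
    have hS : volume S < ⊤ := lt_of_le_of_lt (measure_mono (fun x hx => hx.1.1))
      (measure_ball_lt_top (x := (0 : Euc N)) (r := B))
    have hle : ∫⁻ y in S, ENNReal.ofReal (levelFun hN ψ μ y ^ e) ≤
        ∫⁻ y in S, ENNReal.ofReal ((δ / 2) ^ e) := by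
      refine setLIntegral_mono measurable_const fun y hy => ENNReal.ofReal_le_ofReal ?_
      exact Real.rpow_le_rpow_of_nonpos (by positivity) (le_of_lt hy.1.2) he
    refine lt_of_le_of_lt hle ?_
    rw [setLIntegral_const]
    exact ENNReal.mul_lt_top ENNReal.ofReal_lt_top hS

/-- On a ball of radius `D` the factor `D^r ‖Y‖^{-r}` is at least `1` and can be inserted, which
makes the hyperplane formula available. With `r = N - 1 + θ` this costs `t^{-θ}`, and `θ = (e +
1)/2` keeps the exponent `e - θ` above `-1`. -/
lemma levelAdmissible_zero (hb : DiffeoBounds ψ m M K R) {Ω : Set (Euc N)}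
    (hΩ : Bornology.IsBounded Ω) {e : ℝ} (he : -1 < e) : LevelAdmissible hN ψ 0 e Ω := by
  obtain ⟨B₀, hB₀⟩ := hΩ.closure.subset_ball 0
  set B := max B₀ 1 with hBd
  have hB1 : 1 ≤ B := le_max_right _ _
  have hM := hb.M_pos
  have hc := hb.continuous_levelFun (hN := hN) 0
  refine ⟨Metric.ball 0 B, Metric.isOpen_ball, Metric.isBounded_ball,
    hB₀.trans (Metric.ball_subset_ball (le_max_left _ _)), ?_⟩
  set D := B + |R| with hD
  have hD0 : 0 < D := by positivity
  set θ := (e + 1) / 2 with hθ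
  have hθ0 : 0 < θ := by rw [hθ]; linarith
  set r := (N : ℝ) - 1 + θ with hr
  have hr0 : 0 ≤ r := by
    have : (1 : ℝ) ≤ N := by exact_mod_cast hN
    linarith
  obtain ⟨κ, hκ, h⟩ := exists_lintegral_lastCoord hN (r := r) (by linarith)
    one_pos (ContinuousLinearMap.id ℝ (Euc N)) (by simp)
  set f : ℝ → ENNReal := (Set.Ioc 0 D).indicator fun t => ENNReal.ofReal (t ^ e) with hf
  have hfm : Measurable f := Measurable.indicator (by fun_prop) measurableSet_Ioc
  have hset : MeasurableSet (Metric.ball 0 B ∩ {y | 0 < levelFun hN ψ 0 y}) :=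
    (Metric.isOpen_ball.inter (isOpen_lt continuous_const hc)).measurableSet
  rw [← lintegral_indicator hset, hb.lintegral_comp]
  have hle : ∀ Y, ENNReal.ofReal |(fderiv ℝ ψ Y).det| *
      (Metric.ball 0 B ∩ {y | 0 < levelFun hN ψ 0 y}).indicator
        (fun y => ENNReal.ofReal (levelFun hN ψ 0 y ^ e)) (ψ Y) ≤
      ENNReal.ofReal (M * D ^ r) * (f (lastCoord hN Y) * ENNReal.ofReal (‖Y‖ ^ (-r))) := by
    intro Y
    by_cases hY : ψ Y ∈ Metric.ball 0 B ∩ {y | 0 < levelFun hN ψ 0 y}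
    · rw [Set.indicator_of_mem hY]
      have hlv : levelFun hN ψ 0 (ψ Y) = lastCoord hN Y := by simp [levelFun]
      have hYB : ‖Y‖ ≤ D := by
        have h1 := hb.symm_norm_le (ψ Y)
        rw [Equiv.symm_apply_apply] at h1
        have h2 : ‖ψ Y‖ < B := by simpa using hY.1
        have := le_abs_self R
        linarith
      have hpos : 0 < lastCoord hN Y := by simpa [hlv] using hY.2
      have hYle := abs_lastCoord_le hN Y
      rw [abs_of_pos hpos] at hYle
      have hYn : 0 < ‖Y‖ := lt_of_lt_of_le hpos hYle
      have hmem : lastCoord hN Y ∈ Set.Ioc 0 D := ⟨hpos, hYle.trans hYB⟩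
      rw [hlv]
      simp only [hf]
      rw [Set.indicator_of_mem hmem, ← ENNReal.ofReal_mul (abs_nonneg _),
        ← ENNReal.ofReal_mul (by positivity), ← ENNReal.ofReal_mul (by positivity)]
      refine ENNReal.ofReal_le_ofReal ?_
      have h3 : 1 ≤ D ^ r * ‖Y‖ ^ (-r) := by
        rw [Real.rpow_neg hYn.le, ← div_eq_mul_inv, one_le_div (by positivity)]
        gcongr
      calc _ ≤ M * lastCoord hN Y ^ e := by gcongr; exact hb.det_upper Y
        _ ≤ M * lastCoord hN Y ^ e * (D ^ r * ‖Y‖ ^ (-r)) :=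
          le_mul_of_one_le_right (by positivity) h3
        _ = _ := by ring
    · rw [Set.indicator_of_notMem hY, mul_zero]; exact zero_le
  refine lt_of_le_of_lt (lintegral_mono hle) ?_
  have e₁ := h f hfm
  simp only [ContinuousLinearMap.id_apply] at e₁
  rw [lintegral_const_mul' _ _ ENNReal.ofReal_ne_top, e₁]
  refine ENNReal.mul_lt_top ENNReal.ofReal_lt_top (ENNReal.mul_lt_top ENNReal.ofReal_lt_top ?_)
  have hint : IntegrableOn (fun t : ℝ => t ^ (e - θ)) (Set.Ioc 0 D) :=
    (intervalIntegral.intervalIntegrable_rpow' (a := 0) (b := D) (by rw [hθ]; linarith)).1.mono_set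
      (by rfl)
  refine lt_of_le_of_lt (le_of_eq ?_) hint.lintegral_lt_top
  rw [← lintegral_indicator measurableSet_Ioc]
  refine lintegral_congr fun t => ?_
  simp only [hf]
  by_cases ht : t ∈ Set.Ioc 0 D
  · rw [Set.indicator_of_mem ht, Set.indicator_of_mem ht, ← ENNReal.ofReal_mul
      (Real.rpow_nonneg ht.1.le _), abs_of_pos ht.1, ← Real.rpow_add ht.1]
    congr 2
    rw [hr]; ring
  · rw [Set.indicator_of_notMem ht, Set.indicator_of_notMem ht, zero_mul]

/-- The Gagliardo density of the transported barrier. -/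
def gagliardo (hN : 1 ≤ N) (s p α μ : ℝ) (ψ : Euc N ≃ Euc N) (z : Euc N × Euc N) : ℝ :=
  |posPow α (levelFun hN ψ μ z.1) - posPow α (levelFun hN ψ μ z.2)| ^ p *
    ‖z.1 - z.2‖ ^ (-((N : ℝ) + s * p))

lemma gagliardo_nonneg (z : Euc N × Euc N) : 0 ≤ gagliardo hN s p α μ ψ z := by
  unfold gagliardo; positivity

lemma gagliardo_swap (z : Euc N × Euc N) :
    gagliardo hN s p α μ ψ z.swap = gagliardo hN s p α μ ψ z := by
  simp only [gagliardo, Prod.fst_swap, Prod.snd_swap]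
  rw [abs_sub_comm, norm_sub_rev]

lemma DiffeoBounds.continuous_barrier (hb : DiffeoBounds ψ m M K R) (hα0 : 0 < α) (μ : ℝ) :
    Continuous fun x => posPow α (levelFun hN ψ μ x) :=
  (continuous_posPow hα0).comp (hb.continuous_levelFun μ)

lemma DiffeoBounds.measurable_gagliardo (hb : DiffeoBounds ψ m M K R) (hα0 : 0 < α) :
    Measurable (gagliardo hN s p α μ ψ) := by
  have h := (hb.continuous_barrier (hN := hN) hα0 μ).measurable
  have h1 : Measurable fun z : Euc N × Euc N => posPow α (levelFun hN ψ μ z.1) :=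
    h.comp measurable_fst
  have h2 : Measurable fun z : Euc N × Euc N => posPow α (levelFun hN ψ μ z.2) :=
    h.comp measurable_snd
  unfold gagliardo
  fun_prop

lemma DiffeoBounds.integrableOn_gagliardo (hb : DiffeoBounds ψ m M K R)
    (hs0 : 0 < s) (hs1 : s < 1) (hp : 1 < p) (hα0 : 0 < α) (hαs : α < s) {S : Set (Euc N)}
    (hpos : ∀ x ∈ S, 0 < levelFun hN ψ μ x)
    (hfin : ∫⁻ y in S, ENNReal.ofReal (levelFun hN ψ μ y ^ ((α - s) * p)) < ⊤) :
    IntegrableOn (gagliardo hN s p α μ ψ) (S ×ˢ Set.univ) ∧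
    IntegrableOn (gagliardo hN s p α μ ψ) (Set.univ ×ˢ S) := by
  obtain ⟨C, hC, h⟩ := hb.exists_lintegral_pow_le hN hs0 hs1 hp hα0 hαs
  have hm := hb.measurable_gagliardo (hN := hN) (s := s) (p := p) (μ := μ) hα0
  have h1 : IntegrableOn (gagliardo hN s p α μ ψ) (S ×ˢ Set.univ) := by
    refine ⟨hm.aestronglyMeasurable, ?_⟩
    rw [hasFiniteIntegral_iff_norm]
    simp only [Real.norm_eq_abs, abs_of_nonneg (gagliardo_nonneg _)]
    rw [Measure.volume_eq_prod, setLIntegral_prod _ (by fun_prop)]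
    have hle : ∫⁻ x in S, ∫⁻ y in Set.univ, ENNReal.ofReal (gagliardo hN s p α μ ψ (x, y)) ≤
        ∫⁻ x in S, ENNReal.ofReal C * ENNReal.ofReal (levelFun hN ψ μ x ^ ((α - s) * p)) := by
      have hlm := hb.measurable_levelFun (hN := hN) μ
      refine setLIntegral_mono (by fun_prop) fun x hx => ?_
      rw [← ENNReal.ofReal_mul hC.le, Measure.restrict_univ]
      exact h μ x (hpos x hx)
    refine lt_of_le_of_lt hle ?_
    rw [lintegral_const_mul' _ _ ENNReal.ofReal_ne_top]
    exact ENNReal.mul_lt_top ENNReal.ofReal_lt_top hfin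
  refine ⟨h1, ?_⟩
  have h2 := (Measure.measurePreserving_swap (μ := (volume : Measure (Euc N)))
    (ν := (volume : Measure (Euc N)))).integrableOn_comp_preimage
      (MeasurableEquiv.prodComm (α := Euc N) (β := Euc N)).measurableEmbedding
      (f := gagliardo hN s p α μ ψ) (s := S ×ˢ Set.univ)
  have h3 := h2.2 h1
  rw [Set.preimage_swap_prod] at h3
  refine h3.congr (.of_forall fun z => ?_)
  exact gagliardo_swap z

lemma barrier_le_rpow (hb : DiffeoBounds ψ m M K R) (hα0 : 0 < α) (x : Euc N) :
    posPow α (levelFun hN ψ μ x) ≤ (1 + |R| + |μ|) ^ α * (1 + ‖x‖) ^ α := by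
  rw [← Real.mul_rpow (by positivity) (by positivity)]
  unfold posPow
  refine Real.rpow_le_rpow (le_max_right _ _) (max_le ?_ (by positivity)) hα0.le
  have h1 := abs_lastCoord_le hN (ψ.symm x)
  have h2 := hb.symm_norm_le x
  have h3 := le_abs_self (lastCoord hN (ψ.symm x))
  have h4 := le_abs_self R
  have h5 := le_abs_self μ
  unfold levelFun
  nlinarith [norm_nonneg x, abs_nonneg R, abs_nonneg μ, mul_nonneg (abs_nonneg R) (norm_nonneg x),
    mul_nonneg (abs_nonneg μ) (norm_nonneg x)]

/-- The barrier grows at most like `(1 + |x|)^α`, so the tail integrand decays with exponent `N + sp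
- α(p-1) = N + β`. The seminorm is controlled by integrating the one-point bound `L^{(α-s)p}`. -/
theorem DiffeoBounds.memWspBar_barrier (hb : DiffeoBounds ψ m M K R)
    (hs0 : 0 < s) (hs1 : s < 1) (hp : 1 < p) (hα0 : 0 < α) (hαs : α < s) {Ω : Set (Euc N)}
    (hadm : LevelAdmissible hN ψ μ ((α - s) * p) Ω) :
    MemWspBar s p Ω fun x => posPow α (levelFun hN ψ μ x) := by
  have hWc := hb.continuous_barrier (hN := hN) hα0 μ
  have hbd : ∀ S : Set (Euc N), Bornology.IsBounded S →
      MemLp (fun x => posPow α (levelFun hN ψ μ x)) (ENNReal.ofReal p) (volume.restrict S) := by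
    intro S hS
    obtain ⟨B, hB⟩ := hS.subset_closedBall 0
    obtain ⟨C, hC⟩ := (isCompact_closedBall (0 : Euc N) B).exists_bound_of_continuousOn
      hWc.continuousOn
    have : IsFiniteMeasure (volume.restrict (Metric.closedBall (0 : Euc N) B)) :=
      ⟨by simpa using measure_closedBall_lt_top⟩
    have h1 : MemLp (fun x => posPow α (levelFun hN ψ μ x)) (ENNReal.ofReal p)
        (volume.restrict (Metric.closedBall (0 : Euc N) B)) := by
      refine MemLp.of_bound hWc.aestronglyMeasurable C ?_
      filter_upwards [ae_restrict_mem Metric.isClosed_closedBall.measurableSet] with x hx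
      exact hC x hx
    exact h1.mono_measure (Measure.restrict_mono hB le_rfl)
  refine ⟨fun S hS => hbd S hS.isBounded, ?_, ?_⟩
  · obtain ⟨U, hUo, hUb, hUc, hfin⟩ := hadm
    refine ⟨U, hUo, hUc, hbd U hUb, ?_⟩
    set S := U ∩ {y | 0 < levelFun hN ψ μ y} with hSd
    have hlc := hb.continuous_levelFun (hN := hN) μ
    obtain ⟨h1, h2⟩ := hb.integrableOn_gagliardo hs0 hs1 hp hα0 hαs (fun x hx => hx.2) hfin
    -- The neighbourhood may reach below level zero; pairs with both points there contribute
    -- nothing.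
    set Z : Set (Euc N × Euc N) := {z | levelFun hN ψ μ z.1 ≤ 0 ∧ levelFun hN ψ μ z.2 ≤ 0} with hZ
    have hZm : MeasurableSet Z :=
      (measurableSet_le (hlc.measurable.comp measurable_fst) measurable_const).inter
        (measurableSet_le (hlc.measurable.comp measurable_snd) measurable_const)
    have h3 : IntegrableOn (gagliardo hN s p α μ ψ) Z := by
      refine integrableOn_zero.congr_fun (fun z hz => ?_) hZm
      simp [gagliardo, posPow_of_nonpos hα0 hz.1, posPow_of_nonpos hα0 hz.2,
        Real.zero_rpow (by linarith : p ≠ 0)]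
    have h4 : IntegrableOn (gagliardo hN s p α μ ψ) (U ×ˢ U) := by
      refine ((h1.union h2).union h3).mono_set fun z hz => ?_
      by_cases hz1 : 0 < levelFun hN ψ μ z.1
      · exact Or.inl (Or.inl ⟨⟨hz.1, hz1⟩, trivial⟩)
      by_cases hz2 : 0 < levelFun hN ψ μ z.2
      · exact Or.inl (Or.inr ⟨trivial, ⟨hz.2, hz2⟩⟩)
      exact Or.inr ⟨not_lt.1 hz1, not_lt.1 hz2⟩
    refine h4.congr (.of_forall fun z => ?_)
    simp only [gagliardo]
    rw [Real.rpow_neg (norm_nonneg _), div_eq_mul_inv]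
  · have hσ : 0 < s * p := by nlinarith
    have hβ := lt_betaExp hp hαs
    have hint : Integrable fun x : Euc N =>
        ((1 + |R| + |μ|) ^ α) ^ (p - 1) * (1 + ‖x‖) ^ (-((N : ℝ) + betaExp s p α)) := by
      refine (integrable_one_add_norm ?_).const_mul _
      simp; linarith
    refine hint.mono' (Continuous.aestronglyMeasurable ?_) (.of_forall fun x => ?_)
    · refine Continuous.div (hWc.abs.rpow_const fun _ => Or.inr (by linarith))
        ((by fun_prop : Continuous fun x : Euc N => 1 + ‖x‖).rpow_const
          fun x => Or.inl (by positivity)) fun x => by positivity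
    · have hx : 0 < 1 + ‖x‖ := by positivity
      have hW0 := posPow_nonneg α (levelFun hN ψ μ x)
      rw [Real.norm_eq_abs, abs_of_nonneg (by positivity), abs_of_nonneg hW0, div_eq_mul_inv,
        ← Real.rpow_neg hx.le]
      calc _ ≤ ((1 + |R| + |μ|) ^ α * (1 + ‖x‖) ^ α) ^ (p - 1) *
            (1 + ‖x‖) ^ (-((N : ℝ) + s * p)) := by
            refine mul_le_mul_of_nonneg_right (Real.rpow_le_rpow hW0 ?_ (by linarith))
              (by positivity)
            exact barrier_le_rpow hb hα0 x
        _ = _ := by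
            rw [Real.mul_rpow (by positivity) (by positivity), ← Real.rpow_mul hx.le α, mul_assoc,
              ← Real.rpow_add hx]
            congr 2
            unfold betaExp; ring

end

/-! ### The weak form: integrability, symmetrization and the limit -/

lemma rpow_mul_le_add_rpow {p a b : ℝ} (hp : 1 < p) (ha : 0 ≤ a) (hb : 0 ≤ b) :
    a ^ (p - 1) * b ≤ a ^ p + b ^ p := by
  have hsplit : ∀ c : ℝ, 0 ≤ c → c ^ (p - 1) * c = c ^ p := fun c hc => by
    rcases eq_or_lt_of_le hc with rfl | h
    · rw [Real.zero_rpow (by linarith), Real.zero_rpow (by linarith), zero_mul]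
    · rw [← Real.rpow_add_one h.ne']; ring_nf
  have hap : 0 ≤ a ^ p := Real.rpow_nonneg ha p
  have hbp : 0 ≤ b ^ p := Real.rpow_nonneg hb p
  rcases le_total a b with h | h
  · have : a ^ (p - 1) * b ≤ b ^ (p - 1) * b :=
      mul_le_mul_of_nonneg_right (Real.rpow_le_rpow ha h (by linarith)) hb
    rw [hsplit b hb] at this
    linarith
  · have : a ^ (p - 1) * b ≤ a ^ (p - 1) * a := by gcongr
    rw [hsplit a ha] at this
    linarith

/-- Pairs of points whose levels are not within a ratio `r` of each other. -/
def farPairs {N : ℕ} (hN : 1 ≤ N) (ψ : Euc N ≃ Euc N) (μ r : ℝ) : Set (Euc N × Euc N) :=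
  {z | levelFun hN ψ μ z.2 ≤ r * levelFun hN ψ μ z.1 ∨
    levelFun hN ψ μ z.1 ≤ r * levelFun hN ψ μ z.2}

/-- The antisymmetric kernel of the weak form of the operator at the transported barrier. -/
def barrierKernel {N : ℕ} (hN : 1 ≤ N) (s p α μ : ℝ) (ψ : Euc N ≃ Euc N) (z : Euc N × Euc N) : ℝ :=
  oddPow p (posPow α (levelFun hN ψ μ z.1) - posPow α (levelFun hN ψ μ z.2)) *
    ‖z.1 - z.2‖ ^ (-((N : ℝ) + s * p))

section

variable {N : ℕ} {hN : 1 ≤ N} {s p α μ : ℝ} {ψ : Euc N ≃ Euc N} {m M K R : ℝ}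

lemma energyIntegrand_eq (φ : Euc N → ℝ) (z : Euc N × Euc N) :
    energyIntegrand s p (fun x => posPow α (levelFun hN ψ μ x)) φ z =
      barrierKernel hN s p α μ ψ z * (φ z.1 - φ z.2) := by
  simp only [energyIntegrand, barrierKernel]
  rw [Real.rpow_neg (norm_nonneg _)]
  ring

lemma barrierKernel_swap (z : Euc N × Euc N) :
    barrierKernel hN s p α μ ψ z.swap = -barrierKernel hN s p α μ ψ z := by
  simp only [barrierKernel, Prod.fst_swap, Prod.snd_swap]
  rw [norm_sub_rev, ← neg_sub, oddPow_neg, neg_mul]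

lemma swap_mem_farPairs {r : ℝ} (z : Euc N × Euc N) :
    z.swap ∈ farPairs hN ψ μ r ↔ z ∈ farPairs hN ψ μ r := or_comm

lemma mk_mem_farPairs {r : ℝ} (x y : Euc N) : (x, y) ∈ farPairs hN ψ μ r ↔
    levelFun hN ψ μ y - levelFun hN ψ μ x ∈ farSet r (levelFun hN ψ μ x) := by
  simp [farPairs, farSet]

lemma DiffeoBounds.measurableSet_farPairs (hb : DiffeoBounds ψ m M K R) (r : ℝ) :
    MeasurableSet (farPairs hN ψ μ r) := by
  have h := hb.measurable_levelFun (hN := hN) μ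
  have h1 : Measurable fun z : Euc N × Euc N => levelFun hN ψ μ z.1 := h.comp measurable_fst
  have h2 : Measurable fun z : Euc N × Euc N => levelFun hN ψ μ z.2 := h.comp measurable_snd
  exact (measurableSet_le h2 (h1.const_mul r)).union (measurableSet_le h1 (h2.const_mul r))

lemma DiffeoBounds.measurable_barrierKernel (hb : DiffeoBounds ψ m M K R) (hα0 : 0 < α) :
    Measurable (barrierKernel hN s p α μ ψ) := by
  have h := (hb.continuous_barrier (hN := hN) hα0 μ).measurable
  have h1 : Measurable fun z : Euc N × Euc N => posPow α (levelFun hN ψ μ z.1) :=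
    h.comp measurable_fst
  have h2 : Measurable fun z : Euc N × Euc N => posPow α (levelFun hN ψ μ z.2) :=
    h.comp measurable_snd
  have := measurable_oddPow p
  unfold barrierKernel
  fun_prop

lemma MemWspZero.aestronglyMeasurable {Ω : Set (Euc N)} {φ : Euc N → ℝ}
    (hφ : MemWspZero s p Ω φ) : AEStronglyMeasurable φ := by
  simpa using hφ.1.1.aestronglyMeasurable

lemma MemWspZero.integrable {Ω : Set (Euc N)} {φ : Euc N → ℝ}
    (hφ : MemWspZero s p Ω φ) : Integrable fun z : Euc N × Euc N =>
      |φ z.1 - φ z.2| ^ p * ‖z.1 - z.2‖ ^ (-((N : ℝ) + s * p)) := by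
  have := hφ.1.2
  rw [Set.univ_prod_univ, integrableOn_univ] at this
  refine this.congr (.of_forall fun z => ?_)
  simp only
  rw [Real.rpow_neg (norm_nonneg _), div_eq_mul_inv]

/-- Young's inequality dominates the integrand by the two Gagliardo densities. The barrier's density
is integrable only over pairs with a point in `Ω`, which suffices because `φ x - φ y` vanishes at
almost all other pairs. -/
theorem DiffeoBounds.integrable_energy (hb : DiffeoBounds ψ m M K R)
    (hs0 : 0 < s) (hs1 : s < 1) (hp : 1 < p) (hα0 : 0 < α) (hαs : α < s) {Ω : Set (Euc N)}
    (hΩ : MeasurableSet Ω) (hpos : ∀ x ∈ Ω, 0 < levelFun hN ψ μ x)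
    (hfin : ∫⁻ y in Ω, ENNReal.ofReal (levelFun hN ψ μ y ^ ((α - s) * p)) < ⊤)
    {φ : Euc N → ℝ} (hφ : MemWspZero s p Ω φ) :
    Integrable (energyIntegrand s p (fun x => posPow α (levelFun hN ψ μ x)) φ) := by
  obtain ⟨h1, h2⟩ := hb.integrableOn_gagliardo hs0 hs1 hp hα0 hαs hpos hfin
  have hS : MeasurableSet (Ω ×ˢ Set.univ ∪ Set.univ ×ˢ Ω : Set (Euc N × Euc N)) :=
    (hΩ.prod MeasurableSet.univ).union (MeasurableSet.univ.prod hΩ)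
  have h3 := (h1.union h2).integrable_indicator hS
  have hφm := hφ.aestronglyMeasurable
  have hz1 : ∀ᵐ z : Euc N × Euc N, z.1 ∉ Ω → φ z.1 = 0 :=
    Measure.quasiMeasurePreserving_fst.ae hφ.2
  have hz2 : ∀ᵐ z : Euc N × Euc N, z.2 ∉ Ω → φ z.2 = 0 :=
    Measure.quasiMeasurePreserving_snd.ae hφ.2
  have hm := (hb.measurable_barrierKernel (hN := hN) (s := s) (p := p) (μ := μ) hα0)
  have hE : (energyIntegrand s p (fun x => posPow α (levelFun hN ψ μ x)) φ) = fun z =>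
      barrierKernel hN s p α μ ψ z * (φ z.1 - φ z.2) := funext (energyIntegrand_eq φ)
  rw [hE]
  refine (h3.add hφ.integrable).mono'
    (hm.aestronglyMeasurable.mul (hφm.comp_fst.sub hφm.comp_snd)) ?_
  filter_upwards [hz1, hz2] with z h4 h5
  by_cases hz : z ∈ (Ω ×ˢ Set.univ ∪ Set.univ ×ˢ Ω : Set (Euc N × Euc N))
  · simp only [Pi.add_apply]
    rw [Set.indicator_of_mem hz]
    simp only [gagliardo, barrierKernel]
    rw [← add_mul, Real.norm_eq_abs, abs_mul, abs_mul, abs_oddPow hp,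
      abs_of_nonneg (by positivity : 0 ≤ ‖z.1 - z.2‖ ^ (-((N : ℝ) + s * p))), mul_right_comm]
    gcongr
    exact rpow_mul_le_add_rpow hp (abs_nonneg _) (abs_nonneg _)
  · have hz1 : z.1 ∉ Ω := fun h => hz (Or.inl ⟨h, trivial⟩)
    have hz2 : z.2 ∉ Ω := fun h => hz (Or.inr ⟨trivial, h⟩)
    rw [h4 hz1, h5 hz2]
    simp only [sub_self, mul_zero, norm_zero, Pi.add_apply]
    rw [Set.indicator_of_notMem hz]
    positivity

/-- Hardy's inequality for functions vanishing outside a subset of the transported half-space. -/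
lemma DiffeoBounds.lintegral_hardy_lt_top (hb : DiffeoBounds ψ m M K R) (hN : 1 ≤ N)
    (hs0 : 0 < s) (hp : 1 < p) {Ω : Set (Euc N)}
    (hpos : ∀ x ∈ Ω, 0 < levelFun hN ψ 0 x) {φ : Euc N → ℝ} (hφ : MemWspZero s p Ω φ) :
    ∫⁻ x in Ω, ENNReal.ofReal (|φ x| ^ p * levelFun hN ψ 0 x ^ (-(s * p))) < ⊤ := by
  have hσ : 0 < s * p := by nlinarith
  obtain ⟨c, hc, h⟩ := hb.exists_le_lintegral_exterior hN hσ
  have hi := hφ.integrable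
  have hφm := hφ.aestronglyMeasurable.aemeasurable
  have hlm := hb.measurable_levelFun (hN := hN) 0
  have hZ : MeasurableSet {y | levelFun hN ψ 0 y ≤ 0} := measurableSet_le hlm measurable_const
  have hfin := hi.lintegral_lt_top
  rw [Measure.volume_eq_prod, lintegral_prod _ (by
    exact hi.aestronglyMeasurable.aemeasurable.ennreal_ofReal)] at hfin
  have hle : ∫⁻ x in Ω, ENNReal.ofReal c *
      ENNReal.ofReal (|φ x| ^ p * levelFun hN ψ 0 x ^ (-(s * p))) ≤
      ∫⁻ x, ∫⁻ y, ENNReal.ofReal (|φ x - φ y| ^ p * ‖x - y‖ ^ (-((N : ℝ) + s * p))) := by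
    refine le_trans (lintegral_mono_ae ?_) (setLIntegral_le_lintegral Ω _)
    have hΩ' : ∀ᵐ x ∂(volume.restrict Ω), x ∈ {x | 0 < levelFun hN ψ 0 x} := by
      refine ae_restrict_of_ae_restrict_of_subset hpos (ae_restrict_mem ?_)
      exact measurableSet_lt measurable_const hlm
    filter_upwards [hΩ'] with x hx
    calc _ = ENNReal.ofReal (|φ x| ^ p) *
          ENNReal.ofReal (c * levelFun hN ψ 0 x ^ (-(s * p))) := by
          rw [← ENNReal.ofReal_mul hc.le, ← ENNReal.ofReal_mul (by positivity)]
          ring_nf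
      _ ≤ ENNReal.ofReal (|φ x| ^ p) * ∫⁻ y in {y | levelFun hN ψ 0 y ≤ 0},
          ENNReal.ofReal (‖x - y‖ ^ (-((N : ℝ) + s * p))) := by gcongr; exact h x hx
      _ = ∫⁻ y in {y | levelFun hN ψ 0 y ≤ 0},
          ENNReal.ofReal (|φ x - φ y| ^ p * ‖x - y‖ ^ (-((N : ℝ) + s * p))) := by
          rw [← lintegral_const_mul' _ _ ENNReal.ofReal_ne_top]
          refine lintegral_congr_ae ?_
          filter_upwards [ae_restrict_mem hZ, ae_restrict_of_ae hφ.2] with y hy hy0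
          have : φ y = 0 := hy0 fun hyΩ => absurd (hpos y hyΩ) (not_lt.2 hy)
          rw [this, sub_zero, ENNReal.ofReal_mul (by positivity)]
      _ ≤ _ := setLIntegral_le_lintegral _ _
  rw [lintegral_const_mul' _ _ ENNReal.ofReal_ne_top] at hle
  by_contra hcon
  rw [not_lt, top_le_iff] at hcon
  rw [hcon, ENNReal.mul_top (by simpa using hc)] at hle
  exact absurd hfin (not_lt.2 hle)

/-- Since `-β = (α - s)(p - 1) - s`, Young's inequality splits the integrand into `L^{(α-s)p}` and
the Hardy term `|φ|^p L^{-sp}`. -/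
lemma DiffeoBounds.integrableOn_weight_mul (hb : DiffeoBounds ψ m M K R)
    (hs0 : 0 < s) (hp : 1 < p) (hμ : 0 ≤ μ) {Ω : Set (Euc N)}
    (hpos : ∀ x ∈ Ω, 0 < levelFun hN ψ 0 x) (hΩ : MeasurableSet Ω)
    (hfin : ∫⁻ y in Ω, ENNReal.ofReal (levelFun hN ψ μ y ^ ((α - s) * p)) < ⊤)
    {φ : Euc N → ℝ} (hφ : MemWspZero s p Ω φ) :
    IntegrableOn (fun x => levelFun hN ψ μ x ^ (-betaExp s p α) * φ x) Ω := by
  have hlm := hb.measurable_levelFun (hN := hN) μ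
  have hφm := hφ.aestronglyMeasurable
  refine ⟨(((hlm.pow_const _).aestronglyMeasurable).mul hφm).restrict, ?_⟩
  rw [hasFiniteIntegral_iff_norm]
  have hle : ∫⁻ x in Ω, ENNReal.ofReal ‖levelFun hN ψ μ x ^ (-betaExp s p α) * φ x‖ ≤
      ∫⁻ x in Ω, (ENNReal.ofReal (levelFun hN ψ μ x ^ ((α - s) * p)) +
        ENNReal.ofReal (|φ x| ^ p * levelFun hN ψ 0 x ^ (-(s * p)))) := by
    refine lintegral_mono_ae ?_
    filter_upwards [ae_restrict_mem hΩ] with x hx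
    have h0 := hpos x hx
    have hLe : levelFun hN ψ 0 x ≤ levelFun hN ψ μ x := by simp [levelFun, hμ]
    have hL : 0 < levelFun hN ψ μ x := lt_of_lt_of_le h0 hLe
    set L := levelFun hN ψ μ x
    set L₀ := levelFun hN ψ 0 x
    rw [← ENNReal.ofReal_add (by positivity) (by positivity)]
    refine ENNReal.ofReal_le_ofReal ?_
    have hy := rpow_mul_le_add_rpow hp (a := L ^ (α - s)) (b := |φ x| * L ^ (-s))
      (by positivity) (by positivity)
    rw [Real.norm_eq_abs, abs_mul, abs_of_pos (by positivity : 0 < L ^ (-betaExp s p α))]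
    have e1 : (L ^ (α - s)) ^ (p - 1) * (|φ x| * L ^ (-s)) = L ^ (-betaExp s p α) * |φ x| := by
      rw [← Real.rpow_mul hL.le, mul_left_comm, ← Real.rpow_add hL, mul_comm]
      congr 2
      unfold betaExp; ring
    rw [e1, ← Real.rpow_mul hL.le, Real.mul_rpow (abs_nonneg _) (by positivity),
      ← Real.rpow_mul hL.le, neg_mul] at hy
    refine hy.trans ?_
    -- Hardy's inequality concerns the unshifted level, which is the smaller one as `μ ≥ 0`, so its
    -- negative power is the larger.
    exact add_le_add_right (mul_le_mul_of_nonneg_left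
      (Real.rpow_le_rpow_of_nonpos h0 hLe (by nlinarith)) (by positivity)) _
  refine lt_of_le_of_lt hle ?_
  rw [lintegral_add_left ((hlm.pow_const _).ennreal_ofReal)]
  exact ENNReal.add_lt_top.2 ⟨hfin, hb.lintegral_hardy_lt_top hN hs0 hp hpos hφ⟩

lemma DiffeoBounds.integrable_farPairs (hb : DiffeoBounds ψ m M K R)
    (hs0 : 0 < s) (hs1 : s < 1) (hp : 1 < p) (hα0 : 0 < α) (hαs : α < s) {r : ℝ} (hr0 : 0 < r)
    (hr1 : r < 1) {Ω : Set (Euc N)} (hΩ : MeasurableSet Ω)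
    (hpos : ∀ x ∈ Ω, 0 < levelFun hN ψ μ x) {φ : Euc N → ℝ} (hφ : MemWspZero s p Ω φ)
    (hw : IntegrableOn (fun x => levelFun hN ψ μ x ^ (-betaExp s p α) * φ x) Ω) :
    Integrable ((farPairs hN ψ μ r).indicator fun z => barrierKernel hN s p α μ ψ z * φ z.1) := by
  obtain ⟨C, hC, h⟩ := hb.exists_lintegral_far_le hN hs0 hs1 hp hα0 hαs hr0 hr1
  have hφm := hφ.aestronglyMeasurable
  have hkm := hb.measurable_barrierKernel (hN := hN) (s := s) (p := p) (μ := μ) hα0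
  have hD := hb.measurableSet_farPairs (hN := hN) (μ := μ) r
  have hlm := hb.measurable_levelFun (hN := hN) μ
  have hmeas : AEStronglyMeasurable ((farPairs hN ψ μ r).indicator fun z =>
      barrierKernel hN s p α μ ψ z * φ z.1) :=
    (hkm.aestronglyMeasurable.mul hφm.comp_fst).indicator hD
  refine ⟨hmeas, ?_⟩
  rw [hasFiniteIntegral_iff_norm, Measure.volume_eq_prod, lintegral_prod _ (by
    exact hmeas.norm.aemeasurable.ennreal_ofReal)]
  have hle : ∀ᵐ x, ∫⁻ y, ENNReal.ofReal ‖(farPairs hN ψ μ r).indicator (fun z =>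
      barrierKernel hN s p α μ ψ z * φ z.1) (x, y)‖ ≤ Ω.indicator (fun x => ENNReal.ofReal C *
        ENNReal.ofReal ‖levelFun hN ψ μ x ^ (-betaExp s p α) * φ x‖) x := by
    filter_upwards [hφ.2] with x hx
    by_cases hxΩ : x ∈ Ω
    · have hL := hpos x hxΩ
      have hset : MeasurableSet {y | levelFun hN ψ μ y - levelFun hN ψ μ x ∈
          farSet r (levelFun hN ψ μ x)} := (hlm.sub_const _) (measurableSet_farSet _ _)
      have h1 := h μ x hL
      rw [← lintegral_indicator hset] at h1
      rw [Set.indicator_of_mem hxΩ]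
      calc _ ≤ ∫⁻ y, ENNReal.ofReal |φ x| * {y | levelFun hN ψ μ y - levelFun hN ψ μ x ∈
          farSet r (levelFun hN ψ μ x)}.indicator (fun y => ENNReal.ofReal
            (|posPow α (levelFun hN ψ μ x) - posPow α (levelFun hN ψ μ y)| ^ (p - 1) *
              ‖x - y‖ ^ (-((N : ℝ) + s * p)))) y := by
            refine lintegral_mono fun y => ?_
            by_cases hy : (x, y) ∈ farPairs hN ψ μ r
            · rw [Set.indicator_of_mem hy, Set.indicator_of_mem (by
                exact (mk_mem_farPairs x y).1 hy), ← ENNReal.ofReal_mul (abs_nonneg _)]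
              refine ENNReal.ofReal_le_ofReal (le_of_eq ?_)
              simp only [barrierKernel]
              rw [Real.norm_eq_abs, abs_mul, abs_mul, abs_oddPow hp, mul_comm,
                abs_of_nonneg (by positivity : 0 ≤ ‖x - y‖ ^ (-((N : ℝ) + s * p)))]
            · rw [Set.indicator_of_notMem hy]
              simp
        _ ≤ ENNReal.ofReal |φ x| * ENNReal.ofReal (C * levelFun hN ψ μ x ^ (-betaExp s p α)) := by
            rw [lintegral_const_mul' _ _ ENNReal.ofReal_ne_top]
            gcongr
        _ = _ := by
            rw [← ENNReal.ofReal_mul (abs_nonneg _), ← ENNReal.ofReal_mul hC.le, Real.norm_eq_abs,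
              abs_mul, abs_of_pos (by positivity : 0 < levelFun hN ψ μ x ^ (-betaExp s p α))]
            ring_nf
    · rw [Set.indicator_of_notMem hxΩ]
      simp [hx hxΩ, Set.indicator]
  refine lt_of_le_of_lt (lintegral_mono_ae hle) ?_
  rw [lintegral_indicator hΩ, lintegral_const_mul' _ _ ENNReal.ofReal_ne_top]
  exact ENNReal.mul_lt_top ENNReal.ofReal_lt_top ((hasFiniteIntegral_iff_norm _).1 hw.2)

/-- Truncating by the ratio of levels is invariant under exchanging the two points, and the kernel
changes sign, so the terms with `φ x` and `-φ y` have equal integrals. The truncation is what makes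
each of them integrable on its own. -/
lemma DiffeoBounds.integral_farPairs_energy (hb : DiffeoBounds ψ m M K R) {r : ℝ}
    {φ : Euc N → ℝ}
    (hi : Integrable
      ((farPairs hN ψ μ r).indicator fun z => barrierKernel hN s p α μ ψ z * φ z.1)) :
    ∫ z, (farPairs hN ψ μ r).indicator
      (energyIntegrand s p (fun x => posPow α (levelFun hN ψ μ x)) φ) z =
      2 * ∫ x, φ x *
        ∫ y in {y | levelFun hN ψ μ y - levelFun hN ψ μ x ∈ farSet r (levelFun hN ψ μ x)},
          barrierKernel hN s p α μ ψ (x, y) := by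
  set H := (farPairs hN ψ μ r).indicator fun z => barrierKernel hN s p α μ ψ z * φ z.1 with hH
  have hlm := hb.measurable_levelFun (hN := hN) μ
  rw [Measure.volume_eq_prod] at hi
  have hsw : Integrable (fun z => H z.swap) (volume.prod volume) := hi.swap
  have e1 : (farPairs hN ψ μ r).indicator
      (energyIntegrand s p (fun x => posPow α (levelFun hN ψ μ x)) φ) =
      fun z => H z + H z.swap := by
    ext z
    simp only [hH]
    by_cases hz : z ∈ farPairs hN ψ μ r
    · rw [Set.indicator_of_mem hz, Set.indicator_of_mem hz,
        Set.indicator_of_mem ((swap_mem_farPairs z).2 hz), energyIntegrand_eq, barrierKernel_swap]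
      simp only [Prod.fst_swap]
      ring
    · rw [Set.indicator_of_notMem hz, Set.indicator_of_notMem hz,
        Set.indicator_of_notMem (mt (swap_mem_farPairs z).1 hz), add_zero]
  rw [e1, Measure.volume_eq_prod, integral_add hi hsw, integral_prod_swap, ← two_mul,
    integral_prod _ hi]
  congr 1
  refine integral_congr_ae (.of_forall fun x => ?_)
  have hset : MeasurableSet {y | levelFun hN ψ μ y - levelFun hN ψ μ x ∈
      farSet r (levelFun hN ψ μ x)} := (hlm.sub_const _) (measurableSet_farSet _ _)
  simp only
  rw [← integral_indicator hset, ← integral_const_mul]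
  refine integral_congr_ae (.of_forall fun y => ?_)
  simp only [hH]
  by_cases hy : (x, y) ∈ farPairs hN ψ μ r
  · rw [Set.indicator_of_mem hy, Set.indicator_of_mem (by exact (mk_mem_farPairs x y).1 hy),
      mul_comm]
  · rw [Set.indicator_of_notMem hy, Set.indicator_of_notMem (by
      exact mt (mk_mem_farPairs x y).2 hy), mul_zero]

lemma eventually_mem_farPairs {z : Euc N × Euc N}
    (hne : posPow α (levelFun hN ψ μ z.1) ≠ posPow α (levelFun hN ψ μ z.2)) :
    ∀ᶠ r in nhdsWithin (1 : ℝ) (Set.Iio 1), z ∈ farPairs hN ψ μ r := by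
  have key : ∀ a b : ℝ, b < a → ∀ᶠ r in nhdsWithin (1 : ℝ) (Set.Iio 1), b ≤ r * a := by
    intro a b hab
    have hc : Filter.Tendsto (fun r : ℝ => r * a) (nhds 1) (nhds (1 * a)) :=
      (continuous_id.mul continuous_const).tendsto 1
    rw [one_mul] at hc
    filter_upwards [(hc.mono_left nhdsWithin_le_nhds).eventually (lt_mem_nhds hab)] with r hr
    exact hr.le
  rcases lt_trichotomy (levelFun hN ψ μ z.1) (levelFun hN ψ μ z.2) with h | h | h
  · filter_upwards [key _ _ h] with r hr using Or.inr hr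
  · exact absurd (by rw [h]) hne
  · filter_upwards [key _ _ h] with r hr using Or.inl hr

/-- Dominated convergence: a pair lost for every `r < 1` has equal barrier values, and there the
integrand is already zero. -/
theorem DiffeoBounds.tendsto_integral_farPairs (hb : DiffeoBounds ψ m M K R)
    {φ : Euc N → ℝ}
    (hi : Integrable (energyIntegrand s p (fun x => posPow α (levelFun hN ψ μ x)) φ)) :
    Filter.Tendsto (fun r => ∫ z, (farPairs hN ψ μ r).indicator
      (energyIntegrand s p (fun x => posPow α (levelFun hN ψ μ x)) φ) z)
      (nhdsWithin (1 : ℝ) (Set.Iio 1))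
      (nhds (∫ z, energyIntegrand s p (fun x => posPow α (levelFun hN ψ μ x)) φ z)) := by
  refine tendsto_integral_filter_of_dominated_convergence
    (fun z => ‖energyIntegrand s p (fun x => posPow α (levelFun hN ψ μ x)) φ z‖) ?_ ?_ hi.norm ?_
  · exact .of_forall fun r =>
      hi.aestronglyMeasurable.indicator (hb.measurableSet_farPairs r)
  · exact .of_forall fun r => .of_forall fun z => norm_indicator_le_norm_self _ _
  · refine .of_forall fun z => ?_
    by_cases hz : posPow α (levelFun hN ψ μ z.1) = posPow α (levelFun hN ψ μ z.2)
    · have h0 : energyIntegrand s p (fun x => posPow α (levelFun hN ψ μ x)) φ z = 0 := by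
        simp [energyIntegrand, hz, oddPow]
      have : ∀ r, (farPairs hN ψ μ r).indicator
          (energyIntegrand s p (fun x => posPow α (levelFun hN ψ μ x)) φ) z = 0 := fun r => by
        by_cases hr : z ∈ farPairs hN ψ μ r
        · rw [Set.indicator_of_mem hr, h0]
        · rw [Set.indicator_of_notMem hr]
      simp only [this, h0]
      exact tendsto_const_nhds
    · refine tendsto_const_nhds.congr' ?_
      filter_upwards [eventually_mem_farPairs hz] with r hr
      rw [Set.indicator_of_mem hr]

/-- Two-sided bounds for the weak form of the operator at the transported barrier. -/
theorem DiffeoBounds.exists_weak_bounds (hb : DiffeoBounds ψ m M K R) (hN : 1 ≤ N)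
    (hs0 : 0 < s) (hs1 : s < 1) (hp : 1 < p) (hα0 : 0 < α) (hαs : α < s) :
    ∃ l c C : ℝ, 0 < l ∧ 0 < c ∧ 0 < C ∧ ∀ (μ : ℝ) (Ω : Set (Euc N)), 0 ≤ μ → MeasurableSet Ω →
      (∀ x ∈ Ω, 0 < levelFun hN ψ 0 x ∧ levelFun hN ψ μ x < l) →
      LevelAdmissible hN ψ μ ((α - s) * p) Ω →
      ∀ φ : Euc N → ℝ, MemWspZero s p Ω φ → (∀ᵐ x, 0 ≤ φ x) →
        Integrable (energyIntegrand s p (fun x => posPow α (levelFun hN ψ μ x)) φ) ∧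
        IntegrableOn (fun x => levelFun hN ψ μ x ^ (-betaExp s p α) * φ x) Ω ∧
        c * ∫ x in Ω, levelFun hN ψ μ x ^ (-betaExp s p α) * φ x ≤
          ∫ z, energyIntegrand s p (fun x => posPow α (levelFun hN ψ μ x)) φ z ∧
        ∫ z, energyIntegrand s p (fun x => posPow α (levelFun hN ψ μ x)) φ z ≤
          C * ∫ x in Ω, levelFun hN ψ μ x ^ (-betaExp s p α) * φ x := by
  obtain ⟨l, c, C, hl, hc, hC, hbd⟩ := hb.exists_bounds_truncated hN hs0 hs1 hp hα0 hαs
  refine ⟨l, 2 * c, 2 * C, hl, by positivity, by positivity,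
    fun μ Ω hμ hΩ hlev hadm φ hφ hφ0 => ?_⟩
  have hpos : ∀ x ∈ Ω, 0 < levelFun hN ψ μ x := fun x hx => by
    have := (hlev x hx).1
    simp only [levelFun] at this ⊢
    linarith
  have hfin : ∫⁻ y in Ω, ENNReal.ofReal (levelFun hN ψ μ y ^ ((α - s) * p)) < ⊤ := by
    obtain ⟨U, -, -, hU, hf⟩ := hadm
    exact lt_of_le_of_lt (lintegral_mono_set fun x hx =>
      Set.mem_inter (hU (subset_closure hx)) (hpos x hx)) hf
  have hE := hb.integrable_energy hs0 hs1 hp hα0 hαs hΩ hpos hfin hφ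
  have hw := hb.integrableOn_weight_mul hs0 hp hμ (fun x hx => (hlev x hx).1) hΩ hfin hφ
  have hlim := hb.tendsto_integral_farPairs hE
  -- The pointwise bounds on the truncated operator are multiplied by `φ ≥ 0`; the constants do not
  -- involve `r`, so they pass to the limit.
  have hbounds : ∀ r : ℝ, 0 < r → r < 1 →
      2 * c * ∫ x in Ω, levelFun hN ψ μ x ^ (-betaExp s p α) * φ x ≤
        ∫ z, (farPairs hN ψ μ r).indicator
          (energyIntegrand s p (fun x => posPow α (levelFun hN ψ μ x)) φ) z ∧
      ∫ z, (farPairs hN ψ μ r).indicator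
          (energyIntegrand s p (fun x => posPow α (levelFun hN ψ μ x)) φ) z ≤
        2 * C * ∫ x in Ω, levelFun hN ψ μ x ^ (-betaExp s p α) * φ x := by
    intro r hr0 hr1
    have hH := hb.integrable_farPairs hs0 hs1 hp hα0 hαs hr0 hr1 hΩ hpos hφ hw
    have hlm := hb.measurable_levelFun (hN := hN) μ
    rw [hb.integral_farPairs_energy hH]
    set g : Euc N → ℝ := fun x =>
      ∫ y in {y | levelFun hN ψ μ y - levelFun hN ψ μ x ∈ farSet r (levelFun hN ψ μ x)},
          barrierKernel hN s p α μ ψ (x, y) with hg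
    have hgi : Integrable fun x => φ x * g x := by
      rw [Measure.volume_eq_prod] at hH
      refine hH.integral_prod_left.congr (.of_forall fun x => ?_)
      have hset : MeasurableSet {y | levelFun hN ψ μ y - levelFun hN ψ μ x ∈
          farSet r (levelFun hN ψ μ x)} := (hlm.sub_const _) (measurableSet_farSet _ _)
      simp only [hg]
      rw [← integral_indicator hset, ← integral_const_mul]
      refine integral_congr_ae (.of_forall fun y => ?_)
      simp only
      by_cases hy : (x, y) ∈ farPairs hN ψ μ r
      · rw [Set.indicator_of_mem hy, Set.indicator_of_mem (by exact (mk_mem_farPairs x y).1 hy),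
          mul_comm]
      · rw [Set.indicator_of_notMem hy, Set.indicator_of_notMem (by
          exact mt (mk_mem_farPairs x y).2 hy), mul_zero]
    have hrestr : ∫ x, φ x * g x = ∫ x in Ω, φ x * g x := by
      rw [← integral_indicator hΩ]
      refine integral_congr_ae ?_
      filter_upwards [hφ.2] with x hx
      by_cases hxΩ : x ∈ Ω
      · rw [Set.indicator_of_mem hxΩ]
      · rw [Set.indicator_of_notMem hxΩ, hx hxΩ, zero_mul]
    rw [hrestr, mul_assoc, mul_assoc, ← integral_const_mul c, ← integral_const_mul C]
    constructor
    · refine mul_le_mul_of_nonneg_left (integral_mono_ae (hw.const_mul c) hgi.integrableOn ?_)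
        zero_le_two
      filter_upwards [ae_restrict_mem hΩ, ae_restrict_of_ae hφ0] with x hx hx0
      have := (hbd μ x r hr0 hr1 (hpos x hx) (hlev x hx).2).1
      calc _ = φ x * (c * levelFun hN ψ μ x ^ (-betaExp s p α)) := by ring
        _ ≤ _ := mul_le_mul_of_nonneg_left this hx0
    · refine mul_le_mul_of_nonneg_left (integral_mono_ae hgi.integrableOn (hw.const_mul C) ?_)
        zero_le_two
      filter_upwards [ae_restrict_mem hΩ, ae_restrict_of_ae hφ0] with x hx hx0
      have := (hbd μ x r hr0 hr1 (hpos x hx) (hlev x hx).2).2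
      calc _ ≤ φ x * (C * levelFun hN ψ μ x ^ (-betaExp s p α)) :=
            mul_le_mul_of_nonneg_left this hx0
        _ = _ := by ring
  have hev : ∀ᶠ r in nhdsWithin (1 : ℝ) (Set.Iio 1), 0 < r ∧ r < 1 :=
    Ioo_mem_nhdsLT (zero_lt_one' ℝ)
  refine ⟨hE, hw, ge_of_tendsto hlim ?_, le_of_tendsto hlim ?_⟩
  · filter_upwards [hev] with r hr using (hbounds r hr.1 hr.2).1
  · filter_upwards [hev] with r hr using (hbounds r hr.1 hr.2).2

end

/-! ### Conclusion in terms of `W_λ` -/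

lemma barrierW_eq {N : ℕ} (hN : 1 ≤ N) (α lam : ℝ) (ψ : Euc N ≃ Euc N) :
    barrierW hN α lam ψ = fun x => posPow α (levelFun hN ψ (lam ^ (1 / α)) x) := rfl

lemma mem_imageStrip_iff {N : ℕ} (hN : 1 ≤ N) (ψ : Euc N ≃ Euc N) (ρ : ℝ) (x : Euc N) :
    x ∈ imageStrip hN ψ ρ ↔ 0 < levelFun hN ψ 0 x ∧ levelFun hN ψ 0 x < ρ := by
  simp only [imageStrip, levelFun, add_zero]
  constructor
  · rintro ⟨X, hX, rfl⟩
    simpa using hX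
  · intro h
    exact ⟨ψ.symm x, h, by simp⟩

lemma rpow_posPow {α β L : ℝ} (hα : 0 < α) (hL : 0 < L) :
    posPow α L ^ (-(β / α)) = L ^ (-β) := by
  rw [posPow_of_pos hL, ← Real.rpow_mul hL.le]
  congr 1
  field_simp

theorem DiffeoBounds.exists_isEWeak {N : ℕ} {s p α : ℝ} {ψ : Euc N ≃ Euc N} {m M K R : ℝ}
    (hb : DiffeoBounds ψ m M K R) (hN : 1 ≤ N) (hs0 : 0 < s) (hs1 : s < 1) (hp : 1 < p)
    (hα0 : 0 < α) (hαs : α < s) :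
    ∃ l C : ℝ, 0 < l ∧ 0 < C ∧ ∀ (lam : ℝ) (Ω : Set (Euc N)), 0 ≤ lam → IsOpen Ω →
      (∀ x ∈ Ω, 0 < levelFun hN ψ 0 x ∧ levelFun hN ψ (lam ^ (1 / α)) x < l) →
      LevelAdmissible hN ψ (lam ^ (1 / α)) ((α - s) * p) Ω →
      IsEWeakSuperBdd s p Ω (barrierW hN α lam ψ)
        (fun x => 1 / C * barrierW hN α lam ψ x ^ (-(betaExp s p α / α))) ∧
      IsEWeakSubBdd s p Ω (barrierW hN α lam ψ)
        (fun x => C * barrierW hN α lam ψ x ^ (-(betaExp s p α / α))) := by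
  obtain ⟨l, c, C, hl, hc, hC, h⟩ := hb.exists_weak_bounds hN hs0 hs1 hp hα0 hαs
  -- One constant serves both sides: it is at least `C`, and its inverse is at most `c`.
  refine ⟨l, max C (1 / c), hl, by positivity, fun lam Ω hlam hΩ hlev hadm => ?_⟩
  have hμ : 0 ≤ lam ^ (1 / α) := Real.rpow_nonneg hlam _
  have hmem := hb.memWspBar_barrier hs0 hs1 hp hα0 hαs hadm
  have hC0 : 0 < max C (1 / c) := by positivity
  have hcle : 1 / max C (1 / c) ≤ c := by
    rw [div_le_iff₀ hC0, ← div_le_iff₀' hc]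
    exact le_max_right _ _
  rw [barrierW_eq]
  set μ := lam ^ (1 / α)
  have hpos : ∀ x ∈ Ω, 0 < levelFun hN ψ μ x := fun x hx => by
    have := (hlev x hx).1
    simp only [levelFun] at this ⊢
    linarith
  have hrew : ∀ (A : ℝ) (φ : Euc N → ℝ), Set.EqOn
      (fun x => A * (levelFun hN ψ μ x ^ (-betaExp s p α) * φ x))
      (fun x => A * posPow α (levelFun hN ψ μ x) ^ (-(betaExp s p α / α)) * φ x) Ω := by
    intro A φ x hx
    simp only
    rw [rpow_posPow hα0 (hpos x hx), mul_assoc]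
  have hint0 : ∀ φ : Euc N → ℝ, (∀ᵐ x, 0 ≤ φ x) →
      0 ≤ ∫ x in Ω, levelFun hN ψ μ x ^ (-betaExp s p α) * φ x := by
    intro φ hφ0
    refine integral_nonneg_of_ae ?_
    filter_upwards [ae_restrict_mem hΩ.measurableSet, ae_restrict_of_ae hφ0] with x hx hx0
    exact mul_nonneg (Real.rpow_nonneg (hpos x hx).le _) hx0
  refine ⟨⟨hmem, fun φ hφ hφ0 => ?_⟩, ⟨hmem, fun φ hφ hφ0 => ?_⟩⟩
  · obtain ⟨hE, hw, hlow, -⟩ := h μ Ω hμ hΩ.measurableSet hlev hadm φ hφ hφ0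
    refine ⟨hE, IntegrableOn.congr_fun (hw.const_mul _) (hrew _ φ) hΩ.measurableSet, ?_⟩
    rw [← setIntegral_congr_fun hΩ.measurableSet (hrew _ φ), integral_const_mul]
    exact (mul_le_mul_of_nonneg_right hcle (hint0 φ hφ0)).trans hlow
  · obtain ⟨hE, hw, -, hupp⟩ := h μ Ω hμ hΩ.measurableSet hlev hadm φ hφ hφ0
    refine ⟨hE, IntegrableOn.congr_fun (hw.const_mul _) (hrew _ φ) hΩ.measurableSet, ?_⟩
    rw [← setIntegral_congr_fun hΩ.measurableSet (hrew _ φ), integral_const_mul]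
    exact hupp.trans (mul_le_mul_of_nonneg_right (le_max_left _ _) (hint0 φ hφ0))

end FracPLaplace

end

theorem theorem3p4 (N : ℕ) (hN : 1 ≤ N) (s p α : ℝ) (hs0 : 0 < s) (hs1 : s < 1) (hp : 1 < p)
    (hα0 : 0 < α) (hαs : α < s)
    (ψ : FracPLaplace.Euc N ≃ FracPLaplace.Euc N) (hψ : FracPLaplace.IsC11Diffeo ψ)
    (hψid : ∃ R : ℝ, 0 < R ∧ ∀ x : FracPLaplace.Euc N, R ≤ ‖x‖ → ψ x = x) :
    ∃ ρstar : ℝ, 0 < ρstar ∧ ∃ lamstar : ℝ, 0 < lamstar ∧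
      ∀ ρ : ℝ, 0 < ρ → ρ < ρstar →
        ∃ C : ℝ, 0 < C ∧ ∀ lam : ℝ, 0 ≤ lam → lam ≤ lamstar →
          ((0 < lam ∨ s - 1 / p < α) →
            FracPLaplace.IsEWeakSuper s p (FracPLaplace.imageStrip hN ψ ρ)
              (FracPLaplace.barrierW hN α lam ψ)
              (fun x => 1 / C *
                FracPLaplace.barrierW hN α lam ψ x ^ (-(FracPLaplace.betaExp s p α / α))) ∧
            FracPLaplace.IsEWeakSub s p (FracPLaplace.imageStrip hN ψ ρ)
              (FracPLaplace.barrierW hN α lam ψ)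
              (fun x => C *
                FracPLaplace.barrierW hN α lam ψ x ^ (-(FracPLaplace.betaExp s p α / α)))) ∧
          (∀ Ω' : Set (FracPLaplace.Euc N), IsOpen Ω' → IsCompact (closure Ω') →
            closure Ω' ⊆ FracPLaplace.imageStrip hN ψ ρ →
            FracPLaplace.IsEWeakSuperBdd s p Ω'
              (FracPLaplace.barrierW hN α lam ψ)
              (fun x => 1 / C *
                FracPLaplace.barrierW hN α lam ψ x ^ (-(FracPLaplace.betaExp s p α / α))) ∧
            FracPLaplace.IsEWeakSubBdd s p Ω'
              (FracPLaplace.barrierW hN α lam ψ)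
              (fun x => C *
                FracPLaplace.barrierW hN α lam ψ x ^ (-(FracPLaplace.betaExp s p α / α)))) := by
  open FracPLaplace in
  obtain ⟨R, hR0, hR⟩ := hψid
  obtain ⟨m, M, K, hb⟩ := hψ.exists_bounds hR0 hR
  obtain ⟨l, C, hl, hC, h⟩ := hb.exists_isEWeak hN hs0 hs1 hp hα0 hαs
  -- With `ρ < l/2` and `λ^{1/α} ≤ l/2` the shifted level stays below `l` on the strip. The constant
  -- `C` obtained does not even depend on `ρ`.
  refine ⟨l / 2, by positivity, (l / 2) ^ α, by positivity, fun ρ hρ0 hρ =>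
    ⟨C, hC, fun lam hlam0 hlam => ?_⟩⟩
  have hμ0 : 0 ≤ lam ^ (1 / α) := Real.rpow_nonneg hlam0 _
  have hμ : lam ^ (1 / α) ≤ l / 2 := by
    calc _ ≤ ((l / 2) ^ α) ^ (1 / α) := by gcongr
      _ = l / 2 := by
        rw [← Real.rpow_mul (by positivity), mul_one_div_cancel hα0.ne', Real.rpow_one]
  have hadd : ∀ x, levelFun hN ψ (lam ^ (1 / α)) x = levelFun hN ψ 0 x + lam ^ (1 / α) := fun x => by
    simp [levelFun]
  have hlev : ∀ Ω : Set (Euc N), Ω ⊆ imageStrip hN ψ ρ → ∀ x ∈ Ω,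
      0 < levelFun hN ψ 0 x ∧ levelFun hN ψ (lam ^ (1 / α)) x < l := fun Ω hΩ x hx => by
    obtain ⟨h1, h2⟩ := (mem_imageStrip_iff hN ψ ρ x).1 (hΩ hx)
    rw [hadd]
    exact ⟨h1, by linarith⟩
  have he : (α - s) * p ≤ 0 := by nlinarith
  have hc := hb.continuous_levelFun (hN := hN) 0
  refine ⟨fun hcase => ?_, fun Ω hΩo hΩc hΩs => ?_⟩
  · have key : ∀ Ω : Set (Euc N), IsOpen Ω → Bornology.IsBounded Ω → Ω ⊆ imageStrip hN ψ ρ →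
        LevelAdmissible hN ψ (lam ^ (1 / α)) ((α - s) * p) Ω := by
      intro Ω hΩo hΩb hΩs
      -- For `λ = 0` the condition `α > s - 1/p` is exactly `(α - s)p > -1`. For `λ > 0` the shifted
      -- level is at least `λ^{1/α}` on the closure, which may touch level zero.
      rcases hlam0.eq_or_lt with h0 | h0
      · have hα : s - 1 / p < α := hcase.resolve_left (by rw [← h0]; exact lt_irrefl _)
        rw [← h0, Real.zero_rpow (by positivity)]
        refine levelAdmissible_zero hb hΩb ?_
        have hp0 : 0 < p := by linarith
        have h1 : (s - α) * p < 1 / p * p := by gcongr; linarith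
        rw [one_div_mul_cancel hp0.ne'] at h1
        linarith
      · refine levelAdmissible_of_le hb hΩb (Real.rpow_pos_of_pos h0 (1 / α)) he fun x hx => ?_
        have hcl : closure Ω ⊆ {x | 0 ≤ levelFun hN ψ 0 x} :=
          closure_minimal (fun y hy => (hlev Ω hΩs y hy).1.le) (isClosed_le continuous_const hc)
        have := hcl hx
        rw [hadd]
        simp only [Set.mem_ofPred_eq] at this
        linarith
    exact ⟨fun Ω hΩo hΩb hΩs => (h lam Ω hlam0 hΩo (hlev Ω hΩs) (key Ω hΩo hΩb hΩs)).1,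
      fun Ω hΩo hΩb hΩs => (h lam Ω hlam0 hΩo (hlev Ω hΩs) (key Ω hΩo hΩb hΩs)).2⟩
  · refine h lam Ω hlam0 hΩo (hlev Ω (subset_closure.trans hΩs)) ?_
    -- Compactness keeps the level away from zero even when `λ = 0`.
    obtain ⟨δ, hδ, hδle⟩ : ∃ δ : ℝ, 0 < δ ∧ ∀ x ∈ closure Ω, δ ≤ levelFun hN ψ 0 x := by
      rcases (closure Ω).eq_empty_or_nonempty with hem | hne
      · exact ⟨1, one_pos, by simp [hem]⟩
      obtain ⟨x₀, hx₀, hmin⟩ := hΩc.exists_isMinOn hne hc.continuousOn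
      exact ⟨_, ((mem_imageStrip_iff hN ψ ρ x₀).1 (hΩs hx₀)).1, fun x hx => hmin hx⟩
    refine levelAdmissible_of_le hb (hΩc.isBounded.subset subset_closure) hδ he fun x hx => ?_
    rw [hadd]
    linarith [hδle x hx]
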